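/- **Setting.** Fix $d\ge 1$. A data set is a finite $P\subset\mathbb R^d$; $P,P'$ are neighbouring if $|P\triangle P'|=1$, and a randomized algorithm $\mathcal A$ is $(\epsilon,\delta)$-DP if $\Pr[\mathcal A(P)\in S]\le e^{\epsilon}\Pr[\mathcal A(P')\in S]+\delta$ for all neighbouring $P,P'$ and all sets $S$ of outputs. The Tukey depth of $x$ is $\mathrm{TD}(x,P)=\min_{\|u\|=1}|\{p\in P:\langle p,u\rangle\le\langle x,u\rangle\}|$, and $D_P(\kappa)=\{x:\mathrm{TD}(x,P)\ge\kappa\}$. Let $b\geq 1$, let $\mathcal G=\{m2^{-b}:0\le m\le 2^b\}$, and let $\upsilon=4d^4b$. **Subroutines.** (1) A quasi-concave maximizer $\mathsf M_{\epsilon,\delta,\beta}$ gets a finite $G\subset\mathbb R$ and a quasi-concave $q:\mathbb R\to\mathbb R$. It is $(\epsilon,\delta)$-private if its output distributions on $G$ and any two quasi-concave $q,q'$ with $\|q-q'\|_\infty\le1$ are $(\epsilon,\delta)$-indistinguishable. It has accuracy $\alpha^{\rm qc}(\epsilon,\delta,\beta)$ if for every nonempty $G$ with $|G|\le2^\upsilon$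 and every quasi-concave $q$, with probability at least $1-\beta$, it returns $x\in G$ with $q(x)\ge\max_Gq-\alpha^{\rm qc}$. The *binary search* is the maximizer that repeatedly halves the sorted list $G$, keeping a half with probability proportional to its total weight, where $x$ has weight $e^{\epsilon q(x)/2}$. (2) The sparse vector technique $\mathsf{SVT}_\epsilon(\tau;q_0,\dots,q_{m-1})$ draws independent $X,Y_0,\dots,Y_{m-1}\sim\mathrm{Lap}(3/\epsilon)$ and returns the first $i$ with $q_i+Y_i\ge\tau+X$, if there is one. For a linear map $A:\mathbb R^d\to\mathbb R^j$ and a prefix $y=(y_1,\dots,y_i)$, $0\le i<j$, let $\mathrm{TDC}^A_y(x)$ be the largest integer $k$ such that some $p\in D_P(k)$ has $Ap=(y_1,\dots,y_i,x,*,\dots,*)$ ($0$ if there is none). The refined grid $\mathcal G'_{A,y}$ consists of $\mathcal G$ and of all end points of the intervals $\{x:\mathrm{TDC}^A_y(x)\ge k\}$, $k\ge1$, over all data sets in $\mathcal G^d$. For each unit vector $v$ let $R_v$ be a fixed linear isometry with $R_vv=e_1$. **The private recursive bounding-box algorithm** has parameters $\epsilon,\delta,\beta,\kappa$. Put $k=d^2+2d-1$,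 $\epsilon_0=\epsilon/k$, $\delta_0=\delta/k$, $\beta_0=\beta/k$. Fix in every dimension $j$ a finite $\arccos(9/10)$-angle cover $V_j$ of the unit sphere (a set of unit vectors such that each unit vector has angle at most $\arccos(9/10)$ with one of them) and a finite $\sqrt{1/20}$-angle cover $W_j$. Put $T=\lceil10(2\upsilon+\ln d)\rceil$, $\ell_i=\sqrt d\,(19/20)^i$, and $\Delta^{\rm diam}=\frac{12}{\epsilon_0}\ln\frac{T+2}{\beta_0}$. Start with $j=d$ and $A=\mathrm{id}$. In dimension $j$: - Find the coordinates of a point $s\in\mathbb R^j$ one by one: given the prefix $y$, apply $\mathsf M_{\epsilon_0,\delta_0,\beta_0}$ to $\mathrm{TDC}^A_y$ on $\mathcal G'_{A,y}$. - Run $\mathsf{SVT}_{\epsilon_0}$ with threshold $\kappa-\frac6{\epsilon_0}\ln\frac{T+2}{\beta_0}$ on the queries $\max_{v\in W_j}\max_x\min\{\mathrm{TDC}^{R_vA}(x),\mathrm{TDC}^{R_vA}(x+\ell_i)\}$ (empty prefix), $0\le i\le T$. Let $\ell=\ell_i$ if it returns $i$, and $\ell=0$ otherwise. - If $j=1$,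 return $[s-\frac{10}9\ell,s+\frac{10}9\ell]$. - Run $\mathsf{SVT}_{\epsilon_0}$ with threshold $\kappa-\Delta^{\rm diam}-\frac6{\epsilon_0}\ln\frac{|V_j|+1}{\beta_0}$ on the queries $\mathrm{TDC}^{R_vA}(\langle s,v\rangle+0.45\ell)$, $v\in V_j$, to get $v\in V_j$. By $j-1$ calls to $\mathsf M_{\epsilon_0,\delta_0,\beta_0}$ as above, complete the first coordinate $\langle s,v\rangle+0.45\ell$ in the $R_v$-rotated basis to a point $t$. Put $u=(t-s)/\|t-s\|$ ($u=e_1$ if no $v$ was found or $t=s$). - Put $I_j=[\langle s,u\rangle-\frac{10}9\ell,\langle s,u\rangle+\frac{10}9\ell]$ in direction $u$. Replace $A$ by its composition with the orthogonal projection onto $u^\perp\cong\mathbb R^{j-1}$ (apply $R_u$ and drop the first coordinate), recurse in dimension $j-1$ to get a box $B'$, and return the box with side $I_j$ in direction $u$ and base $B'$ in $u^\perp$. **Theorem.** Let $\epsilon>0$, $\delta\ge0$, $0<\beta<1$, $\kappa\in\mathbb R$, and let $\mathsf M_{\epsilon_0,\delta_0,\beta_0}$ be $(\epsilon_0,\delta_0)$-private.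 (a) The algorithm is $(\epsilon,\delta)$-DP. (b) Suppose in addition that $\mathsf M_{\epsilon_0,\delta_0,\beta_0}$ has accuracy $\alpha^{\rm qc}=\alpha^{\rm qc}(\epsilon_0,\delta_0,\beta_0)$ with failure probability $\beta_0$, that $\kappa>0$, $P\subset\mathcal G^d$, $D_P(\kappa)$ has positive volume, and $D_P(\kappa+d\,\alpha^{\rm qc})\neq\emptyset$. Then with probability at least $1-\beta$ the algorithm returns a box $B$ with $$D_P(\kappa)\subset B,\qquad \mathrm{vol}(D_P(\kappa))\le\mathrm{vol}(B)\le5^d\,d!\,\mathrm{vol}\bigl(D_P(\kappa-\Delta^{\rm BB})\bigr),$$ $$\Delta^{\rm BB}=\frac{12}{\epsilon_0}\ln\frac{T+2}{\beta_0}+\frac{12}{\epsilon_0}\ln\frac{m+1}{\beta_0}+d\,\alpha^{\rm qc},$$ where $m$ is any number with $|V_j|\le m$ for all $j\le d$. (c) For all $\epsilon>0$ and $0<\beta<1$ the binary search is $(\epsilon,0)$-private with accuracy $\alpha^{\rm qc}=2(\upsilon\ln2+\ln(1/\beta))/\epsilon$. Suppose $|V_j|\le K^j$ for all $j\le d$,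 with a constant $K$, and take $m=K^d$ in (b). With constants that depend only on $K$ (and on the constants in the bounds assumed for $\alpha^{\rm qc}$): - With the binary search, the algorithm is $(\epsilon,0)$-DP and $\Delta^{\rm BB}=O\bigl(d^3(\upsilon+\log(d/\beta))/\epsilon\bigr)$, and (b) also holds with this upper bound in place of $\Delta^{\rm BB}$. - With a maximizer of accuracy $\tilde O(\log(\upsilon/\beta_0\epsilon_0\delta_0)/\epsilon_0)$ ("Between Thresholds"), $\epsilon\le1$, $0<\delta\le1$: $\Delta^{\rm BB}=\tilde O\bigl(d^3\log(d\upsilon/\epsilon\delta\beta)/\epsilon\bigr)$, where $\tilde O(L)$ means $O(L\log^c(2+L))$ with the same $c$ in both. - With a maximizer of accuracy $O\bigl(8^{\log^*\upsilon}\log^*(\upsilon)\log(\log^*(\upsilon)/\beta_0\delta_0)/\epsilon_0\bigr)$ ("RecConcave"), $0<\delta\le1$: $\Delta^{\rm BB}=O\bigl(d^3\log(d\upsilon/\beta)/\epsilon+d^38^{\log^*\upsilon}\log^*(\upsilon)\log(d\log^*(\upsilon)/\delta\beta)/\epsilon\bigr)$. -/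

import Mathlib

open MeasureTheory

noncomputable section

/-! ### Data sets, Tukey depth and Tukey regions -/

/-- Euclidean space of dimension `d`. -/
abbrev E (d : ℕ) : Type := EuclideanSpace ℝ (Fin d)

/-- Tukey depth: the least number of data points in a closed halfspace
`{p | ⟨p, u⟩ ≤ ⟨x, u⟩}`, over all unit vectors `u`. -/
def tukeyDepth {d : ℕ} (P : Finset (E d)) (x : E d) : ℕ :=
  sInf {n : ℕ | ∃ u : E d, ‖u‖ = 1 ∧
    n = {p : E d | p ∈ P ∧ inner ℝ p u ≤ inner ℝ x u}.ncard}

/-- The `κ`-Tukey region `D_P(κ)`. -/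
def tukeyRegion {d : ℕ} (P : Finset (E d)) (κ : ℝ) : Set (E d) :=
  {x | κ ≤ (tukeyDepth P x : ℝ)}

/-- The grid of granularity `2^(-b)` in `[0,1]`. -/
def gridLine (b : ℕ) : Set ℝ := {x | ∃ m : ℕ, m ≤ 2 ^ b ∧ x = (m : ℝ) / 2 ^ b}

/-- The grid of granularity `2^(-b)` in the cube `[0,1]^d`. -/
def gridPoints (d b : ℕ) : Set (E d) := {p | ∀ i, p i ∈ gridLine b}

/-! ### Differential privacy -/

/-- The probability of the event `S` under the discrete distribution `p`. -/
def prob {Ω : Type} (p : PMF Ω) (S : Set Ω) : ENNReal := p.toOuterMeasure S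

/-- `(ε, δ)`-indistinguishability of `p` from `p'` (one direction). -/
def CloseTo {Ω : Type} (ε δ : ℝ) (p p' : PMF Ω) : Prop :=
  ∀ S : Set Ω, prob p S ≤ ENNReal.ofReal (Real.exp ε) * prob p' S + ENNReal.ofReal δ

/-- Two data sets are neighbouring if they differ in a single point. -/
def Neighbouring {d : ℕ} (P P' : Finset (E d)) : Prop :=
  (symmDiff (P : Set (E d)) (P' : Set (E d))).ncard = 1

/-- `(ε, δ)`-differential privacy of a randomized algorithm on finite data sets. -/
def IsDP {d : ℕ} {Ω : Type} (M : Finset (E d) → PMF Ω) (ε δ : ℝ) : Prop :=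
  ∀ P P' : Finset (E d), Neighbouring P P' → CloseTo ε δ (M P) (M P')

/-! ### Private maximization of a quasi-concave function over a grid -/

/-- A randomized algorithm that gets a finite set of candidates and a score function. -/
abbrev QCAlgorithm : Type := Finset ℝ → (ℝ → ℝ) → PMF ℝ

/-- Privacy: the scores of two neighbouring data sets are two quasi-concave functions
that differ by at most `1` everywhere. -/
def QCPrivate (M : QCAlgorithm) (ε δ : ℝ) : Prop :=
  ∀ (G : Finset ℝ) (q q' : ℝ → ℝ), QuasiconcaveOn ℝ Set.univ q → QuasiconcaveOn ℝ Set.univ q' →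
    (∀ x, |q x - q' x| ≤ 1) → CloseTo ε δ (M G q) (M G q')

/-- Accuracy `α` with failure probability `β` on all grids with at most `2^υ` points. -/
def QCAccurate (M : QCAlgorithm) (υ : ℕ) (β α : ℝ) : Prop :=
  ∀ (G : Finset ℝ) (q : ℝ → ℝ), G.Nonempty → G.card ≤ 2 ^ υ → QuasiconcaveOn ℝ Set.univ q →
    ENNReal.ofReal (1 - β) ≤ prob (M G q) {x | x ∈ G ∧ ∀ y ∈ G, q y - α ≤ q x}

/-- A coin that shows `true` with probability `p` (for `p ≤ 1`). -/
def coin (p : NNReal) : PMF Bool :=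
  PMF.ofFintype (fun b => ((cond b (min p 1) (1 - min p 1) : NNReal) : ENNReal)) (by
    rw [Fintype.sum_bool, cond_true, cond_false, ← ENNReal.coe_add,
      add_tsub_cancel_of_le (min_le_right p 1), ENNReal.coe_one])

/-- Randomized bisection: `r` rounds, each of which keeps one of the two halves of the current
list of candidates, a half being kept with probability proportional to its total weight. -/
def bisect (w : ℝ → ℝ) : ℕ → List ℝ → PMF ℝ
  | 0, L => PMF.pure (L.headD 0)
  | r + 1, L =>
    if L.length ≤ 1 then PMF.pure (L.headD 0)
    else
      let L₁ := L.take (L.length / 2)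
      let L₂ := L.drop (L.length / 2)
      (coin (Real.toNNReal ((L₁.map w).sum / ((L₁.map w).sum + (L₂.map w).sum)))).bind fun left =>
        bisect w r (if left then L₁ else L₂)

/-- The `ε`-differentially private binary search on the sorted grid; the weight of a candidate
`x` is `exp(ε q(x) / 2)`. -/
def binarySearch (ε : ℝ) : QCAlgorithm := fun G q =>
  bisect (fun x => Real.exp (ε * q x / 2)) (Nat.clog 2 G.card) (G.sort (· ≤ ·))

/-- The accuracy of the binary search. -/
def alphaBinary (υ : ℕ) (ε β : ℝ) : ℝ := 2 * (υ * Real.log 2 + Real.log (1 / β)) / ε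

/-! ### Laplace noise and the sparse vector technique -/

/-- The Laplace distribution of scale `1`. -/
def stdLaplace : Measure ℝ :=
  volume.withDensity fun x => ENNReal.ofReal (Real.exp (-|x|) / 2)

theorem stdLaplace_integral : ∫ x : ℝ, Real.exp (-|x|) / 2 = 1 := by
  rw [integral_comp_abs (f := fun x => Real.exp (-x) / 2), integral_div,
    integral_exp_neg_Ioi_zero]
  norm_num

instance : IsProbabilityMeasure stdLaplace := by
  constructor
  have hint : Integrable (fun x : ℝ => Real.exp (-|x|) / 2) := by
    apply Integrable.of_integral_ne_zero
    rw [stdLaplace_integral]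
    exact one_ne_zero
  rw [stdLaplace, withDensity_apply _ MeasurableSet.univ, Measure.restrict_univ,
    ← ofReal_integral_eq_lintegral_ofReal hint (Filter.Eventually.of_forall fun x => by positivity),
    stdLaplace_integral, ENNReal.ofReal_one]

/-- The Laplace distribution of scale `b`. -/
def laplace (b : ℝ) : Measure ℝ := stdLaplace.map fun x => b * x

instance (b : ℝ) : IsProbabilityMeasure (laplace b) :=
  Measure.isProbabilityMeasure_map (measurable_const_mul b).aemeasurable

open Classical in
/-- The first index `i < m` with `Y_i + q_i ≥ τ + X`, and `m` if there is none; here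
`ω = (X, Y)` is the noise. -/
def firstAbove (m : ℕ) (τ : ℝ) (q : ℕ → ℝ) (ω : ℝ × (Fin m → ℝ)) : ℕ :=
  Nat.find (p := fun i => ∀ h : i < m, τ + ω.1 ≤ ω.2 ⟨i, h⟩ + q i)
    ⟨m, fun h => absurd h (lt_irrefl m)⟩

theorem measurable_firstAbove (m : ℕ) (τ : ℝ) (q : ℕ → ℝ) : Measurable (firstAbove m τ q) := by
  classical
  unfold firstAbove
  refine measurable_find
    (p := fun (ω : ℝ × (Fin m → ℝ)) (i : ℕ) => ∀ h : i < m, τ + ω.1 ≤ ω.2 ⟨i, h⟩ + q i) _ ?_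
  intro k
  by_cases h : k < m
  · simp only [h, forall_true_left]
    exact measurableSet_le (by fun_prop) (by fun_prop)
  · simp [h]

/-- The sparse vector technique: index of the first of the `m` queries whose noisy value reaches
the noisy threshold (`m` if there is none); all noises are `Lap(3/ε)` and independent. -/
def sparseVector (ε : ℝ) (m : ℕ) (τ : ℝ) (q : ℕ → ℝ) : PMF ℕ :=
  haveI : IsProbabilityMeasure (Measure.map (firstAbove m τ q)
      ((laplace (3 / ε)).prod (Measure.pi fun _ : Fin m => laplace (3 / ε)))) :=
    Measure.isProbabilityMeasure_map (measurable_firstAbove m τ q).aemeasurable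
  Measure.toPMF (Measure.map (firstAbove m τ q)
    ((laplace (3 / ε)).prod (Measure.pi fun _ : Fin m => laplace (3 / ε))))

/-! ### Tukey depth completion

`A : E d →ₗ[ℝ] E j` is the linear map (a composition of projections and rotations) that was applied
so far; the current chain of polytopes consists of the images `A (D_P(k))`. -/

/-- Given the values `y m` of the first coordinates, `m < i`, the set of all values of the next
coordinate that can be completed to a point of the polytope `A (D_P(k))`. -/
def slice {d j : ℕ} (P : Finset (E d)) (A : E d →ₗ[ℝ] E j) (i : Fin j) (y : Fin j → ℝ) (k : ℕ) :
    Set ℝ :=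
  {x | ∃ p ∈ tukeyRegion P k, (∀ m : Fin j, m < i → A p m = y m) ∧ A p i = x}

/-- `TDC_y(x)`: the largest `k` such that the prefix `y` followed by `x` can be completed to a
point of `A (D_P(k))`. -/
def tdc {d j : ℕ} (P : Finset (E d)) (A : E d →ₗ[ℝ] E j) (i : Fin j) (y : Fin j → ℝ) (x : ℝ) : ℕ :=
  sSup {k : ℕ | x ∈ slice P A i y k}

/-- The refined grid for the next coordinate: the original grid together with the end points of the
intervals on which `TDC_y ≥ k`, for all possible data sets on the original grid. It does not
depend on the actual data set. -/
def refinedGridSet {d j : ℕ} (b : ℕ) (A : E d →ₗ[ℝ] E j) (i : Fin j) (y : Fin j → ℝ) : Set ℝ :=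
  gridLine b ∪ {x | ∃ Q : Finset (E d), (Q : Set (E d)) ⊆ gridPoints d b ∧ ∃ k : ℕ, 1 ≤ k ∧
    (IsLeast (slice Q A i y k) x ∨ IsGreatest (slice Q A i y k) x)}

theorem gridLine_finite (b : ℕ) : (gridLine b).Finite := by
  refine ((Set.finite_Iic (2 ^ b)).image fun m : ℕ => (m : ℝ) / 2 ^ b).subset ?_
  rintro x ⟨m, hm, rfl⟩
  exact ⟨m, hm, rfl⟩

theorem gridPoints_finite (d b : ℕ) : (gridPoints d b).Finite := by
  have h : {f : Fin d → ℝ | ∀ i, f i ∈ gridLine b}.Finite :=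
    Set.Finite.pi' fun _ => gridLine_finite b
  refine (h.image (WithLp.toLp 2)).subset ?_
  intro p hp
  exact ⟨WithLp.ofLp p, fun i => hp i, rfl⟩

theorem tukeyDepth_le_card {d : ℕ} (P : Finset (E d)) (x : E d) : tukeyDepth P x ≤ P.card := by
  unfold tukeyDepth
  rcases Set.eq_empty_or_nonempty {n : ℕ | ∃ u : E d, ‖u‖ = 1 ∧
    n = {p : E d | p ∈ P ∧ inner ℝ p u ≤ inner ℝ x u}.ncard} with h | ⟨n, hn⟩
  · rw [h]
    simp
  · refine (Nat.sInf_le hn).trans ?_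
    obtain ⟨u, -, rfl⟩ := hn
    rw [← Set.ncard_coe_finset]
    exact Set.ncard_le_ncard (fun p hp => hp.1) P.finite_toSet

theorem refinedGridSet_finite {d j : ℕ} (b : ℕ) (A : E d →ₗ[ℝ] E j) (i : Fin j) (y : Fin j → ℝ) :
    (refinedGridSet b A i y).Finite := by
  classical
  have hsub : ∀ S : Set ℝ, {x | IsLeast S x ∨ IsGreatest S x}.Finite := by
    intro S
    have h1 : {x | IsLeast S x}.Subsingleton := fun a ha c hc => ha.unique hc
    have h2 : {x | IsGreatest S x}.Subsingleton := fun a ha c hc => ha.unique hc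
    exact h1.finite.union h2.finite
  have hQ : {Q : Finset (E d) | (Q : Set (E d)) ⊆ gridPoints d b}.Finite := by
    refine ((gridPoints_finite d b).toFinset.powerset.finite_toSet).subset ?_
    intro Q hQ
    rw [Finset.mem_coe, Finset.mem_powerset]
    intro p hp
    rw [Set.Finite.mem_toFinset]
    exact hQ hp
  refine (gridLine_finite b).union ?_
  refine (hQ.biUnion fun Q _ => (Set.finite_Iic Q.card).biUnion fun k _ =>
    hsub (slice Q A i y k)).subset ?_
  rintro x ⟨Q, hQs, k, -, hx⟩
  have hmem : x ∈ slice Q A i y k := hx.elim (fun h => h.1) (fun h => h.1)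
  obtain ⟨p, hp, -⟩ := hmem
  have hk : k ≤ Q.card := by
    have h1 : k ≤ tukeyDepth Q p := by
      have h2 : (k : ℝ) ≤ (tukeyDepth Q p : ℝ) := hp
      exact_mod_cast h2
    exact h1.trans (tukeyDepth_le_card Q p)
  simp only [Set.mem_iUnion]
  exact ⟨Q, hQs, k, hk, hx⟩

/-- The refined grid as a finite set. -/
def refinedGrid {d j : ℕ} (b : ℕ) (A : E d →ₗ[ℝ] E j) (i : Fin j) (y : Fin j → ℝ) : Finset ℝ :=
  (refinedGridSet_finite b A i y).toFinset

/-- The number `υ` of bits of the refined grid, which has at most `2^υ` points. -/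
def refinedBits (d b : ℕ) : ℕ := 4 * d ^ 4 * b

/-- Fills in the listed coordinates of `y` one after the other, each by a private approximate
maximization of the Tukey depth completion function. -/
def fillCoords {d j : ℕ} (M : QCAlgorithm) (b : ℕ) (P : Finset (E d)) (A : E d →ₗ[ℝ] E j) :
    List (Fin j) → (Fin j → ℝ) → PMF (Fin j → ℝ)
  | [], y => PMF.pure y
  | i :: is, y => (M (refinedGrid b A i y) fun x => (tdc P A i y x : ℝ)).bind fun x =>
      fillCoords M b P A is (Function.update y i x)

/-! ### Directions and rotations -/

/-- `V` is a `ζ`-angle cover of the unit sphere. -/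
def IsAngleCover {j : ℕ} (ζ : ℝ) (V : Set (E j)) : Prop :=
  (∀ v ∈ V, ‖v‖ = 1) ∧ ∀ w : E j, ‖w‖ = 1 → ∃ v ∈ V, InnerProductGeometry.angle w v ≤ ζ

/-- The first vector of the standard basis. -/
def e₀ (n : ℕ) : E (n + 1) := EuclideanSpace.single 0 1

/-- The data-independent choices of the algorithm, in every dimension: the angle cover `V` used to
find a direction, the angle cover `W` used to approximate the diameter up to a factor `1 - 1/10`,
and for each unit vector `v` a rotation `R v` that takes `v` to the first basis vector. -/
structure Directions where
  V : (j : ℕ) → List (E j)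
  V_cover : ∀ j, IsAngleCover (Real.arccos (9 / 10)) {v | v ∈ V j}
  W : (j : ℕ) → Finset (E j)
  W_cover : ∀ j, IsAngleCover (Real.sqrt ((1 / 10) / 2)) {v | v ∈ W j}
  R : (n : ℕ) → E (n + 1) → (E (n + 1) ≃ₗᵢ[ℝ] E (n + 1))
  R_apply : ∀ (n : ℕ) (v : E (n + 1)), ‖v‖ = 1 → R n v v = e₀ n

/-- The map `A` followed by the rotation that takes `v` to the first basis vector. -/
def Directions.rotate (D : Directions) {d n : ℕ} (v : E (n + 1)) (A : E d →ₗ[ℝ] E (n + 1)) :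
    E d →ₗ[ℝ] E (n + 1) :=
  (D.R n v).toLinearEquiv.toLinearMap ∘ₗ A

/-- Dropping the first coordinate. -/
def dropFirst (n : ℕ) : E (n + 1) →ₗ[ℝ] E n where
  toFun x := WithLp.toLp 2 fun i => x i.succ
  map_add' _ _ := rfl
  map_smul' _ _ := rfl

/-- `TDC^{R_v}(x)`, with an empty prefix. -/
def tdcDir (D : Directions) {d n : ℕ} (P : Finset (E d)) (A : E d →ₗ[ℝ] E (n + 1)) (v : E (n + 1))
    (x : ℝ) : ℕ :=
  tdc P (D.rotate v A) 0 0 x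

/-! ### Private approximation of the diameter, with multiplicative error `1/10` -/

/-- The number `T` of the algorithm: `⌈(2υ + ln d) / α⌉` with `α = 1/10`. -/
def diamRounds (d υ : ℕ) : ℕ := ⌈(2 * (υ : ℝ) + Real.log d) / (1 / 10)⌉₊

/-- The lengths `ℓ_i = √d (1 - α/2)^i`. -/
def diamLength (d i : ℕ) : ℝ := Real.sqrt d * (1 - (1 / 10) / 2) ^ i

/-- The query `max_{v ∈ W} max_x min(TDC^{R_v}(x), TDC^{R_v}(x + ℓ))`. -/
def diamQuery (D : Directions) {d n : ℕ} (P : Finset (E d)) (A : E d →ₗ[ℝ] E (n + 1)) (ℓ : ℝ) : ℕ :=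
  (D.W (n + 1)).sup fun v => ⨆ x : ℝ, min (tdcDir D P A v x) (tdcDir D P A v (x + ℓ))

/-- The private approximation of the diameter of `A (D_P(κ))`. -/
def dpTukeyDiam (D : Directions) (υ : ℕ) (ε β κ : ℝ) {d n : ℕ} (P : Finset (E d))
    (A : E d →ₗ[ℝ] E (n + 1)) : PMF ℝ :=
  (sparseVector ε (diamRounds d υ + 1) (κ - 6 / ε * Real.log ((diamRounds d υ + 2) / β))
      fun i => (diamQuery D P A (diamLength d i) : ℝ)).map
    fun i => if i ≤ diamRounds d υ then diamLength d i else 0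

/-- The loss of depth of the diameter approximation. -/
def deltaDiam (d υ : ℕ) (ε β : ℝ) : ℝ := 12 * Real.log ((diamRounds d υ + 2) / β) / ε

/-! ### Private choice of a direction -/

/-- Finds a direction `v` of the list such that some point of large depth has the same coordinate
along `v` as the point `s`, shifted by `lam`; `none` if the search fails. -/
def dpLargeTDCDirection (D : Directions) (ε β κ : ℝ) {d n : ℕ} (P : Finset (E d))
    (A : E d →ₗ[ℝ] E (n + 1)) (V : List (E (n + 1))) (s : E (n + 1)) (lam : ℝ) :
    PMF (Option (E (n + 1))) :=
  (sparseVector ε V.length (κ - 6 * Real.log ((V.length + 1) / β) / ε) fun i =>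
      match V[i]? with
      | some v => (tdcDir D P A v (inner ℝ s v + lam) : ℝ)
      | none => 0).map
    fun i => V[i]?

/-- The loss of depth in the choice of one of `m` directions. -/
def deltaDir (m : ℕ) (ε β : ℝ) : ℝ := 12 * Real.log ((m + 1) / β) / ε

/-! ### The recursive bounding-box algorithm -/

/-- The number of calls to private subroutines. -/
def numCalls (d : ℕ) : ℝ := (d : ℝ) ^ 2 + 2 * d - 1

/-- The unit vector in direction `t - s` (the first basis vector if `s = t` or if there is
no `t`). -/
def segmentDir {n : ℕ} (s : E (n + 1)) : Option (E (n + 1)) → E (n + 1)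
  | none => e₀ n
  | some t => open Classical in if t = s then e₀ n else ‖t - s‖⁻¹ • (t - s)

/-- The point `t`: its coordinate along `v` is `x`, the remaining coordinates in the rotated basis
are found one by one; there is no `t` if there is no direction. -/
def findT (D : Directions) (M : QCAlgorithm) (b : ℕ) {d n : ℕ} (P : Finset (E d))
    (A : E d →ₗ[ℝ] E (n + 1)) (s : E (n + 1)) (lam : ℝ) :
    Option (E (n + 1)) → PMF (Option (E (n + 1)))
  | none => PMF.pure none
  | some v =>
    (fillCoords M b P (D.rotate v A) (List.finRange (n + 1)).tail
        (Function.update 0 0 (inner ℝ s v + lam))).map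
      fun y => some ((D.R n v).symm (WithLp.toLp 2 y))

/-- The recursion over the dimension. `M` is the quasi-concave maximizer and `ε`, `β` are the
parameters of a single call. -/
def bbRec (D : Directions) (M : QCAlgorithm) (b : ℕ) (ε β κ : ℝ) {d : ℕ} (P : Finset (E d)) :
    (j : ℕ) → (E d →ₗ[ℝ] E j) → PMF (Set (E j))
  | 0, _ => PMF.pure Set.univ
  | 1, A =>
    (fillCoords M b P A (List.finRange 1) 0).bind fun s =>
    (dpTukeyDiam D (refinedBits d b) ε β κ P A).bind fun ℓ =>
    PMF.pure {x : E 1 | x 0 ∈ Set.Icc (s 0 - 10 / 9 * ℓ) (s 0 + 10 / 9 * ℓ)}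
  | n + 2, A =>
    (fillCoords M b P A (List.finRange (n + 2)) 0).bind fun s' =>
    let s : E (n + 2) := WithLp.toLp 2 s'
    (dpTukeyDiam D (refinedBits d b) ε β κ P A).bind fun ℓ =>
    (dpLargeTDCDirection D ε β (κ - deltaDiam d (refinedBits d b) ε β) P A (D.V (n + 2)) s
      (0.45 * ℓ)).bind fun v =>
    (findT D M b P A s (0.45 * ℓ) v).bind fun t =>
    let u := segmentDir s t
    (bbRec D M b ε β κ P (n + 1) (dropFirst (n + 1) ∘ₗ D.rotate u A)).bind fun B' =>
    PMF.pure {x : E (n + 2) |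
      inner ℝ x u ∈ Set.Icc (inner ℝ s u - 10 / 9 * ℓ) (inner ℝ s u + 10 / 9 * ℓ) ∧
      dropFirst (n + 1) (D.R (n + 1) u x) ∈ B'}

/-- The private bounding-box algorithm for data of `b` bits per coordinate. `M ε δ β` is the
quasi-concave maximizer with privacy parameters `ε`, `δ` and failure probability `β`. -/
def boundingBox (D : Directions) (M : ℝ → ℝ → ℝ → QCAlgorithm) (b : ℕ) (ε δ β κ : ℝ) {d : ℕ}
    (P : Finset (E d)) : PMF (Set (E d)) :=
  bbRec D (M (ε / numCalls d) (δ / numCalls d) (β / numCalls d)) b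
    (ε / numCalls d) (β / numCalls d) κ P d LinearMap.id

/-! ### The guarantee -/

/-- `B` is a (possibly degenerate, arbitrarily oriented) box. -/
def IsBox {d : ℕ} (B : Set (E d)) : Prop :=
  ∃ (F : E d ≃ₗᵢ[ℝ] E d) (lo hi : Fin d → ℝ), (∀ i, lo i ≤ hi i) ∧
    B = {x | ∀ i, F x i ∈ Set.Icc (lo i) (hi i)}

/-- `B` is a box that contains `D_P(κ)`, of volume at most `5^d d! vol(D_P(κ - Δ))`. -/
def GoodBox {d : ℕ} (P : Finset (E d)) (κ Δ : ℝ) (B : Set (E d)) : Prop :=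
  IsBox B ∧ tukeyRegion P κ ⊆ B ∧ volume (tukeyRegion P κ) ≤ volume B ∧
    volume B ≤ 5 ^ d * (d.factorial : ENNReal) * volume (tukeyRegion P (κ - Δ))

/-- The loss of depth; `m` bounds the number of directions, and `α` is the accuracy of the
quasi-concave maximizer in a single call. -/
def deltaBB (d υ m : ℕ) (ε β α : ℝ) : ℝ :=
  deltaDiam d υ (ε / numCalls d) (β / numCalls d) + deltaDir m (ε / numCalls d) (β / numCalls d)
    + d * α

/-- The iterated logarithm: how often `log₂` has to be applied to get a value at most `1`. -/
def logStar (x : ℝ) : ℕ := sInf {n : ℕ | (Real.logb 2)^[n] x ≤ 1}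

end

noncomputable section

/-! ### Discrete probability and composition of private algorithms -/

/-! Privacy. The data enter the subroutines only through Tukey depths. Adding or removing one point
changes every halfspace count by at most 1, hence also every depth, every value of `tdc` and every
query of the sparse vector technique. Grids, covers and rotations depend on earlier outputs only. So
each call is private, and adaptive composition (`CloseTo.bind`) adds the parameters. Dimension `j ≥
2` makes `j + (j - 1)` maximizations and two sparse vector calls, dimension 1 makes two calls; the
sum is `d² + 2d - 1` (`recCalls_eq`).

Utility. By a union bound all calls may be assumed to succeed. Let `K` and `K'` be the images under
the current map of the regions of depth `κ` and `κ - Δ`. The point `s` lies in `K`, and `10/9 ℓ`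
bounds the diameter of `K`, so the slab of half-width `10/9 ℓ` around `s` contains `K` whatever the
direction `u` is. For the volume, `K'` contains `s` and two points at distance at least `ℓ`. One of
them is at distance at least `ℓ/2` from `s`, and some direction of the cover sees `9/10` of that
distance, so the point `t` of `K'` satisfies `L = ‖t - s‖ ≥ 0.45 ℓ`. A convex body is at least as
large as a cone over its projection along a chord (`volume_image_dropFirst_le`), that is, `L ·
vol(projection) ≤ j · vol(K')`. The side of the box is `20/9 ℓ ≤ 5 L`, so dimension `j` contributes
the factor `5 j`, and the product is `5^d d!`. The depth loss does not accumulate over the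
dimensions, because the same two regions of the original data are projected throughout
(`bbRec_accurate`).

Arithmetic of the grid. The refined grid must have at most `2^υ` points, and a region of positive
volume must be wider than about `e^(-υ)` in every direction, or the search for the diameter could
run out of lengths. Both facts rest on one local description: a Tukey region is an intersection of
convex hulls of large subsets, and near a point it contains the intersection of at most `d` flats,
each spanned by at most `d` data points (`exists_flats_of_mem_tukeyRegion`). An end point of an
interval of completions is determined by the prefix and these flats, hence by `d³` grid coordinates
(`card_refinedGrid_le`). A vertex is the only point on its flats, so Cramer's rule bounds its
denominator (`exists_vertex_denominator`). The determinant of `d` independent differences of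
vertices is then bounded below, and a narrow region would make it too small
(`exists_le_abs_inner_sub`).

Binary search. The branching probabilities along a path telescope, so it is exactly the exponential
mechanism (`binarySearch_apply`). The asymptotic bounds are then elementary: `numCalls d ≤ 3 d²`,
and the remaining factor `d` comes from `log (K^d)` or from the `d` losses of `α`. -/

theorem prob_bind {Ω Ω' : Type} (p : PMF Ω) (f : Ω → PMF Ω') (S : Set Ω') :
    prob (p.bind f) S = ∑' a, p a * prob (f a) S :=
  PMF.toOuterMeasure_bind_apply p f S

theorem prob_map {Ω Ω' : Type} (p : PMF Ω) (f : Ω → Ω') (S : Set Ω') :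
    prob (p.map f) S = prob p (f ⁻¹' S) :=
  PMF.toOuterMeasure_map_apply f p S

theorem prob_univ {Ω : Type} (p : PMF Ω) : prob p Set.univ = 1 := by
  rw [prob, PMF.toOuterMeasure_apply, Set.indicator_univ, p.tsum_coe]

theorem prob_mono {Ω : Type} (p : PMF Ω) {S S' : Set Ω} (h : S ⊆ S') : prob p S ≤ prob p S' :=
  p.toOuterMeasure.mono h

theorem prob_le_one {Ω : Type} (p : PMF Ω) (S : Set Ω) : prob p S ≤ 1 :=
  (prob_mono p (Set.subset_univ S)).trans_eq (prob_univ p)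

theorem prob_ne_top {Ω : Type} (p : PMF Ω) (S : Set Ω) : prob p S ≠ ⊤ :=
  ((prob_le_one p S).trans_lt ENNReal.one_lt_top).ne

theorem prob_add_compl {Ω : Type} (p : PMF Ω) (S : Set Ω) : prob p S + prob p Sᶜ = 1 := by
  rw [prob, prob, PMF.toOuterMeasure_apply, PMF.toOuterMeasure_apply, ← ENNReal.tsum_add,
    ← p.tsum_coe]
  refine tsum_congr fun a => ?_
  by_cases h : a ∈ S <;> simp [h]

theorem prob_pure {Ω : Type} (a : Ω) (S : Set Ω) [Decidable (a ∈ S)] :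
    prob (PMF.pure a) S = if a ∈ S then 1 else 0 := by
  classical
  rw [prob, PMF.toOuterMeasure_pure_apply]
  congr

/-- The event `S` fails with probability at most `β`. -/
def Fails {Ω : Type} (β : ℝ) (p : PMF Ω) (S : Set Ω) : Prop := prob p Sᶜ ≤ ENNReal.ofReal β

theorem fails_iff {Ω : Type} {β : ℝ} (hβ : 0 ≤ β) (p : PMF Ω) (S : Set Ω) :
    Fails β p S ↔ ENNReal.ofReal (1 - β) ≤ prob p S := by
  have h := prob_add_compl p S
  have hS := prob_ne_top p S
  have hS' := prob_ne_top p Sᶜ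
  unfold Fails
  rw [← ENNReal.ofReal_toReal hS, ← ENNReal.ofReal_toReal hS'] at h ⊢
  rw [← ENNReal.ofReal_add ENNReal.toReal_nonneg ENNReal.toReal_nonneg,
    ENNReal.ofReal_eq_one] at h
  rw [ENNReal.ofReal_le_ofReal_iff hβ, ENNReal.ofReal_le_ofReal_iff ENNReal.toReal_nonneg]
  constructor <;> intro <;> linarith

theorem Fails.mono {Ω : Type} {β : ℝ} {p : PMF Ω} {S S' : Set Ω} (h : Fails β p S)
    (hS : S ⊆ S') : Fails β p S' :=
  (prob_mono p (Set.compl_subset_compl.2 hS)).trans h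

theorem fails_pure {Ω : Type} {β : ℝ} {a : Ω} {S : Set Ω} (h : a ∈ S) :
    Fails β (PMF.pure a) S := by
  classical
  simp [Fails, prob_pure, h]

/-- Union bound; the second stage has to be controlled only after outcomes in `S`. Stating utility
by failure probabilities makes them simply additive. -/
theorem Fails.bind {Ω Ω' : Type} {β β' : ℝ} (hβ : 0 ≤ β) (hβ' : 0 ≤ β') {p : PMF Ω}
    {f : Ω → PMF Ω'} {S : Set Ω} {S' : Set Ω'} (hp : Fails β p S)
    (hf : ∀ a ∈ S, Fails β' (f a) S') : Fails (β + β') (p.bind f) S' := by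
  unfold Fails at *
  rw [prob_bind, ENNReal.ofReal_add hβ hβ']
  have h1 : ∀ a, p a * prob (f a) S'ᶜ ≤ Sᶜ.indicator p a + p a * ENNReal.ofReal β' := by
    intro a
    by_cases h : a ∈ S
    · exact le_add_left (mul_le_mul_right (hf a h) _)
    · refine le_add_right ?_
      rw [Set.indicator_of_mem (show a ∈ Sᶜ from h)]
      exact mul_le_of_le_one_right' (prob_le_one _ _)
  refine (ENNReal.tsum_le_tsum h1).trans ?_
  rw [ENNReal.tsum_add, ENNReal.tsum_mul_right, p.tsum_coe, one_mul, ← PMF.toOuterMeasure_apply]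
  exact add_le_add hp le_rfl

theorem Fails.map {Ω Ω' : Type} {β : ℝ} {p : PMF Ω} {f : Ω → Ω'} {S' : Set Ω'}
    (hp : Fails β p (f ⁻¹' S')) : Fails β (p.map f) S' := by
  unfold Fails at *
  rwa [prob_map]

theorem CloseTo.refl {Ω : Type} (p : PMF Ω) {ε δ : ℝ} (hε : 0 ≤ ε) : CloseTo ε δ p p := by
  intro S
  refine le_add_right ?_
  calc prob p S = 1 * prob p S := (one_mul _).symm
    _ ≤ _ := mul_le_mul_left (ENNReal.one_le_ofReal.2 (Real.one_le_exp hε)) _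

theorem CloseTo.map {Ω Ω' : Type} {p p' : PMF Ω} {ε δ : ℝ} (h : CloseTo ε δ p p')
    (f : Ω → Ω') : CloseTo ε δ (p.map f) (p'.map f) := by
  intro S
  rw [prob_map, prob_map]
  exact h _

theorem CloseTo.of_apply_le {Ω : Type} {p p' : PMF Ω} {ε : ℝ}
    (h : ∀ a, p a ≤ ENNReal.ofReal (Real.exp ε) * p' a) : CloseTo ε 0 p p' := by
  intro S
  rw [ENNReal.ofReal_zero, add_zero, prob, prob, PMF.toOuterMeasure_apply,
    PMF.toOuterMeasure_apply, ← ENNReal.tsum_mul_left]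
  refine ENNReal.tsum_le_tsum fun a => ?_
  by_cases ha : a ∈ S
  · simpa [ha] using h a
  · simp [ha]

theorem CloseTo.weaken {Ω : Type} {p p' : PMF Ω} {ε δ δ' : ℝ} (h : CloseTo ε δ p p')
    (hδ : δ ≤ δ') : CloseTo ε δ' p p' :=
  fun S => (h S).trans (add_le_add le_rfl (ENNReal.ofReal_le_ofReal hδ))

/-- Indistinguishability passes from events to test functions with values in `[0, 1]`. The event `S`
on which `p` dominates `e^ε p'` is the worst one, and it shows that the whole positive part of `p -
e^ε p'` has mass at most `δ`. -/
theorem CloseTo.tsum_le {Ω : Type} {p p' : PMF Ω} {ε δ : ℝ} (h : CloseTo ε δ p p')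
    (g : Ω → ENNReal) (hg : ∀ a, g a ≤ 1) :
    ∑' a, p a * g a ≤
      ENNReal.ofReal (Real.exp ε) * (∑' a, p' a * g a) + ENNReal.ofReal δ := by
  set e := ENNReal.ofReal (Real.exp ε) with he
  set S : Set Ω := {a | e * p' a ≤ p a} with hS
  have h1 : ∑' a, (p a - e * p' a) ≤ ENNReal.ofReal δ := by
    have h2 : prob p S = e * prob p' S + ∑' a, (p a - e * p' a) := by
      rw [prob, prob, PMF.toOuterMeasure_apply, PMF.toOuterMeasure_apply,
        ← ENNReal.tsum_mul_left, ← ENNReal.tsum_add]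
      refine tsum_congr fun a => ?_
      by_cases ha : a ∈ S
      · rw [Set.indicator_of_mem ha, Set.indicator_of_mem ha, add_tsub_cancel_of_le ha]
      · rw [Set.indicator_of_notMem ha, Set.indicator_of_notMem ha,
          tsub_eq_zero_of_le (not_le.1 ha).le, mul_zero, add_zero]
    have h3 := h S
    rw [h2] at h3
    exact (ENNReal.add_le_add_iff_left
      (ENNReal.mul_ne_top ENNReal.ofReal_ne_top (prob_ne_top _ _))).1 h3
  have h4 : ∀ a, p a * g a ≤ e * (p' a * g a) + (p a - e * p' a) := by
    intro a
    calc p a * g a ≤ (e * p' a + (p a - e * p' a)) * g a :=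
          mul_le_mul_left le_add_tsub _
      _ = e * (p' a * g a) + (p a - e * p' a) * g a := by ring
      _ ≤ _ := add_le_add le_rfl (mul_le_of_le_one_right' (hg a))
  refine (ENNReal.tsum_le_tsum h4).trans ?_
  rw [ENNReal.tsum_add, ENNReal.tsum_mul_left]
  exact add_le_add le_rfl h1

/-- Adaptive sequential composition. -/
theorem CloseTo.bind {Ω Ω' : Type} {p p' : PMF Ω} {f f' : Ω → PMF Ω'} {ε₁ δ₁ ε₂ δ₂ : ℝ}
    (hδ₁ : 0 ≤ δ₁) (hδ₂ : 0 ≤ δ₂) (h : CloseTo ε₁ δ₁ p p')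
    (hf : ∀ a, CloseTo ε₂ δ₂ (f a) (f' a)) :
    CloseTo (ε₁ + ε₂) (δ₁ + δ₂) (p.bind f) (p'.bind f') := by
  intro S
  rw [prob_bind, prob_bind, ENNReal.ofReal_add hδ₁ hδ₂, Real.exp_add,
    ENNReal.ofReal_mul (Real.exp_pos _).le]
  set e₁ := ENNReal.ofReal (Real.exp ε₁)
  set e₂ := ENNReal.ofReal (Real.exp ε₂)
  -- Truncation at 1 makes `g` an admissible test function. Without it `δ₁` would be multiplied by
  -- `e^ε₂`.
  set g : Ω → ENNReal := fun a => min 1 (e₂ * prob (f' a) S) with hg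
  have h1 : ∀ a, p a * prob (f a) S ≤ p a * g a + p a * ENNReal.ofReal δ₂ := by
    intro a
    rw [← mul_add]
    refine mul_le_mul_right ?_ _
    rw [hg, min_add]
    exact le_min (le_add_right (prob_le_one _ _)) (hf a S)
  refine (ENNReal.tsum_le_tsum h1).trans ?_
  rw [ENNReal.tsum_add, ENNReal.tsum_mul_right, p.tsum_coe, one_mul, ← add_assoc]
  refine add_le_add ?_ le_rfl
  refine (h.tsum_le g fun a => min_le_left _ _).trans (add_le_add ?_ le_rfl)
  rw [mul_assoc, ← ENNReal.tsum_mul_left (a := e₂)]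
  refine mul_le_mul_right (ENNReal.tsum_le_tsum fun a => ?_) _
  calc p' a * g a ≤ p' a * (e₂ * prob (f' a) S) := mul_le_mul_right (min_le_right _ _) _
    _ = _ := by ring

/-! ### Laplace noise -/

theorem measurable_laplaceDensity :
    Measurable fun x : ℝ => ENNReal.ofReal (Real.exp (-|x|) / 2) := by
  fun_prop

/-- The densities at `x` and `x + c` differ at most by the factor `e^|c|`, by the triangle
inequality. As an inequality between measures the bound is stable under products and maps. -/
theorem stdLaplace_le_map_sub (c : ℝ) :
    stdLaplace ≤ ENNReal.ofReal (Real.exp |c|) • stdLaplace.map fun x => x - c := by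
  refine Measure.le_iff.2 fun A hA => ?_
  rw [Measure.smul_apply, Measure.map_apply (by fun_prop) hA, stdLaplace,
    withDensity_apply _ hA, withDensity_apply _ (hA.preimage (by fun_prop)), smul_eq_mul,
    ← lintegral_const_mul _ measurable_laplaceDensity]
  have h1 : MeasurePreserving (fun x : ℝ => x - c) volume volume :=
    measurePreserving_sub_right volume c
  have h2 : ∫⁻ x in (fun x : ℝ => x - c) ⁻¹' A,
      ENNReal.ofReal (Real.exp |c|) * ENNReal.ofReal (Real.exp (-|x|) / 2) =
      ∫⁻ x in A, ENNReal.ofReal (Real.exp |c|) * ENNReal.ofReal (Real.exp (-|x + c|) / 2) := by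
    rw [← h1.setLIntegral_comp_preimage hA (by fun_prop)]
    simp
  rw [h2]
  refine lintegral_mono fun x => ?_
  rw [← ENNReal.ofReal_mul (Real.exp_pos _).le]
  refine ENNReal.ofReal_le_ofReal ?_
  rw [← mul_div_assoc, ← Real.exp_add]
  have := abs_add_le x c
  gcongr
  linarith

theorem laplace_le_map_sub {b : ℝ} (hb : 0 < b) (c : ℝ) :
    laplace b ≤ ENNReal.ofReal (Real.exp (|c| / b)) • (laplace b).map fun x => x - c := by
  have h := Measure.map_mono (f := fun x => b * x) (stdLaplace_le_map_sub (c / b)) (by fun_prop)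
  rw [Measure.map_smul, Measure.map_map (by fun_prop) (by fun_prop), abs_div, abs_of_pos hb] at h
  rw [laplace, Measure.map_map (by fun_prop) (by fun_prop)]
  have hf : (fun x : ℝ => x - c) ∘ (fun x => b * x) =
      (fun x => b * x) ∘ fun x => x - c / b := by
    funext x
    simp only [Function.comp_apply]
    field_simp
  rw [hf]
  exact h

theorem stdLaplace_abs_gt {t : ℝ} (ht : 0 ≤ t) :
    stdLaplace {x | t < |x|} = ENNReal.ofReal (Real.exp (-t)) := by
  have hm : MeasurableSet {x : ℝ | t < |x|} := measurableSet_lt measurable_const (by fun_prop)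
  have h1 : ∫ x : ℝ, Set.indicator {x : ℝ | t < |x|} (fun x => Real.exp (-|x|) / 2) x =
      Real.exp (-t) := by
    have h2 : Set.indicator {x : ℝ | t < |x|} (fun x => Real.exp (-|x|) / 2) =
        fun x => (Set.indicator (Set.Ioi t) (fun y => Real.exp (-y) / 2)) |x| := by
      ext x
      simp only [Set.indicator, Set.mem_ofPred_eq, Set.mem_Ioi]
    rw [h2, integral_comp_abs (f := Set.indicator (Set.Ioi t) (fun y => Real.exp (-y) / 2)),
      setIntegral_indicator measurableSet_Ioi, Set.inter_eq_right.2 (Set.Ioi_subset_Ioi ht),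
      integral_div, integral_exp_neg_Ioi]
    ring
  have hint : Integrable (Set.indicator {x : ℝ | t < |x|} (fun x => Real.exp (-|x|) / 2)) := by
    apply Integrable.of_integral_ne_zero
    rw [h1]
    exact (Real.exp_pos _).ne'
  rw [stdLaplace, withDensity_apply _ hm, ← lintegral_indicator hm, ← h1,
    ofReal_integral_eq_lintegral_ofReal hint
      (Filter.Eventually.of_forall fun x => Set.indicator_nonneg (fun _ _ => by positivity) x)]
  refine lintegral_congr fun x => ?_
  by_cases hx : t < |x| <;> simp [hx]

theorem laplace_abs_gt_le {b : ℝ} (hb : 0 < b) (t : ℝ) :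
    laplace b {x | t < |x|} ≤ ENNReal.ofReal (Real.exp (-(t / b))) := by
  rcases lt_or_ge t 0 with ht | ht
  · refine prob_le_one.trans ?_
    rw [ENNReal.one_le_ofReal, Real.one_le_exp_iff]
    have := div_neg_of_neg_of_pos ht hb
    linarith
  · have hm : MeasurableSet {x : ℝ | t < |x|} := measurableSet_lt measurable_const (by fun_prop)
    rw [laplace, Measure.map_apply (by fun_prop) hm, ← stdLaplace_abs_gt (div_nonneg ht hb.le)]
    refine measure_mono fun x hx => ?_
    simp only [Set.mem_preimage, Set.mem_ofPred_eq, abs_mul, abs_of_pos hb] at hx ⊢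
    rwa [div_lt_iff₀' hb]

/-! ### The sparse vector technique -/

/-- The joint distribution of the noises of the sparse vector technique. -/
def svtNoise (ε : ℝ) (m : ℕ) : Measure (ℝ × (Fin m → ℝ)) :=
  (laplace (3 / ε)).prod (Measure.pi fun _ : Fin m => laplace (3 / ε))

instance (ε : ℝ) (m : ℕ) : IsProbabilityMeasure (svtNoise ε m) := by
  unfold svtNoise
  infer_instance

theorem firstAbove_eq_iff (m : ℕ) (τ : ℝ) (q : ℕ → ℝ) (ω : ℝ × (Fin m → ℝ)) (i : ℕ) :
    firstAbove m τ q ω = i ↔ i ≤ m ∧ (∀ h : i < m, τ + ω.1 ≤ ω.2 ⟨i, h⟩ + q i) ∧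
      ∀ j < i, ∀ h : j < m, ω.2 ⟨j, h⟩ + q j < τ + ω.1 := by
  classical
  unfold firstAbove
  rw [Nat.find_eq_iff]
  constructor
  · rintro ⟨h1, h2⟩
    refine ⟨?_, h1, fun j hj h => ?_⟩
    · by_contra hi
      exact h2 m (not_le.1 hi) fun h => absurd h (lt_irrefl m)
    · have := h2 j hj
      push Not at this
      exact this.2
  · rintro ⟨h0, h1, h2⟩
    refine ⟨h1, fun j hj h => ?_⟩
    exact absurd (h (hj.trans_le h0)) (not_le.2 (h2 j hj _))

theorem prob_sparseVector (ε : ℝ) (m : ℕ) (τ : ℝ) (q : ℕ → ℝ) (S : Set ℕ) :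
    prob (sparseVector ε m τ q) S = svtNoise ε m (firstAbove m τ q ⁻¹' S) := by
  have : IsProbabilityMeasure (Measure.map (firstAbove m τ q) (svtNoise ε m)) :=
    Measure.isProbabilityMeasure_map (measurable_firstAbove m τ q).aemeasurable
  have h : sparseVector ε m τ q = Measure.toPMF (Measure.map (firstAbove m τ q) (svtNoise ε m)) :=
    rfl
  rw [h, prob, ← PMF.toMeasure_apply_eq_toOuterMeasure, Measure.toPMF_toMeasure,
    Measure.map_apply (measurable_firstAbove m τ q) MeasurableSet.of_discrete]

/-- The coordinate `i` is split off as a factor of the product, and only that factor is shifted. -/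
theorem pi_le_map_update {m : ℕ} (i : Fin m) (ν : Measure ℝ) [IsProbabilityMeasure ν]
    {e : ENNReal} {c : ℝ} (h : ν ≤ e • ν.map fun x => x - c) :
    (Measure.pi fun _ : Fin m => ν) ≤
      e • (Measure.pi fun _ : Fin m => ν).map fun Y => Function.update Y i (Y i - c) := by
  obtain ⟨n, rfl⟩ : ∃ n, m = n + 1 := ⟨m - 1, by have := i.2; omega⟩
  set ρ : Measure (Fin n → ℝ) := Measure.pi fun _ => ν with hρ
  have hmp := measurePreserving_piFinSuccAbove (fun _ : Fin (n + 1) => ν) i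
  set E := MeasurableEquiv.piFinSuccAbove (fun _ : Fin (n + 1) => ℝ) i with hE
  have h1 : (Measure.pi fun _ : Fin (n + 1) => ν) = (ν.prod ρ).map E.symm := (hmp.symm E).map_eq.symm
  have hupd : Measurable fun Y : Fin (n + 1) → ℝ => Function.update Y i (Y i - c) := by
    rw [measurable_pi_iff]
    intro j
    by_cases hj : j = i
    · subst hj
      simp only [Function.update_self]
      fun_prop
    · simpa [hj] using measurable_pi_apply j
  have hs : Measurable fun x : ℝ => x - c := by fun_prop
  have h2 : ν.prod ρ ≤ e • (ν.prod ρ).map (Prod.map (fun x => x - c) id) := by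
    rw [← Measure.map_prod_map _ _ hs measurable_id, Measure.map_id, ← Measure.prod_smul_left]
    exact Measure.prod_mono h le_rfl
  rw [h1]
  refine (Measure.map_mono h2 E.symm.measurable).trans_eq ?_
  rw [Measure.map_smul, Measure.map_map E.symm.measurable (hs.prodMap measurable_id),
    Measure.map_map hupd E.symm.measurable]
  congr 2
  funext x
  have hE' : ∀ y : ℝ × (Fin n → ℝ), E.symm y = i.insertNth (α := fun _ => ℝ) y.1 y.2 :=
    fun _ => rfl
  simp only [Function.comp_apply, hE', Prod.map_fst, Prod.map_snd, id]
  ext j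
  rcases Fin.eq_self_or_eq_succAbove i j with rfl | ⟨k, rfl⟩
  · simp
  · simp [Fin.succAbove_ne]

/-- If the noise with `X` lowered by 1 and `Y_i` lowered by 2 gives the answer `i` on `q`, then the
original noise gives `i` on `q'`: the earlier queries stay below the threshold, which is higher by
1, and query `i` has a gain of `2 - 1` to pay for its own change. With scale `3 / ε` these shifts
cost `ε/3 + 2ε/3 = ε`. -/
theorem sparseVector_private {ε : ℝ} (hε : 0 < ε) (m : ℕ) (τ : ℝ) (q q' : ℕ → ℝ)
    (hq : ∀ i, |q i - q' i| ≤ 1) :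
    CloseTo ε 0 (sparseVector ε m τ q) (sparseVector ε m τ q') := by
  refine CloseTo.of_apply_le fun i => ?_
  rw [← PMF.toOuterMeasure_apply_singleton, ← PMF.toOuterMeasure_apply_singleton]
  change prob _ _ ≤ _ * prob _ _
  rw [prob_sparseVector, prob_sparseVector]
  have hb : 0 < 3 / ε := by positivity
  have hsub : Measurable fun x : ℝ => x - 1 := by fun_prop
  have hX := laplace_le_map_sub hb 1
  have hmeas := measurable_firstAbove m τ q (measurableSet_singleton i)
  have hq1 : ∀ j, q' j ≤ q j + 1 ∧ q j ≤ q' j + 1 := fun j => by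
    have := abs_le.1 (hq j); constructor <;> linarith
  rcases lt_or_ge i m with hi | hi
  · have hY := pi_le_map_update ⟨i, hi⟩ (laplace (3 / ε)) (laplace_le_map_sub hb 2)
    have hupd : Measurable fun Y : Fin m → ℝ => Function.update Y ⟨i, hi⟩ (Y ⟨i, hi⟩ - 2) := by
      rw [measurable_pi_iff]
      intro j
      by_cases hj : j = ⟨i, hi⟩
      · subst hj
        simpa using (measurable_pi_apply _).sub_const 2
      · simpa [hj] using measurable_pi_apply j
    have h := Measure.prod_mono hX hY
    have : IsProbabilityMeasure ((laplace (3 / ε)).map fun x => x - 1) :=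
      Measure.isProbabilityMeasure_map hsub.aemeasurable
    have : IsProbabilityMeasure ((Measure.pi fun _ : Fin m => laplace (3 / ε)).map
        fun Y => Function.update Y ⟨i, hi⟩ (Y ⟨i, hi⟩ - 2)) :=
      Measure.isProbabilityMeasure_map hupd.aemeasurable
    rw [Measure.prod_smul_left, Measure.prod_smul_right, Measure.map_prod_map _ _ hsub hupd,
      smul_smul, ← ENNReal.ofReal_mul (Real.exp_pos _).le, ← Real.exp_add] at h
    refine (h _).trans ?_
    rw [Measure.smul_apply, smul_eq_mul, Measure.map_apply (hsub.prodMap hupd) hmeas]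
    have he : |(1 : ℝ)| / (3 / ε) + |(2 : ℝ)| / (3 / ε) = ε := by
      rw [abs_one, abs_two]; field_simp; norm_num
    rw [he]
    refine mul_le_mul_right (measure_mono fun ω hω => ?_) _
    simp only [Set.mem_preimage, Set.mem_singleton_iff, firstAbove_eq_iff, Prod.map_fst,
      Prod.map_snd] at hω ⊢
    obtain ⟨h0, h1, h2⟩ := hω
    refine ⟨h0, fun h => ?_, fun j hj h => ?_⟩
    · have := h1 h
      rw [Function.update_self] at this
      linarith [(hq1 i).2]
    · have := h2 j hj h
      rw [Function.update_of_ne (by simpa using hj.ne)] at this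
      linarith [(hq1 j).1]
  -- The answer `m` means that no query reaches the threshold, so shifting the threshold alone
  -- suffices.
  · have h := Measure.prod_mono hX (le_refl (Measure.pi fun _ : Fin m => laplace (3 / ε)))
    have : IsProbabilityMeasure ((laplace (3 / ε)).map fun x => x - 1) :=
      Measure.isProbabilityMeasure_map hsub.aemeasurable
    rw [Measure.prod_smul_left] at h
    conv_rhs at h => rw [← Measure.map_id (μ := Measure.pi fun _ : Fin m => laplace (3 / ε))]
    rw [Measure.map_prod_map _ _ hsub measurable_id] at h
    refine (h _).trans ?_
    rw [Measure.smul_apply, smul_eq_mul, Measure.map_apply (hsub.prodMap measurable_id) hmeas]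
    have he : |(1 : ℝ)| / (3 / ε) ≤ ε := by
      rw [abs_one, one_div_div]; linarith
    refine mul_le_mul' (ENNReal.ofReal_le_ofReal (Real.exp_le_exp.2 he))
      (measure_mono fun ω hω => ?_)
    simp only [Set.mem_preimage, Set.mem_singleton_iff, firstAbove_eq_iff, Prod.map_fst,
      Prod.map_snd, id] at hω ⊢
    obtain ⟨h0, h1, h2⟩ := hω
    refine ⟨h0, fun h => absurd h (not_lt.2 hi), fun j hj h => ?_⟩
    linarith [(hq1 j).1, h2 j hj h]

/-- Union bound over `m + 1` noises, each of which exceeds the bound with probability at most `β /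
(m + 1)`. -/
theorem svtNoise_exists_gt_le {ε β : ℝ} (hε : 0 < ε) (hβ : 0 < β) (m : ℕ) :
    svtNoise ε m {ω | 3 / ε * Real.log ((m + 1) / β) < |ω.1| ∨
      ∃ j, 3 / ε * Real.log ((m + 1) / β) < |ω.2 j|} ≤ ENNReal.ofReal β := by
  set t := 3 / ε * Real.log ((m + 1) / β) with ht
  have hb : 0 < 3 / ε := by positivity
  have hm : (0 : ℝ) < m + 1 := by positivity
  have htail : laplace (3 / ε) {x | t < |x|} ≤ ENNReal.ofReal (β / (m + 1)) := by
    refine (laplace_abs_gt_le hb t).trans_eq ?_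
    rw [ht, mul_div_cancel_left₀ _ hb.ne', ← Real.log_inv, inv_div, Real.exp_log (by positivity)]
  have hms : MeasurableSet {x : ℝ | t < |x|} := measurableSet_lt measurable_const (by fun_prop)
  have h1 : svtNoise ε m {ω | t < |ω.1|} ≤ ENNReal.ofReal (β / (m + 1)) := by
    have : {ω : ℝ × (Fin m → ℝ) | t < |ω.1|} = {x | t < |x|} ×ˢ Set.univ := by
      ext; simp
    rw [this, svtNoise, Measure.prod_prod, measure_univ, mul_one]
    exact htail
  have h2 : ∀ j, svtNoise ε m {ω | t < |ω.2 j|} ≤ ENNReal.ofReal (β / (m + 1)) := by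
    intro j
    have : {ω : ℝ × (Fin m → ℝ) | t < |ω.2 j|} =
        Set.univ ×ˢ (Function.eval j ⁻¹' {x : ℝ | t < |x|}) := by
      ext; simp
    rw [this, svtNoise, Measure.prod_prod, measure_univ, one_mul,
      (measurePreserving_eval (fun _ : Fin m => laplace (3 / ε)) j).measure_preimage
        hms.nullMeasurableSet]
    exact htail
  have hset : {ω : ℝ × (Fin m → ℝ) | t < |ω.1| ∨ ∃ j, t < |ω.2 j|} =
      {ω | t < |ω.1|} ∪ ⋃ j, {ω | t < |ω.2 j|} := by
    ext; simp
  rw [hset]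
  refine (measure_union_le _ _).trans ((add_le_add h1 ((measure_iUnion_le _).trans
    (ENNReal.tsum_le_tsum h2))).trans_eq ?_)
  rw [tsum_fintype, Finset.sum_const, Finset.card_univ, Fintype.card_fin, ← ENNReal.ofReal_nsmul,
    ← ENNReal.ofReal_add (by positivity) (by positivity)]
  congr 1
  rw [nsmul_eq_mul]
  field_simp
  ring

/-- Each comparison involves two noises of size at most `3/ε · log ((m + 1)/β)`, hence the factor 6.
-/
theorem sparseVector_accurate {ε β : ℝ} (hε : 0 < ε) (hβ : 0 < β) (m : ℕ) (τ : ℝ) (q : ℕ → ℝ) :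
    Fails β (sparseVector ε m τ q) {i | i ≤ m ∧
      (∀ j < i, q j < τ + 6 / ε * Real.log ((m + 1) / β)) ∧
      (i < m → τ - 6 / ε * Real.log ((m + 1) / β) ≤ q i)} := by
  unfold Fails
  rw [prob_sparseVector]
  refine (measure_mono fun ω hω => ?_).trans (svtNoise_exists_gt_le hε hβ m)
  by_contra hcon
  simp only [Set.mem_ofPred_eq, not_or, not_exists, not_lt] at hcon
  obtain ⟨hX, hY⟩ := hcon
  obtain ⟨h0, h1, h2⟩ := (firstAbove_eq_iff m τ q ω _).1 rfl
  refine hω ⟨h0, fun j hj => ?_, fun hi => ?_⟩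
  · have hjm := hj.trans_le h0
    have := h2 j hj hjm
    have h3 := abs_le.1 (hY ⟨j, hjm⟩)
    have h4 := abs_le.1 hX
    have : 6 / ε * Real.log ((m + 1) / β) = 2 * (3 / ε * Real.log ((m + 1) / β)) := by ring
    linarith
  · have := h1 hi
    have h3 := abs_le.1 (hY ⟨_, hi⟩)
    have h4 := abs_le.1 hX
    have : 6 / ε * Real.log ((m + 1) / β) = 2 * (3 / ε * Real.log ((m + 1) / β)) := by ring
    linarith

/-! ### Tukey depth -/

theorem exists_norm_eq_one {d : ℕ} (hd : 0 < d) : ∃ u : E d, ‖u‖ = 1 :=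
  ⟨EuclideanSpace.single ⟨0, hd⟩ 1, by simp⟩

/-- Positive dimension provides a unit vector; with no unit vectors the infimum in ℕ would be that
of the empty set, which is 0. -/
theorem le_tukeyDepth_iff {d : ℕ} (hd : 0 < d) (P : Finset (E d)) (x : E d) (k : ℕ) :
    k ≤ tukeyDepth P x ↔
      ∀ u : E d, ‖u‖ = 1 → k ≤ {p : E d | p ∈ P ∧ inner ℝ p u ≤ inner ℝ x u}.ncard := by
  constructor
  · intro h u hu
    exact h.trans (Nat.sInf_le ⟨u, hu, rfl⟩)
  · intro h
    obtain ⟨u, hu⟩ := exists_norm_eq_one hd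
    obtain ⟨v, hv, he⟩ := Nat.sInf_mem (s := {n : ℕ | ∃ u : E d, ‖u‖ = 1 ∧
      n = {p : E d | p ∈ P ∧ inner ℝ p u ≤ inner ℝ x u}.ncard}) ⟨_, u, hu, rfl⟩
    rw [tukeyDepth, he]
    exact h v hv

theorem finite_halfspace {d : ℕ} (P : Finset (E d)) (x u : E d) :
    {p : E d | p ∈ P ∧ inner ℝ p u ≤ inner ℝ x u}.Finite :=
  P.finite_toSet.subset fun _ h => h.1

theorem Neighbouring.symm {d : ℕ} {P P' : Finset (E d)} (h : Neighbouring P P') :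
    Neighbouring P' P := by
  rwa [Neighbouring, symmDiff_comm]

theorem Neighbouring.tukeyDepth_le {d : ℕ} (hd : 0 < d) {P P' : Finset (E d)}
    (h : Neighbouring P P') (x : E d) : tukeyDepth P x ≤ tukeyDepth P' x + 1 := by
  rw [← Nat.sub_le_iff_le_add, le_tukeyDepth_iff hd]
  intro u hu
  rw [Nat.sub_le_iff_le_add]
  refine ((le_tukeyDepth_iff hd P x _).1 le_rfl u hu).trans ?_
  refine le_of_le_of_eq ?_ (congrArg _ (show _ = 1 from h))
  refine (Set.ncard_le_ncard ?_ ((finite_halfspace P' x u).union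
    ((P.finite_toSet.union P'.finite_toSet).subset symmDiff_le_sup))).trans (Set.ncard_union_le _ _)
  rintro p ⟨hp, hpx⟩
  by_cases hp' : p ∈ P'
  · exact Or.inl ⟨hp', hpx⟩
  · exact Or.inr (Or.inl ⟨hp, hp'⟩)

theorem mem_tukeyRegion_natCast {d : ℕ} {P : Finset (E d)} {k : ℕ} {x : E d} :
    x ∈ tukeyRegion P k ↔ k ≤ tukeyDepth P x := by
  rw [tukeyRegion, Set.mem_ofPred_eq, Nat.cast_le]

theorem tukeyRegion_eq_ceil {d : ℕ} (P : Finset (E d)) (κ : ℝ) :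
    tukeyRegion P κ = tukeyRegion P (⌈κ⌉₊ : ℕ) := by
  ext x
  rw [mem_tukeyRegion_natCast, Nat.ceil_le]
  rfl

theorem tukeyRegion_antitone {d : ℕ} (P : Finset (E d)) : Antitone (tukeyRegion P) :=
  fun _ _ h _ hx => h.trans hx

theorem tukeyRegion_of_nonpos {d : ℕ} (P : Finset (E d)) {κ : ℝ} (h : κ ≤ 0) :
    tukeyRegion P κ = Set.univ :=
  Set.eq_univ_of_forall fun _ => h.trans (Nat.cast_nonneg _)

/-- A point outside the convex hull of a finite set is strictly separated from it. -/
theorem exists_inner_lt_of_notMem_convexHull {d : ℕ} (hd : 0 < d) {S : Finset (E d)} {x : E d}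
    (hx : x ∉ convexHull ℝ (S : Set (E d))) :
    ∃ u : E d, ‖u‖ = 1 ∧ ∀ p ∈ S, inner ℝ x u < inner ℝ p u := by
  rcases S.eq_empty_or_nonempty with rfl | ⟨p₀, hp₀⟩
  · obtain ⟨u, hu⟩ := exists_norm_eq_one hd
    exact ⟨u, hu, by simp⟩
  · obtain ⟨f, c, hf, hc⟩ := geometric_hahn_banach_closed_point (convex_convexHull ℝ (S : Set (E d)))
      (S.finite_toSet.isClosed_convexHull ℝ) hx
    set w := (InnerProductSpace.toDual ℝ (E d)).symm f with hw
    have hwf : ∀ z, inner ℝ z w = f z := fun z => by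
      rw [real_inner_comm, hw, InnerProductSpace.toDual_symm_apply]
    have hlt : ∀ p ∈ S, inner ℝ p w < inner ℝ x w := fun p hp => by
      rw [hwf, hwf]
      exact (hf p (subset_convexHull ℝ _ hp)).trans hc
    have hw0 : w ≠ 0 := by
      intro h0
      have := hlt p₀ hp₀
      simp [h0] at this
    refine ⟨-(‖w‖⁻¹ • w), ?_, fun p hp => ?_⟩
    · rw [norm_neg, norm_smul, norm_inv, norm_norm, inv_mul_cancel₀ (norm_ne_zero_iff.2 hw0)]
    · rw [inner_neg_right, inner_neg_right, real_inner_smul_right, real_inner_smul_right]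
      have : 0 < ‖w‖⁻¹ := by positivity
      nlinarith [hlt p hp]

/-- The Tukey region is the intersection of the convex hulls of all large subsets. -/
theorem mem_tukeyRegion_iff_convexHull {d : ℕ} (hd : 0 < d) (P : Finset (E d)) (k : ℕ) (x : E d) :
    x ∈ tukeyRegion P k ↔
      ∀ S ⊆ P, P.card < S.card + k → x ∈ convexHull ℝ (S : Set (E d)) := by
  classical
  rw [mem_tukeyRegion_natCast, le_tukeyDepth_iff hd]
  constructor
  · intro h S hSP hcard
    by_contra hx
    obtain ⟨u, hu, hlt⟩ := exists_inner_lt_of_notMem_convexHull hd hx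
    have h1 := h u hu
    have h2 : {p : E d | p ∈ P ∧ inner ℝ p u ≤ inner ℝ x u} ⊆ ((P \ S : Finset (E d)) : Set (E d)) := by
      rintro p ⟨hp, hpx⟩
      rw [Finset.mem_coe, Finset.mem_sdiff]
      exact ⟨hp, fun hpS => absurd hpx (not_le.2 (hlt p hpS))⟩
    have h3 := Set.ncard_le_ncard h2 (Finset.finite_toSet _)
    rw [Set.ncard_coe_finset, Finset.card_sdiff_of_subset hSP] at h3
    have := Finset.card_le_card hSP
    omega
  · intro h u hu
    by_contra hlt
    -- If fewer than `k` points lie in the closed halfspace, the points strictly beyond it form a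
    -- large subset, whose hull misses `x`.
    set S := P.filter fun p => inner ℝ x u < inner ℝ p u with hS
    have hc : {p : E d | p ∈ P ∧ inner ℝ p u ≤ inner ℝ x u} =
        ((P.filter fun p => ¬ inner ℝ x u < inner ℝ p u : Finset (E d)) : Set (E d)) := by
      ext p; simp
    rw [hc, Set.ncard_coe_finset] at hlt
    have hadd := Finset.card_filter_add_card_filter_not (s := P)
      (fun p => inner ℝ x u < inner ℝ p u)
    have hx := h S (Finset.filter_subset _ _) (by rw [hS]; omega)
    have hconv : Convex ℝ {z : E d | inner ℝ x u < inner ℝ z u} :=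
      convex_halfSpace_gt ⟨fun a b => inner_add_left a b u, fun c a => real_inner_smul_left a u c⟩ _
    have := convexHull_min (s := (S : Set (E d))) (fun p hp => by
      have := (Finset.mem_filter.1 (Finset.mem_coe.1 hp)).2
      exact this) hconv hx
    rw [Set.mem_ofPred_eq] at this
    exact lt_irrefl _ this

theorem tukeyRegion_natCast_eq {d : ℕ} (hd : 0 < d) (P : Finset (E d)) (k : ℕ) :
    tukeyRegion P k =
      ⋂ S ∈ {S : Finset (E d) | S ⊆ P ∧ P.card < S.card + k}, convexHull ℝ (S : Set (E d)) := by
  ext x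
  rw [mem_tukeyRegion_iff_convexHull hd]
  simp only [Set.mem_iInter, Set.mem_ofPred_eq, and_imp]

theorem convex_tukeyRegion {d : ℕ} (hd : 0 < d) (P : Finset (E d)) (κ : ℝ) :
    Convex ℝ (tukeyRegion P κ) := by
  rw [tukeyRegion_eq_ceil, tukeyRegion_natCast_eq hd]
  exact convex_iInter₂ fun S _ => convex_convexHull ℝ _

theorem isClosed_tukeyRegion {d : ℕ} (hd : 0 < d) (P : Finset (E d)) (κ : ℝ) :
    IsClosed (tukeyRegion P κ) := by
  rw [tukeyRegion_eq_ceil, tukeyRegion_natCast_eq hd]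
  exact isClosed_biInter fun S _ => (S.finite_toSet.isClosed_convexHull ℝ)

theorem tukeyRegion_subset_convexHull {d : ℕ} (hd : 0 < d) (P : Finset (E d)) {κ : ℝ}
    (hκ : 0 < κ) : tukeyRegion P κ ⊆ convexHull ℝ (P : Set (E d)) := by
  intro x hx
  rw [tukeyRegion_eq_ceil] at hx
  exact (mem_tukeyRegion_iff_convexHull hd P _ x).1 hx P subset_rfl
    (by have := Nat.ceil_pos.2 hκ; omega)

theorem isCompact_tukeyRegion {d : ℕ} (hd : 0 < d) (P : Finset (E d)) {κ : ℝ}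
    (hκ : 0 < κ) : IsCompact (tukeyRegion P κ) :=
  (P.finite_toSet.isCompact_convexHull ℝ).of_isClosed_subset (isClosed_tukeyRegion hd P κ)
    (tukeyRegion_subset_convexHull hd P hκ)

/-! ### Tukey depth completion -/

theorem slice_antitone {d j : ℕ} (P : Finset (E d)) (A : E d →ₗ[ℝ] E j) (i : Fin j)
    (y : Fin j → ℝ) : Antitone (slice P A i y) := by
  rintro k k' h x ⟨p, hp, hpx⟩
  exact ⟨p, tukeyRegion_antitone P (Nat.cast_le.2 h) hp, hpx⟩

theorem convex_slice {d j : ℕ} (hd : 0 < d) (P : Finset (E d)) (A : E d →ₗ[ℝ] E j) (i : Fin j)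
    (y : Fin j → ℝ) (k : ℕ) : Convex ℝ (slice P A i y k) := by
  rintro x ⟨p, hp, hpy, rfl⟩ x' ⟨p', hp', hpy', rfl⟩ a b ha hb hab
  refine ⟨a • p + b • p', convex_tukeyRegion hd P k hp hp' ha hb hab, fun m hm => ?_, ?_⟩
  · simp only [map_add, map_smul, PiLp.add_apply, PiLp.smul_apply, smul_eq_mul, hpy m hm, hpy' m hm]
    rw [← add_mul, hab, one_mul]
  · simp

theorem bddAbove_slice {d j : ℕ} (P : Finset (E d)) (A : E d →ₗ[ℝ] E j) (i : Fin j)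
    (y : Fin j → ℝ) (x : ℝ) : BddAbove {k : ℕ | x ∈ slice P A i y k} := by
  refine ⟨P.card, ?_⟩
  rintro k ⟨p, hp, -⟩
  exact (mem_tukeyRegion_natCast.1 hp).trans (tukeyDepth_le_card P p)

theorem le_tdc_of_mem_slice {d j : ℕ} {P : Finset (E d)} {A : E d →ₗ[ℝ] E j} {i : Fin j}
    {y : Fin j → ℝ} {x : ℝ} {k : ℕ} (h : x ∈ slice P A i y k) : k ≤ tdc P A i y x :=
  le_csSup (bddAbove_slice P A i y x) h

/-- Positivity of `k` is essential: if the prefix cannot be completed at all, the supremum is that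
of the empty set, so `tdc` is 0 although even the slice at level 0 is empty. -/
theorem mem_slice_of_le_tdc {d j : ℕ} {P : Finset (E d)} {A : E d →ₗ[ℝ] E j} {i : Fin j}
    {y : Fin j → ℝ} {x : ℝ} {k : ℕ} (hk : 0 < k) (h : k ≤ tdc P A i y x) :
    x ∈ slice P A i y k := by
  have hne : {k : ℕ | x ∈ slice P A i y k}.Nonempty := by
    by_contra hne
    rw [tdc, Set.not_nonempty_iff_eq_empty.1 hne] at h
    simp at h
    omega
  exact slice_antitone P A i y h (Nat.sSup_mem hne (bddAbove_slice P A i y x))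

theorem le_tdc_iff {d j : ℕ} {P : Finset (E d)} {A : E d →ₗ[ℝ] E j} {i : Fin j}
    {y : Fin j → ℝ} {x : ℝ} {k : ℕ} (hk : 0 < k) :
    k ≤ tdc P A i y x ↔ x ∈ slice P A i y k :=
  ⟨mem_slice_of_le_tdc hk, le_tdc_of_mem_slice⟩

theorem tdc_le_card {d j : ℕ} (P : Finset (E d)) (A : E d →ₗ[ℝ] E j) (i : Fin j)
    (y : Fin j → ℝ) (x : ℝ) : tdc P A i y x ≤ P.card := by
  by_contra h
  obtain ⟨p, hp, -⟩ := mem_slice_of_le_tdc (Nat.zero_lt_of_lt (not_le.1 h)) le_rfl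
  exact absurd ((mem_tukeyRegion_natCast.1 hp).trans (tukeyDepth_le_card P p)) h

/-- Superlevel sets at positive heights are slices of a convex region; at heights at most 0 they are
the whole line. -/
theorem quasiconcaveOn_tdc {d j : ℕ} (hd : 0 < d) (P : Finset (E d)) (A : E d →ₗ[ℝ] E j)
    (i : Fin j) (y : Fin j → ℝ) :
    QuasiconcaveOn ℝ Set.univ fun x => (tdc P A i y x : ℝ) := by
  intro r
  simp only [Set.mem_univ, true_and]
  rcases le_or_gt r 0 with hr | hr
  · convert convex_univ (𝕜 := ℝ) (E := ℝ)
    exact Set.eq_univ_of_forall fun x => hr.trans (Nat.cast_nonneg _)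
  · convert convex_slice hd P A i y ⌈r⌉₊ using 1
    ext x
    rw [Set.mem_ofPred_eq, ← Nat.ceil_le, le_tdc_iff (Nat.ceil_pos.2 hr)]

/-- A completion that is deep for `P` loses at most 1 in depth for `P'`, so the same point serves as
a witness. -/
theorem Neighbouring.tdc_le {d j : ℕ} (hd : 0 < d) {P P' : Finset (E d)} (h : Neighbouring P P')
    (A : E d →ₗ[ℝ] E j) (i : Fin j) (y : Fin j → ℝ) (x : ℝ) :
    tdc P A i y x ≤ tdc P' A i y x + 1 := by
  rcases Nat.eq_zero_or_pos (tdc P A i y x) with h0 | hpos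
  · omega
  · obtain ⟨p, hp, hpx⟩ := mem_slice_of_le_tdc hpos le_rfl
    rw [← Nat.sub_le_iff_le_add]
    refine le_tdc_of_mem_slice ⟨p, mem_tukeyRegion_natCast.2 ?_, hpx⟩
    rw [Nat.sub_le_iff_le_add]
    exact (mem_tukeyRegion_natCast.1 hp).trans (h.tukeyDepth_le hd p)

theorem abs_natCast_sub_le_one {a b : ℕ} (h : a ≤ b + 1) (h' : b ≤ a + 1) :
    |(a : ℝ) - b| ≤ 1 := by
  have h1 : (a : ℝ) ≤ b + 1 := by exact_mod_cast h
  have h2 : (b : ℝ) ≤ a + 1 := by exact_mod_cast h'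
  rw [abs_le]
  constructor <;> linarith

theorem Neighbouring.abs_tdc_sub_le {d j : ℕ} (hd : 0 < d) {P P' : Finset (E d)}
    (h : Neighbouring P P') (A : E d →ₗ[ℝ] E j) (i : Fin j) (y : Fin j → ℝ) (x : ℝ) :
    |(tdc P A i y x : ℝ) - tdc P' A i y x| ≤ 1 :=
  abs_natCast_sub_le_one (h.tdc_le hd A i y x) (h.symm.tdc_le hd A i y x)

theorem bddAbove_range_min_tdcDir (D : Directions) {d n : ℕ} (P : Finset (E d))
    (A : E d →ₗ[ℝ] E (n + 1)) (v : E (n + 1)) (ℓ : ℝ) :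
    BddAbove (Set.range fun x : ℝ => min (tdcDir D P A v x) (tdcDir D P A v (x + ℓ))) := by
  refine ⟨P.card, ?_⟩
  rintro _ ⟨x, rfl⟩
  exact (min_le_left _ _).trans (tdc_le_card _ _ _ _ _)

theorem Neighbouring.diamQuery_le (D : Directions) {d n : ℕ} (hd : 0 < d) {P P' : Finset (E d)}
    (h : Neighbouring P P') (A : E d →ₗ[ℝ] E (n + 1)) (ℓ : ℝ) :
    diamQuery D P A ℓ ≤ diamQuery D P' A ℓ + 1 := by
  refine Finset.sup_le fun v hv => ?_
  refine (ciSup_le fun x => ?_).trans (Nat.add_le_add_right (Finset.le_sup (f := fun v =>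
    ⨆ x : ℝ, min (tdcDir D P' A v x) (tdcDir D P' A v (x + ℓ))) hv) 1)
  have h1 := le_ciSup (bddAbove_range_min_tdcDir D P' A v ℓ) x
  have h2 : tdcDir D P A v x ≤ tdcDir D P' A v x + 1 := h.tdc_le hd _ _ _ _
  have h3 : tdcDir D P A v (x + ℓ) ≤ tdcDir D P' A v (x + ℓ) + 1 := h.tdc_le hd _ _ _ _
  have h4 : min (tdcDir D P A v x) (tdcDir D P A v (x + ℓ)) ≤
      min (tdcDir D P' A v x) (tdcDir D P' A v (x + ℓ)) + 1 := by omega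
  exact h4.trans (Nat.add_le_add_right h1 1)

/-! ### Privacy of the bounding-box algorithm -/

theorem CloseTo.congr_params {Ω : Type} {ε δ : ℝ} {p p' : PMF Ω} (h : CloseTo ε δ p p') {ε' δ' : ℝ}
    (hε : ε = ε') (hδ : δ = δ') : CloseTo ε' δ' p p' := hε ▸ hδ ▸ h

/-- For a given prefix the refined grid is the same for both data sets, so only the score changes,
and by at most 1. -/
theorem Neighbouring.fillCoords_closeTo {d j b : ℕ} (hd : 0 < d) {P P' : Finset (E d)}
    (h : Neighbouring P P') {M : QCAlgorithm} {ε δ : ℝ} (hδ : 0 ≤ δ) (hM : QCPrivate M ε δ)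
    (A : E d →ₗ[ℝ] E j) (is : List (Fin j)) (y : Fin j → ℝ) :
    CloseTo (is.length * ε) (is.length * δ) (fillCoords M b P A is y)
      (fillCoords M b P' A is y) := by
  induction is generalizing y with
  | nil => exact CloseTo.refl _ (by simp)
  | cons i is ih =>
    have h1 := hM (refinedGrid b A i y) _ _ (quasiconcaveOn_tdc hd P A i y)
      (quasiconcaveOn_tdc hd P' A i y) (h.abs_tdc_sub_le hd A i y)
    refine (CloseTo.bind hδ (by positivity) h1 fun x => ih (Function.update y i x)).congr_params ?_ ?_
    all_goals rw [List.length_cons]; push_cast; ring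

theorem Neighbouring.dpTukeyDiam_closeTo (D : Directions) (υ : ℕ) {ε : ℝ} (hε : 0 < ε) (β κ : ℝ)
    {d n : ℕ} (hd : 0 < d) {P P' : Finset (E d)} (h : Neighbouring P P')
    (A : E d →ₗ[ℝ] E (n + 1)) :
    CloseTo ε 0 (dpTukeyDiam D υ ε β κ P A) (dpTukeyDiam D υ ε β κ P' A) :=
  (sparseVector_private hε _ _ _ _ fun _ => abs_natCast_sub_le_one
    (h.diamQuery_le D hd A _) (h.symm.diamQuery_le D hd A _)).map _

theorem Neighbouring.dpLargeTDCDirection_closeTo (D : Directions) {ε : ℝ} (hε : 0 < ε) (β κ : ℝ)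
    {d n : ℕ} (hd : 0 < d) {P P' : Finset (E d)} (h : Neighbouring P P')
    (A : E d →ₗ[ℝ] E (n + 1)) (V : List (E (n + 1))) (s : E (n + 1)) (lam : ℝ) :
    CloseTo ε 0 (dpLargeTDCDirection D ε β κ P A V s lam)
      (dpLargeTDCDirection D ε β κ P' A V s lam) := by
  refine (sparseVector_private hε _ _ _ _ fun i => ?_).map _
  cases V[i]? with
  | none => simp
  | some v => exact h.abs_tdc_sub_le hd _ _ _ _

theorem Neighbouring.findT_closeTo (D : Directions) {M : QCAlgorithm} (b : ℕ) {ε δ : ℝ}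
    (hε : 0 ≤ ε) (hδ : 0 ≤ δ) (hM : QCPrivate M ε δ)
    {d n : ℕ} (hd : 0 < d) {P P' : Finset (E d)} (h : Neighbouring P P')
    (A : E d →ₗ[ℝ] E (n + 1)) (s : E (n + 1)) (lam : ℝ) (v : Option (E (n + 1))) :
    CloseTo (n * ε) (n * δ) (findT D M b P A s lam v) (findT D M b P' A s lam v) := by
  cases v with
  | none => exact CloseTo.refl _ (by positivity)
  | some v =>
    have h1 := h.fillCoords_closeTo (b := b) hd hδ hM (D.rotate v A) (List.finRange (n + 1)).tail
      (Function.update 0 0 (inner ℝ s v + lam))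
    rw [List.length_tail, List.length_finRange, Nat.add_sub_cancel] at h1
    exact h1.map _

/-- The number of calls to private subroutines in dimension `j`. -/
def recCalls : ℕ → ℕ
  | 0 => 0
  | 1 => 2
  | n + 2 => recCalls (n + 1) + (2 * (n + 2) + 1)

/-- The sum is `2 + ∑ (2 j + 1)` over `2 ≤ j ≤ d`. -/
theorem recCalls_succ (n : ℕ) : (recCalls (n + 1) : ℝ) = numCalls (n + 1) := by
  induction n with
  | zero => norm_num [recCalls, numCalls]
  | succ n ih =>
    rw [recCalls, Nat.cast_add, ih, numCalls, numCalls]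
    push_cast
    ring

theorem recCalls_eq {d : ℕ} (hd : 0 < d) : (recCalls d : ℝ) = numCalls d := by
  obtain ⟨n, rfl⟩ : ∃ n, d = n + 1 := ⟨d - 1, by omega⟩
  exact recCalls_succ n

theorem Neighbouring.bbRec_closeTo (D : Directions) {M : QCAlgorithm} (b : ℕ) {ε δ : ℝ}
    (hε : 0 < ε) (hδ : 0 ≤ δ) (β κ : ℝ) (hM : QCPrivate M ε δ)
    {d : ℕ} (hd : 0 < d) {P P' : Finset (E d)} (h : Neighbouring P P')
    (j : ℕ) (A : E d →ₗ[ℝ] E j) :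
    CloseTo (recCalls j * ε) (recCalls j * δ) (bbRec D M b ε β κ P j A)
      (bbRec D M b ε β κ P' j A) := by
  induction j using recCalls.induct with
  | case1 => exact CloseTo.refl _ (by simp [recCalls])
  | case2 =>
    have h1 := h.fillCoords_closeTo (b := b) hd hδ hM A (List.finRange 1) 0
    rw [List.length_finRange] at h1
    refine ((CloseTo.bind (by positivity) (by linarith) h1 fun s =>
      CloseTo.bind le_rfl le_rfl (h.dpTukeyDiam_closeTo D (refinedBits d b) hε β κ hd A) fun ℓ =>
      CloseTo.refl _ le_rfl).weaken (δ' := recCalls 1 * δ) ?_).congr_params ?_ rfl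
    · simp only [recCalls]; push_cast; linarith
    · simp only [recCalls]; push_cast; ring
  | case3 n ih =>
    have h1 := h.fillCoords_closeTo (b := b) hd hδ hM A (List.finRange (n + 2)) 0
    rw [List.length_finRange] at h1
    have hn : (0 : ℝ) ≤ ((n + 1 : ℕ) : ℝ) * δ := by positivity
    have hr : (0 : ℝ) ≤ (recCalls (n + 1) : ℝ) * δ := by positivity
    refine ((CloseTo.bind (by positivity) (by linarith) h1 fun s =>
      CloseTo.bind le_rfl (by linarith)
        (h.dpTukeyDiam_closeTo D (refinedBits d b) hε β κ hd A) fun ℓ =>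
      CloseTo.bind le_rfl (by linarith)
        (h.dpLargeTDCDirection_closeTo D hε β (κ - deltaDiam d (refinedBits d b) ε β) hd A
          (D.V (n + 2)) (WithLp.toLp 2 s) (0.45 * ℓ)) fun v =>
      CloseTo.bind hn (by linarith)
        (h.findT_closeTo D b hε.le hδ hM hd A (WithLp.toLp 2 s) (0.45 * ℓ) v) fun t =>
      CloseTo.bind hr le_rfl (ih _) fun B' =>
      CloseTo.refl _ le_rfl).weaken (δ' := recCalls (n + 2) * δ) ?_).congr_params ?_ rfl
    · simp only [recCalls]; push_cast; linarith
    · simp only [recCalls]; push_cast; ring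

theorem numCalls_pos {d : ℕ} (hd : 0 < d) : 0 < numCalls d := by
  have : (1 : ℝ) ≤ d := by exact_mod_cast hd
  unfold numCalls
  nlinarith

theorem boundingBox_isDP (D : Directions) (M : ℝ → ℝ → ℝ → QCAlgorithm) (d b : ℕ)
    {ε δ : ℝ} (β κ : ℝ) (hd : 0 < d) (hε : 0 < ε) (hδ : 0 ≤ δ)
    (hM : QCPrivate (M (ε / numCalls d) (δ / numCalls d) (β / numCalls d))
      (ε / numCalls d) (δ / numCalls d)) :
    IsDP (fun P : Finset (E d) => boundingBox D M b ε δ β κ P) ε δ := by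
  intro P P' h
  have hk := numCalls_pos hd
  refine (h.bbRec_closeTo D b (div_pos hε hk) (div_nonneg hδ hk.le) (β / numCalls d) κ hM hd d
    LinearMap.id).congr_params ?_ ?_
  all_goals rw [recCalls_eq hd]; field_simp

/-! ### The affine structure of Tukey regions -/

/-- All barycentric weights are positive, so a small multiple of a weight vector with sum 0 can be
added without leaving the simplex. -/
theorem eventually_mem_convexHull_range {V ι : Type*} [AddCommGroup V] [Module ℝ V] [Fintype ι]
    (z : ι → V) (c : ι → ℝ) (hc : ∀ i, 0 < c i) (hc1 : ∑ i, c i = 1) {w : V}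
    (hw : w ∈ vectorSpan ℝ (Set.range z)) :
    ∀ᶠ t in nhds (0 : ℝ), ∑ i, c i • z i + t • w ∈ convexHull ℝ (Set.range z) := by
  obtain ⟨s, a, ha, rfl⟩ := (mem_vectorSpan_iff_eq_weightedVSub ℝ).1 hw
  classical
  set a' : ι → ℝ := fun i => if i ∈ s then a i else 0 with ha'
  have ha0 : ∑ i, a' i = 0 := by rw [← ha, ha', Finset.sum_ite_mem, Finset.univ_inter]
  have hsum : s.weightedVSub z a = ∑ i, a' i • z i := by
    rw [Finset.weightedVSub_eq_linear_combination _ ha]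
    simp only [ha', ite_smul, zero_smul, Finset.sum_ite_mem, Finset.univ_inter]
  have hpos : ∀ᶠ t in nhds (0 : ℝ), ∀ i, 0 < c i + t * a' i := by
    rw [Filter.eventually_all]
    intro i
    have hcont : ContinuousAt (fun t : ℝ => c i + t * a' i) 0 := by fun_prop
    refine hcont.eventually_mem (Ioi_mem_nhds ?_)
    simpa using hc i
  filter_upwards [hpos] with t ht
  rw [hsum, Finset.smul_sum, ← Finset.sum_add_distrib]
  have h1 : ∑ i, (c i + t * a' i) = 1 := by
    rw [Finset.sum_add_distrib, ← Finset.mul_sum, ha0, hc1, mul_zero, add_zero]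
  have h2 := (convex_convexHull ℝ (Set.range z)).sum_mem (t := Finset.univ)
    (w := fun i => c i + t * a' i) (z := z) (fun i _ => (ht i).le) h1
    (fun i _ => subset_convexHull ℝ _ ⟨i, rfl⟩)
  convert h2 using 2 with i
  rw [smul_smul, add_smul]

/-- Every point of a convex hull lies in the relative interior of a simplex. -/
theorem exists_simplex_of_mem_convexHull {V : Type*} [AddCommGroup V] [Module ℝ V] {S : Set V}
    {x : V} (hx : x ∈ convexHull ℝ S) :
    ∃ F : Finset V, (F : Set V) ⊆ S ∧ AffineIndependent ℝ ((↑) : F → V) ∧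
      x ∈ affineSpan ℝ (F : Set V) ∧
      ∀ w ∈ vectorSpan ℝ (F : Set V), ∀ᶠ t in nhds (0 : ℝ), x + t • w ∈ convexHull ℝ S := by
  classical
  obtain ⟨ι, _, z, c, hz, hind, hc, hc1, rfl⟩ := eq_pos_convex_span_of_mem_convexHull hx
  have hF : ((Finset.univ.image z : Finset V) : Set V) = Set.range z := by simp
  refine ⟨Finset.univ.image z, by rwa [hF], ?_, ?_, ?_⟩
  · have h := hind.range
    rwa [← hF] at h
  · rw [hF]
    refine convexHull_subset_affineSpan _ ?_
    exact (convex_convexHull ℝ (Set.range z)).sum_mem (fun i _ => (hc i).le) hc1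
      (fun i _ => subset_convexHull ℝ _ ⟨i, rfl⟩)
  · rw [hF]
    intro w hw
    filter_upwards [eventually_mem_convexHull_range z c hc hc1 hw] with t ht
    exact convexHull_mono hz ht

/-- The intersection of a family of subspaces of a `d`-dimensional space is the intersection of
at most `d` proper subspaces of the family. -/
theorem exists_finset_iInf_eq {d : ℕ} {ι : Type*} (D : ι → Submodule ℝ (E d)) :
    ∃ T : Finset ι, T.card ≤ d ∧ (∀ i ∈ T, D i ≠ ⊤) ∧
      ∀ w, (∀ i ∈ T, w ∈ D i) → ∀ i, w ∈ D i := by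
  classical
  -- A basis of the sum of the orthogonal complements is picked from the complements themselves.
  -- Each basis vector selects one subspace, which is proper because the vector is nonzero.
  obtain ⟨t, hts, hcard, hspan, hind⟩ :=
    Submodule.exists_finset_span_eq_linearIndepOn ℝ (⋃ i, ((D i)ᗮ : Set (E d)))
  have hts' : ∀ v : t, ∃ i, (v : E d) ∈ (D i)ᗮ := fun v => by
    have := hts v.2
    simpa using this
  choose g hg using hts'
  refine ⟨Finset.univ.image g, ?_, ?_, ?_⟩
  · refine Finset.card_image_le.trans ?_
    rw [Finset.card_univ, Fintype.card_coe, hcard]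
    exact (Submodule.finrank_le _).trans_eq finrank_euclideanSpace_fin
  · intro i hi htop
    obtain ⟨v, -, rfl⟩ := Finset.mem_image.1 hi
    have h1 := hg v
    rw [htop, Submodule.top_orthogonal_eq_bot, Submodule.mem_bot] at h1
    exact hind.ne_zero v.2 h1
  · intro w hw i
    rw [← Submodule.orthogonal_orthogonal (D i), Submodule.mem_orthogonal]
    intro u hu
    have hu' : u ∈ Submodule.span ℝ (t : Set (E d)) := by
      rw [hspan]
      exact Submodule.subset_span (Set.mem_iUnion.2 ⟨i, hu⟩)
    refine Submodule.span_induction (p := fun u _ => inner ℝ u w = 0) ?_ ?_ ?_ ?_ hu'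
    · intro v hv
      have h1 := hw (g ⟨v, hv⟩) (Finset.mem_image_of_mem _ (Finset.mem_univ _))
      exact (Submodule.mem_orthogonal' _ _).1 (hg ⟨v, hv⟩) w h1
    · exact inner_zero_left _
    · intro a b _ _ ha hb
      rw [inner_add_left, ha, hb, add_zero]
    · intro c a _ ha
      rw [real_inner_smul_left, ha, mul_zero]

/-- Locally around one of its points `p`, a Tukey region contains the intersection of at most `d`
flats through `p` that are spanned by at most `d` data points each. -/
theorem exists_flats_of_mem_tukeyRegion {d : ℕ} (hd : 0 < d) {P : Finset (E d)} {k : ℕ} {p : E d}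
    (hp : p ∈ tukeyRegion P k) :
    ∃ Fs : Finset (Finset (E d)), Fs.card ≤ d ∧
      (∀ F ∈ Fs, F ⊆ P ∧ F.card ≤ d ∧ AffineIndependent ℝ ((↑) : F → E d) ∧
        p ∈ affineSpan ℝ (F : Set (E d))) ∧
      ∀ w, (∀ F ∈ Fs, w ∈ vectorSpan ℝ (F : Set (E d))) →
        ∀ᶠ t in nhds (0 : ℝ), p + t • w ∈ tukeyRegion P k := by
  classical
  have hp' := (mem_tukeyRegion_iff_convexHull hd P k p).1 hp
  set ι := {S : Finset (E d) // S ⊆ P ∧ P.card < S.card + k}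
  have hfin : Finite ι :=
    ((P.powerset.finite_toSet).subset fun S hS => Finset.mem_powerset.2 hS.1 :
      {S : Finset (E d) | S ⊆ P ∧ P.card < S.card + k}.Finite)
  have h1 := fun S : ι => exists_simplex_of_mem_convexHull (hp' S.1 S.2.1 S.2.2)
  choose F hFS hFind hpF hFw using h1
  obtain ⟨T, hT, hTtop, hTw⟩ := exists_finset_iInf_eq fun S => vectorSpan ℝ (F S : Set (E d))
  refine ⟨T.image F, Finset.card_image_le.trans hT, ?_, ?_⟩
  · intro F' hF'
    obtain ⟨S, hS, rfl⟩ := Finset.mem_image.1 hF'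
    refine ⟨(Finset.coe_subset.1 (hFS S)).trans S.2.1, ?_, hFind S, hpF S⟩
    have hne : Nonempty (F S) := by
      by_contra hne
      have : (F S : Set (E d)) = ∅ := by
        rw [Finset.coe_eq_empty, Finset.eq_empty_iff_forall_notMem]
        exact fun a ha => hne ⟨⟨a, ha⟩⟩
      have h2 := hpF S
      rw [this, AffineSubspace.span_empty] at h2
      exact AffineSubspace.notMem_bot _ _ _ h2
    -- The span is a proper subspace, so its dimension is below `d`, and the simplex has at most `d`
    -- vertices instead of `d + 1`.
    have h2 := (hFind S).finrank_vectorSpan_add_one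
    rw [Subtype.range_coe_subtype, Fintype.card_coe] at h2
    have h3 : Module.finrank ℝ (vectorSpan ℝ (F S : Set (E d))) < d :=
      (Submodule.finrank_lt (hTtop S hS)).trans_eq finrank_euclideanSpace_fin
    have h4 : Module.finrank ℝ (vectorSpan ℝ {x : E d | x ∈ F S}) < d := h3
    omega
  · intro w hw
    have hw' := hTw w fun S hS => hw (F S) (Finset.mem_image_of_mem F hS)
    have h2 : ∀ᶠ t in nhds (0 : ℝ), ∀ S : ι, p + t • w ∈ convexHull ℝ (S.1 : Set (E d)) :=
      Filter.eventually_all.2 fun S => hFw S w (hw' S)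
    filter_upwards [h2] with t ht
    rw [mem_tukeyRegion_iff_convexHull hd]
    exact fun S hSP hS => ht ⟨S, hSP, hS⟩

/-! ### The size of the refined grid -/

theorem exists_image_univ_eq {α : Type*} [DecidableEq α] {d : ℕ} {F : Finset α} (hF : F.Nonempty)
    (hd : F.card ≤ d) : ∃ f : Fin d → α, Finset.univ.image f = F := by
  have : Nonempty F := hF.to_subtype
  obtain ⟨e⟩ := Function.Embedding.nonempty_of_card_le (α := F) (β := Fin d) (by simpa using hd)
  refine ⟨fun i => ((Function.invFun e i : F) : α), ?_⟩
  ext a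
  simp only [Finset.mem_image, Finset.mem_univ, true_and]
  constructor
  · rintro ⟨i, rfl⟩
    exact (Function.invFun e i).2
  · intro ha
    obtain ⟨i, hi⟩ := Function.invFun_surjective e.injective ⟨a, ha⟩
    exact ⟨i, by rw [hi]⟩

/-- The point of the grid with the given integer coordinates. -/
def gridPoint {d : ℕ} (b : ℕ) (c : Fin d → Fin (2 ^ b + 1)) : E d :=
  WithLp.toLp 2 fun i => (c i : ℝ) / 2 ^ b

theorem exists_gridPoint_eq {d b : ℕ} {p : E d} (hp : p ∈ gridPoints d b) :
    ∃ c, gridPoint b c = p := by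
  choose m hm hpm using hp
  exact ⟨fun i => ⟨m i, Nat.lt_succ_of_le (hm i)⟩, by ext i; exact (hpm i).symm⟩

open Classical in
/-- The family of finite sets of grid points that is given by the integer coordinates of the
points. -/
def flatsOfCode {d : ℕ} (b : ℕ) :
    Option (Fin d → Fin d → Fin d → Fin (2 ^ b + 1)) → Finset (Finset (E d))
  | none => ∅
  | some c => Finset.univ.image fun i => Finset.univ.image fun l => gridPoint b (c i l)

theorem exists_flatsOfCode_eq {d b : ℕ} {Fs : Finset (Finset (E d))} (h : Fs.card ≤ d)
    (hF : ∀ F ∈ Fs, F.Nonempty ∧ F.card ≤ d ∧ (F : Set (E d)) ⊆ gridPoints d b) :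
    ∃ c, flatsOfCode b c = Fs := by
  classical
  rcases Fs.eq_empty_or_nonempty with rfl | hne
  · exact ⟨none, rfl⟩
  · obtain ⟨f, hf⟩ := exists_image_univ_eq hne h
    have h1 : ∀ i, f i ∈ Fs := fun i => by
      rw [← hf]
      exact Finset.mem_image_of_mem _ (Finset.mem_univ _)
    choose g hg using fun i => exists_image_univ_eq (hF _ (h1 i)).1 (hF _ (h1 i)).2.1
    have h2 : ∀ i l, g i l ∈ gridPoints d b := fun i l =>
      (hF _ (h1 i)).2.2 (by
        rw [Finset.mem_coe, ← hg i]
        exact Finset.mem_image_of_mem _ (Finset.mem_univ _))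
    choose c hc using fun i l => exists_gridPoint_eq (h2 i l)
    refine ⟨some c, ?_⟩
    rw [← hf, flatsOfCode]
    congr 1
    funext i
    rw [← hg i]
    congr 1
    funext l
    exact hc i l

/-- `x` is the only value of the coordinate `i` on the intersection of the flats `Fs` with the flat
on which the previous coordinates are given by `y`. -/
def DeterminesCoord {d j : ℕ} (A : E d →ₗ[ℝ] E j) (i : Fin j) (y : Fin j → ℝ)
    (Fs : Finset (Finset (E d))) (x : ℝ) : Prop :=
  (∃ p : E d, (∀ m < i, A p m = y m) ∧ (∀ F ∈ Fs, p ∈ affineSpan ℝ (F : Set (E d))) ∧ A p i = x) ∧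
    ∀ p : E d, (∀ m < i, A p m = y m) → (∀ F ∈ Fs, p ∈ affineSpan ℝ (F : Set (E d))) → A p i = x

theorem DeterminesCoord.unique {d j : ℕ} {A : E d →ₗ[ℝ] E j} {i : Fin j} {y : Fin j → ℝ}
    {Fs : Finset (Finset (E d))} {x x' : ℝ} (h : DeterminesCoord A i y Fs x)
    (h' : DeterminesCoord A i y Fs x') : x = x' := by
  obtain ⟨⟨p, hp, hpF, rfl⟩, -⟩ := h
  exact h'.2 p hp hpF

/-- If another point `z` of the flats with the same prefix had a different coordinate, moving from
`p` a little along `z - p` in both directions would stay in the Tukey region and push the coordinate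
past `x` on either side, against its extremality. -/
theorem exists_determinesCoord {d j b : ℕ} (hd : 0 < d) {A : E d →ₗ[ℝ] E j} {i : Fin j}
    {y : Fin j → ℝ} {Q : Finset (E d)} (hQ : (Q : Set (E d)) ⊆ gridPoints d b) {k : ℕ} {x : ℝ}
    (hx : IsLeast (slice Q A i y k) x ∨ IsGreatest (slice Q A i y k) x) :
    ∃ c, DeterminesCoord A i y (flatsOfCode b c) x := by
  obtain ⟨p, hp, hpy, hpx⟩ : x ∈ slice Q A i y k := hx.elim (fun h => h.1) fun h => h.1
  obtain ⟨Fs, hcard, hFs, hw⟩ := exists_flats_of_mem_tukeyRegion hd hp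
  obtain ⟨c, hc⟩ := exists_flatsOfCode_eq (b := b) hcard fun F hF =>
    ⟨by
      rw [Finset.nonempty_iff_ne_empty]
      rintro rfl
      have h2 := (hFs _ hF).2.2.2
      rw [Finset.coe_empty, AffineSubspace.span_empty] at h2
      exact AffineSubspace.notMem_bot _ _ _ h2,
    (hFs F hF).2.1, (Finset.coe_subset.2 (hFs F hF).1).trans hQ⟩
  refine ⟨c, ⟨p, hpy, fun F hF => (hFs F (hc ▸ hF)).2.2.2, hpx⟩, fun z hz hzF => ?_⟩
  have hev := hw (z - p) fun F hF => by
    rw [← direction_affineSpan]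
    exact AffineSubspace.vsub_mem_direction (hzF F (by rwa [hc])) (hFs F hF).2.2.2
  obtain ⟨r, hr, hball⟩ := Metric.eventually_nhds_iff.1 hev
  have hmem : ∀ t : ℝ, |t| < r → x + t * (A z i - x) ∈ slice Q A i y k := by
    intro t ht
    refine ⟨p + t • (z - p), hball (by simpa [Real.dist_eq] using ht), fun m hm => ?_, ?_⟩
    · simp [hpy m hm, hz m hm]
    · simp [hpx]
  have h1 := hmem (r / 2) (by rw [abs_of_pos (by positivity)]; linarith)
  have h2 := hmem (-(r / 2)) (by rw [abs_neg, abs_of_pos (by positivity)]; linarith)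
  rcases hx with hx | hx
  · have h3 := hx.2 h1
    have h4 := hx.2 h2
    nlinarith
  · have h3 := hx.2 h1
    have h4 := hx.2 h2
    nlinarith

theorem two_pow_add_one_le (b : ℕ) (hb : 1 ≤ b) : 2 ^ b + 1 ≤ 2 ^ (2 * b) := by
  have h1 : 2 ≤ 2 ^ b := by
    calc 2 = 2 ^ 1 := rfl
      _ ≤ 2 ^ b := Nat.pow_le_pow_right (by norm_num) hb
  rw [two_mul, pow_add]
  nlinarith

theorem card_refinedGrid_le {d j b : ℕ} (hd : 0 < d) (hb : 1 ≤ b) (A : E d →ₗ[ℝ] E j) (i : Fin j)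
    (y : Fin j → ℝ) : (refinedGrid b A i y).card ≤ 2 ^ refinedBits d b := by
  classical
  set G : Finset ℝ := Finset.univ.image fun m : Fin (2 ^ b + 1) => ((m : ℕ) : ℝ) / 2 ^ b with hG
  have hsub : (refinedGrid b A i y : Set ℝ) ⊆ (G : Set ℝ) ∪ ⋃ c ∈ (Finset.univ :
      Finset (Option (Fin d → Fin d → Fin d → Fin (2 ^ b + 1)))),
      {x | DeterminesCoord A i y (flatsOfCode b c) x} := by
    intro x hx
    rw [refinedGrid, Set.Finite.coe_toFinset] at hx
    rcases hx with ⟨m, hm, rfl⟩ | ⟨Q, hQ, k, -, hx⟩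
    · left
      rw [hG, Finset.mem_coe, Finset.mem_image]
      exact ⟨⟨m, Nat.lt_succ_of_le hm⟩, Finset.mem_univ _, rfl⟩
    · right
      obtain ⟨c, hc⟩ := exists_determinesCoord hd hQ hx
      simp only [Finset.mem_univ, Set.iUnion_true, Set.mem_iUnion]
      exact ⟨c, hc⟩
  have hss : ∀ c, {x | DeterminesCoord A i y (flatsOfCode b c) x}.Subsingleton :=
    fun c x hx x' hx' => DeterminesCoord.unique hx hx'
  have hfin : (⋃ c ∈ (Finset.univ :
      Finset (Option (Fin d → Fin d → Fin d → Fin (2 ^ b + 1)))),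
      {x | DeterminesCoord A i y (flatsOfCode b c) x}).Finite :=
    Set.Finite.biUnion (Finset.finite_toSet _) fun c _ => (hss c).finite
  rw [← Set.ncard_coe_finset]
  refine (Set.ncard_le_ncard hsub (G.finite_toSet.union hfin)).trans ?_
  refine (Set.ncard_union_le _ _).trans ?_
  have h1 : (G : Set ℝ).ncard ≤ 2 ^ b + 1 := by
    rw [Set.ncard_coe_finset]
    exact Finset.card_image_le.trans (by simp)
  have h2 := (Finset.set_ncard_biUnion_le (Finset.univ :
      Finset (Option (Fin d → Fin d → Fin d → Fin (2 ^ b + 1))))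
      fun c => {x | DeterminesCoord A i y (flatsOfCode b c) x}).trans
      (Finset.sum_le_card_nsmul _ _ 1 fun c _ =>
        (Set.ncard_le_one (hss c).finite).2 fun _ ha _ ha' => hss c ha ha')
  simp only [Finset.card_univ, Fintype.card_option, Fintype.card_fun, Fintype.card_fin, smul_eq_mul,
    mul_one] at h2
  refine (add_le_add h1 h2).trans ?_
  -- The grid has `2^b + 1` points and there are `(2^b + 1)^(d³) + 1` codes. With `2^b + 1 ≤ 2^(2b)`
  -- the total is at most `4 · 2^(2 b d³) ≤ 2^(4 b d³)`.
  have hn := two_pow_add_one_le b hb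
  have hd3 : 1 ≤ d ^ 3 := Nat.one_le_pow _ _ hd
  have hbd : b ≤ b * d ^ 3 := Nat.le_mul_of_pos_right b hd3
  have h3 : (((2 ^ b + 1) ^ d) ^ d) ^ d ≤ 2 ^ (2 * (b * d ^ 3)) := by
    rw [← pow_mul, ← pow_mul]
    refine (Nat.pow_le_pow_left hn _).trans_eq ?_
    rw [← pow_mul]
    congr 1
    ring
  have h4 : 2 ^ (2 * b) ≤ 2 ^ (2 * (b * d ^ 3)) := Nat.pow_le_pow_right (by norm_num) (by omega)
  have h5 : 4 * 2 ^ (2 * (b * d ^ 3)) ≤ 2 ^ (4 * (b * d ^ 3)) := by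
    calc 4 * 2 ^ (2 * (b * d ^ 3)) = 2 ^ (2 + 2 * (b * d ^ 3)) := by rw [pow_add]; norm_num
      _ ≤ _ := Nat.pow_le_pow_right (by norm_num) (by omega)
  have h6 : 2 ^ (4 * (b * d ^ 3)) ≤ 2 ^ refinedBits d b := by
    refine Nat.pow_le_pow_right (by norm_num) ?_
    have : refinedBits d b = 4 * (b * d ^ 3) * d := by rw [refinedBits]; ring
    rw [this]
    exact Nat.le_mul_of_pos_right _ hd
  have h7 : 1 ≤ 2 ^ (2 * (b * d ^ 3)) := Nat.one_le_two_pow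
  omega

/-! ### Solutions of integer linear systems -/

/-- Expanding the product of the column sums gives one term for every function `N → N`; the Leibniz
formula uses only the permutations among them. -/
theorem Matrix.abs_det_le_prod_sum {N : Type*} [Fintype N] [DecidableEq N] (B : Matrix N N ℤ) :
    |B.det| ≤ ∏ n, ∑ r, |B r n| := by
  rw [Matrix.det_apply', Finset.prod_univ_sum, Fintype.piFinset_univ]
  calc |∑ σ : Equiv.Perm N, ((Equiv.Perm.sign σ : ℤ) : ℤ) * ∏ i, B (σ i) i|
      ≤ ∑ σ : Equiv.Perm N, ∏ i, |B (σ i) i| := by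
        refine (Finset.abs_sum_le_sum_abs _ _).trans_eq (Finset.sum_congr rfl fun σ _ => ?_)
        rw [abs_mul, Finset.abs_prod]
        rcases Int.units_eq_one_or (Equiv.Perm.sign σ) with h | h <;> simp [h]
    _ = ∑ f ∈ (Finset.univ : Finset (Equiv.Perm N)).map
          ⟨fun σ : Equiv.Perm N => (σ : N → N), DFunLike.coe_injective⟩, ∏ i, |B (f i) i| := by
        rw [Finset.sum_map]
        rfl
    _ ≤ ∑ f : N → N, ∏ i, |B (f i) i| :=
        Finset.sum_le_sum_of_subset_of_nonneg (Finset.subset_univ _) fun f _ _ =>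
          Finset.prod_nonneg fun i _ => abs_nonneg _

theorem exists_linearIndependent_of_span_eq_top {V N : Type*} [AddCommGroup V] [Module ℝ V]
    [FiniteDimensional ℝ V] [Fintype N] {s : Set V} (hs : Submodule.span ℝ s = ⊤)
    (hN : Fintype.card N = Module.finrank ℝ V) :
    ∃ f : N → V, (∀ i, f i ∈ s) ∧ LinearIndependent ℝ f := by
  obtain ⟨f, hfs, -, hind⟩ := Submodule.exists_fun_fin_finrank_span_eq ℝ s
  have hc : Fintype.card N = Module.finrank ℝ (Submodule.span ℝ s) := by
    rw [hs, finrank_top, hN]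
  exact ⟨f ∘ Fintype.equivFinOfCardEq hc, fun i => hfs _, hind.comp _ (Equiv.injective _)⟩

/-- A functional that vanishes on all rows would be a kernel vector, so the rows span and contain a
basis. -/
theorem Matrix.exists_injective_det_submatrix_ne_zero {R N : Type*} [Fintype N] [DecidableEq N]
    (B : Matrix R N ℝ) (hB : ∀ x : N → ℝ, (∀ r, ∑ n, B r n * x n = 0) → x = 0) :
    ∃ g : N → R, Function.Injective g ∧ (B.submatrix g id).det ≠ 0 := by
  have hspan : Submodule.span ℝ (Set.range B.row) = ⊤ := by
    by_contra hne
    obtain ⟨f, hf0, hf⟩ := Submodule.exists_le_ker_of_lt_top _ (lt_top_iff_ne_top.2 hne)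
    have hfx : ∀ z : N → ℝ, f z = ∑ n, z n * f (Pi.single n 1) := fun z => by
      rw [LinearMap.pi_apply_eq_sum_univ f z]
      refine Finset.sum_congr rfl fun n _ => ?_
      rw [smul_eq_mul]
      congr 2
      ext m
      simp [Pi.single_apply, eq_comm]
    have h0 := hB (fun n => f (Pi.single n 1)) fun r => by
      have := hf (Submodule.subset_span ⟨r, rfl⟩)
      rw [LinearMap.mem_ker, hfx] at this
      exact this
    refine hf0 (LinearMap.ext fun z => ?_)
    rw [hfx]
    simp [fun n => congrFun h0 n]
  obtain ⟨f, hfs, hind⟩ := exists_linearIndependent_of_span_eq_top (N := N) hspan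
    (Module.finrank_fintype_fun_eq_card ℝ).symm
  choose g hg using hfs
  have hgf : (B.submatrix g id).row = f := funext hg
  refine ⟨g, fun i i' h => hind.injective ?_, ?_⟩
  · rw [← hg i, ← hg i', h]
  · rw [← hgf, Matrix.linearIndependent_rows_iff_isUnit, Matrix.isUnit_iff_isUnit_det] at hind
    exact hind.ne_zero

/-- The solution of an integer linear system with trivial kernel has a common denominator that is
bounded by the product of the `ℓ₁`-norms of the columns. -/
theorem exists_common_denominator {R N : Type*} [Fintype R] [Fintype N] (B : Matrix R N ℤ)
    (hB : ∀ x : N → ℝ, (∀ r, ∑ n, (B r n : ℝ) * x n = 0) → x = 0) (c : R → ℤ) (x : N → ℝ)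
    (hx : ∀ r, ∑ n, (B r n : ℝ) * x n = c r) :
    ∃ q : ℤ, q ≠ 0 ∧ |q| ≤ ∏ n, ∑ r, |B r n| ∧ ∃ z : N → ℤ, ∀ n, (q : ℝ) * x n = z n := by
  classical
  obtain ⟨g, hg, hdet⟩ := Matrix.exists_injective_det_submatrix_ne_zero (B.map (Int.cast : ℤ → ℝ)) hB
  set B' : Matrix N N ℤ := B.submatrix g id with hB'
  have hmap : (B.map (Int.cast : ℤ → ℝ)).submatrix g id = B'.map (Int.cast : ℤ → ℝ) := rfl
  have hdet' : ((B'.det : ℤ) : ℝ) = (B'.map (Int.cast : ℤ → ℝ)).det := Int.cast_det B'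
  -- Cramer's rule for a regular square subsystem: the determinant is the denominator, and the
  -- adjugate gives integer numerators.
  refine ⟨B'.det, fun h0 => hdet ?_, ?_, fun n => ∑ m, B'.adjugate n m * c (g m), fun n => ?_⟩
  · rw [hmap, ← hdet', h0, Int.cast_zero]
  · refine (Matrix.abs_det_le_prod_sum B').trans (Finset.prod_le_prod
      (fun n _ => Finset.sum_nonneg fun _ _ => abs_nonneg _) fun n _ => ?_)
    calc ∑ r, |B' r n| = ∑ r ∈ Finset.univ.map ⟨g, hg⟩, |B r n| := by
          rw [Finset.sum_map]
          rfl
      _ ≤ _ := Finset.sum_le_sum_of_subset_of_nonneg (Finset.subset_univ _) fun _ _ _ =>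
          abs_nonneg _
  · have h1 : ∀ m, (c (g m) : ℝ) = ∑ l, (B' m l : ℝ) * x l := fun m => (hx (g m)).symm
    have h2 : ∀ l, ∑ m, (B'.adjugate n m : ℝ) * (B' m l : ℝ) = if n = l then (B'.det : ℝ) else 0 := by
      intro l
      have := congrFun (congrFun (Matrix.adjugate_mul B') n) l
      rw [Matrix.mul_apply, Matrix.smul_apply, Matrix.one_apply, smul_eq_mul, mul_ite, mul_one,
        mul_zero] at this
      exact_mod_cast this
    rw [Int.cast_sum]
    simp_rw [Int.cast_mul, h1, Finset.mul_sum]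
    rw [Finset.sum_comm]
    simp_rw [← mul_assoc, ← Finset.sum_mul, h2]
    simp only [ite_mul, zero_mul, Finset.sum_ite_eq, Finset.mem_univ, if_true]

/-! ### Vertices of Tukey regions -/

/-- A common denominator for the coordinates of the vertices of Tukey regions, in units of the
granularity of the grid. -/
def vertexDenom (d b : ℕ) : ℕ := (d * 2 ^ b + 1) ^ (d * d) * d ^ d

/-- The vertex and its barycentric coordinates in each of its flats solve an integer linear system
after scaling by `2^b`. The kernel is trivial because no direction is common to all flats and
because each flat is spanned by affinely independent points. -/
theorem exists_vertex_denominator {d b : ℕ} (hd : 0 < d) {P : Finset (E d)}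
    (hP : (P : Set (E d)) ⊆ gridPoints d b) {k : ℕ} {v : E d}
    (hv : v ∈ (tukeyRegion P k).extremePoints ℝ) :
    ∃ q : ℤ, q ≠ 0 ∧ |q| ≤ vertexDenom d b ∧ ∃ z : Fin d → ℤ, ∀ l, (q : ℝ) * (2 ^ b * v l) = z l := by
  classical
  obtain ⟨Fs, hcard, hFs, hw⟩ := exists_flats_of_mem_tukeyRegion hd hv.1
  -- Moving both ways along a common direction of the flats stays in the region, which an extreme
  -- point does not allow unless the direction is 0.
  have hw0 : ∀ w, (∀ F ∈ Fs, w ∈ vectorSpan ℝ (F : Set (E d))) → w = 0 := by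
    intro w hwF
    obtain ⟨r, hr, hball⟩ := Metric.eventually_nhds_iff.1 (hw w hwF)
    have h1 := hball (y := r / 2) (by
      rw [Real.dist_eq, sub_zero, abs_of_pos (by positivity)]; linarith)
    have h2 := hball (y := -(r / 2)) (by
      rw [Real.dist_eq, sub_zero, abs_neg, abs_of_pos (by positivity)]; linarith)
    have h3 := hv.2 h1 h2 ⟨1 / 2, 1 / 2, by norm_num, by norm_num, by norm_num, by module⟩
    have h4 : (r / 2) • w = 0 := by simpa using h3
    exact (smul_eq_zero.1 h4).resolve_left (by positivity)
  have hgrid : ∀ f : P, ∃ m : Fin d → ℕ, ∀ l, m l ≤ 2 ^ b ∧ 2 ^ b * (f : E d) l = m l := by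
    intro f
    choose m hm hfm using hP f.2
    refine ⟨m, fun l => ⟨hm l, ?_⟩⟩
    rw [hfm l]
    field_simp
  choose m hm hfm using hgrid
  set N := (Σ F : Fs, (F : Finset (E d))) ⊕ Fin d
  set R := Fs × Option (Fin d)
  have hmem : ∀ (F : Fs) (f : (F : Finset (E d))), (f : E d) ∈ P := fun F f => (hFs F F.2).1 f.2
  -- The unknowns are the weights of the points of each flat and the scaled vertex `2^b v`. Row `(F,
  -- none)` says that the weights of `F` have sum 1; row `(F, some l)` says that they represent
  -- coordinate `l` of the vertex.
  set B : Matrix R N ℤ := fun r n => match r, n with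
    | (F, none), Sum.inl n => if n.1 = F then 1 else 0
    | (_, none), Sum.inr _ => 0
    | (F, some l), Sum.inl n => if n.1 = F then (m ⟨n.2, hmem n.1 n.2⟩ l : ℤ) else 0
    | (_, some l), Sum.inr l' => if l' = l then -1 else 0 with hB
  have hsum1 : ∀ (F : Fs) (x : N → ℝ), ∑ n, (B (F, none) n : ℝ) * x n =
      ∑ f : (F : Finset (E d)), x (Sum.inl ⟨F, f⟩) := by
    intro F x
    rw [Fintype.sum_sum_type, Fintype.sum_sigma, Finset.sum_eq_single F]
    · simp [hB]
    · intro F' _ hF'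
      simp [hB, hF']
    · simp
  have hsum2 : ∀ (F : Fs) (l : Fin d) (x : N → ℝ), ∑ n, (B (F, some l) n : ℝ) * x n =
      2 ^ b * (∑ f : (F : Finset (E d)), x (Sum.inl ⟨F, f⟩) • (f : E d)) l - x (Sum.inr l) := by
    intro F l x
    rw [Fintype.sum_sum_type, Fintype.sum_sigma, Finset.sum_eq_single F, sub_eq_add_neg]
    · congr 1
      · rw [WithLp.ofLp_sum, Finset.sum_apply, Finset.mul_sum]
        refine Finset.sum_congr rfl fun f _ => ?_
        have := hfm ⟨f, hmem F f⟩ l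
        simp only [hB, if_true, PiLp.smul_apply, smul_eq_mul, Int.cast_natCast]
        rw [← this]
        ring
      · simp [hB]
    · intro F' _ hF'
      simp [hB, hF']
    · simp
  have hker : ∀ x : N → ℝ, (∀ r, ∑ n, (B r n : ℝ) * x n = 0) → x = 0 := by
    intro x hx
    set w : E d := WithLp.toLp 2 fun l => x (Sum.inr l) / 2 ^ b with hwdef
    have h1 : ∀ F : Fs, ∑ f : (F : Finset (E d)), x (Sum.inl ⟨F, f⟩) = 0 := fun F => by
      rw [← hsum1, hx]
    have h2 : ∀ F : Fs, ∑ f : (F : Finset (E d)), x (Sum.inl ⟨F, f⟩) • (f : E d) = w := by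
      intro F
      ext l
      have := hsum2 F l x
      rw [hx] at this
      rw [hwdef]
      change _ = x (Sum.inr l) / 2 ^ b
      rw [eq_div_iff (by positivity)]
      linarith
    have h3 : w = 0 := by
      refine hw0 w fun F hF => ?_
      have hr : (F : Set (E d)) = Set.range ((↑) : F → E d) := by simp
      rw [hr, mem_vectorSpan_iff_eq_weightedVSub]
      refine ⟨Finset.univ, fun f => x (Sum.inl ⟨⟨F, hF⟩, f⟩), h1 ⟨F, hF⟩, ?_⟩
      rw [Finset.weightedVSub_eq_linear_combination _ (h1 ⟨F, hF⟩), h2 ⟨F, hF⟩]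
    funext n
    rcases n with ⟨F, f⟩ | l
    · have hind := (affineIndependent_iff.1 (hFs F F.2).2.2.1) Finset.univ
        (fun f => x (Sum.inl ⟨F, f⟩)) (h1 F) ((h2 F).trans h3)
      exact hind f (Finset.mem_univ _)
    · have h4 := congrArg (fun w : E d => w l) h3
      simp only [hwdef, PiLp.zero_apply] at h4
      exact (div_eq_zero_iff.1 h4).resolve_right (by positivity)
  have hlam : ∀ F : Fs, ∃ lam : {f // f ∈ F.1} → ℝ, ∑ f, lam f = 1 ∧
      ∑ f, lam f • (f : E d) = v := by
    intro F
    have h := (hFs F F.2).2.2.2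
    have hr : (F.1 : Set (E d)) = Set.range ((↑) : {f // f ∈ F.1} → E d) := by simp
    rw [hr] at h
    obtain ⟨lam, h1, h2⟩ := eq_affineCombination_of_mem_affineSpan_of_fintype h
    refine ⟨lam, h1, ?_⟩
    rw [h2, Finset.affineCombination_eq_linear_combination _ _ _ h1]
  choose lam hlam1 hlamv using hlam
  obtain ⟨q, hq0, hq, z, hz⟩ := exists_common_denominator B hker
    (fun r => if r.2 = none then 1 else 0)
    (Sum.elim (fun n => lam n.1 n.2) fun l => 2 ^ b * v l) (by
      rintro ⟨F, _ | l⟩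
      · rw [hsum1]
        simpa using hlam1 F
      · rw [hsum2]
        simp only [Sum.elim_inl, Sum.elim_inr]
        rw [hlamv F]
        simp)
  refine ⟨q, hq0, hq.trans ?_, fun l => z (Sum.inr l), fun l => hz (Sum.inr l)⟩
  -- A weight occurs in the rows of its own flat only: once with entry 1 and `d` times with an
  -- integer coordinate at most `2^b`. There are at most `d · d` such columns.
  have hcol1 : ∀ n : Σ F : Fs, (F : Finset (E d)), ∑ r, |B r (Sum.inl n)| ≤ ((d * 2 ^ b + 1 : ℕ) : ℤ) := by
    intro n
    rw [Fintype.sum_prod_type, Finset.sum_eq_single n.1]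
    · rw [Fintype.sum_option]
      have h5 : ∀ l, |B (n.1, some l) (Sum.inl n)| ≤ 2 ^ b := fun l => by
        simp only [hB, if_true, Nat.abs_cast]
        exact_mod_cast hm ⟨n.2, hmem n.1 n.2⟩ l
      have h6 := Finset.sum_le_card_nsmul (Finset.univ : Finset (Fin d)) _ _ fun l _ => h5 l
      have h7 : |B (n.1, none) (Sum.inl n)| = 1 := by simp [hB]
      rw [h7]
      simp only [Finset.card_univ, Fintype.card_fin, nsmul_eq_mul] at h6
      push_cast
      linarith
    · intro F _ hF
      rw [Fintype.sum_option]
      simp [hB, hF.symm]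
    · simp
  have hcol2 : ∀ l : Fin d, ∑ r, |B r (Sum.inr l)| ≤ (d : ℤ) := by
    intro l
    rw [Fintype.sum_prod_type]
    have h5 : ∀ F : Fs, ∑ o, |B (F, o) (Sum.inr l)| ≤ 1 := fun F => by
      rw [Fintype.sum_option]
      simp only [hB, abs_zero, zero_add]
      rw [Finset.sum_eq_single l] <;> simp +contextual [eq_comm]
    refine (Finset.sum_le_card_nsmul _ _ _ fun F _ => h5 F).trans ?_
    simpa using hcard
  rw [Fintype.prod_sum_type, vertexDenom]
  push_cast
  refine mul_le_mul ?_ ?_ (Finset.prod_nonneg fun _ _ => Finset.sum_nonneg fun _ _ => abs_nonneg _)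
    (by positivity)
  · refine (Finset.prod_le_prod (fun _ _ => Finset.sum_nonneg fun _ _ => abs_nonneg _)
      fun n _ => hcol1 n).trans ?_
    rw [Finset.prod_const]
    push_cast
    refine pow_le_pow_right₀ (le_add_of_nonneg_left (by positivity)) ?_
    rw [Finset.card_univ, Fintype.card_sigma]
    calc ∑ F : Fs, Fintype.card (F : Finset (E d)) ≤ ∑ F : Fs, d :=
          Finset.sum_le_sum fun F _ => by rw [Fintype.card_coe]; exact (hFs F F.2).2.1
      _ ≤ d * d := by
          rw [Finset.sum_const, Finset.card_univ, Fintype.card_coe, smul_eq_mul]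
          exact Nat.mul_le_mul_right d hcard
  · refine (Finset.prod_le_prod (fun _ _ => Finset.sum_nonneg fun _ _ => abs_nonneg _)
      fun n _ => hcol2 n).trans ?_
    rw [Finset.prod_const, Finset.card_univ, Fintype.card_fin]

/-! ### The width of Tukey regions of positive volume -/

theorem mem_Icc_of_mem_gridLine {b : ℕ} {x : ℝ} (hx : x ∈ gridLine b) : x ∈ Set.Icc (0 : ℝ) 1 := by
  obtain ⟨m, hm, rfl⟩ := hx
  refine ⟨by positivity, ?_⟩
  rw [div_le_one (by positivity)]
  exact_mod_cast hm

theorem convexHull_subset_cube {d b : ℕ} {P : Finset (E d)} (hP : (P : Set (E d)) ⊆ gridPoints d b) :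
    convexHull ℝ (P : Set (E d)) ⊆ {x | ∀ l, x l ∈ Set.Icc (0 : ℝ) 1} := by
  refine convexHull_min (fun p hp l => mem_Icc_of_mem_gridLine (hP hp l)) ?_
  intro x hx y hy a c ha hc hac l
  have := convex_Icc (0 : ℝ) 1 (hx l) (hy l) ha hc hac
  simpa using this

theorem abs_sub_le_one_of_mem_tukeyRegion {d b : ℕ} (hd : 0 < d) {P : Finset (E d)}
    (hP : (P : Set (E d)) ⊆ gridPoints d b) {κ : ℝ} (hκ : 0 < κ) {x y : E d}
    (hx : x ∈ tukeyRegion P κ) (hy : y ∈ tukeyRegion P κ) (l : Fin d) : |x l - y l| ≤ 1 := by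
  have h1 := convexHull_subset_cube hP (tukeyRegion_subset_convexHull hd P hκ hx) l
  have h2 := convexHull_subset_cube hP (tukeyRegion_subset_convexHull hd P hκ hy) l
  rw [abs_le]
  constructor <;> linarith [h1.1, h1.2, h2.1, h2.2]

/-- Otherwise all extreme points, and by the Krein–Milman theorem all of `K`, would lie in a proper
affine subspace, which is a null set. -/
theorem exists_linearIndependent_extremePoints {d : ℕ} {K : Set (E d)} (hK : IsCompact K)
    (hconv : Convex ℝ K) (hvol : 0 < volume K) :
    ∃ (v₀ : E d) (v : Fin d → E d), v₀ ∈ K.extremePoints ℝ ∧ (∀ i, v i ∈ K.extremePoints ℝ) ∧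
      LinearIndependent ℝ fun i => v i - v₀ := by
  obtain ⟨v₀, hv₀⟩ := hK.extremePoints_nonempty (nonempty_of_measure_ne_zero hvol.ne')
  have hspan : Submodule.span ℝ ((fun v => v - v₀) '' K.extremePoints ℝ) = ⊤ := by
    by_contra hne
    set L := AffineSubspace.mk' v₀ (Submodule.span ℝ ((fun v => v - v₀) '' K.extremePoints ℝ)) with hL
    have hLtop : L ≠ ⊤ := by
      intro h
      apply hne
      rw [← AffineSubspace.direction_mk' v₀ (Submodule.span ℝ _), ← hL, h,
        AffineSubspace.direction_top]
    have hsub : K ⊆ (L : Set (E d)) := by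
      rw [← closure_convexHull_extremePoints hK hconv]
      refine closure_minimal (convexHull_min (fun v hv => ?_) L.convex)
        L.closed_of_finiteDimensional
      rw [SetLike.mem_coe, hL, AffineSubspace.mem_mk']
      exact Submodule.subset_span ⟨v, hv, rfl⟩
    exact hvol.ne' (measure_mono_null hsub (Measure.addHaar_affineSubspace volume L hLtop))
  obtain ⟨f, hf, hind⟩ := exists_linearIndependent_of_span_eq_top (N := Fin d) hspan
    (by rw [Fintype.card_fin, finrank_euclideanSpace_fin])
  choose v hv hvf using hf
  exact ⟨v₀, v, hv₀, hv, by simpa only [hvf] using hind⟩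

/-- Clearing the denominators row by row turns the determinant into a nonzero integer. -/
theorem one_le_abs_det_mul {d : ℕ} {M : Matrix (Fin d) (Fin d) ℝ} (hM : M.det ≠ 0)
    (c : Fin d → ℝ) (hc : ∀ i, c i ≠ 0) {C : ℝ} (hcC : ∀ i, |c i| ≤ C)
    (hint : ∀ i l, ∃ z : ℤ, c i * M i l = z) : 1 ≤ C ^ d * |M.det| := by
  choose z hz using hint
  have h1 : (∏ i, c i) * M.det = ((Matrix.of z).det : ℤ) := by
    rw [← Matrix.det_mul_column, Int.cast_det]
    congr 1
    ext i l
    simp [hz]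
  have h2 : ((Matrix.of z).det : ℤ) ≠ 0 := by
    intro h0
    rw [h0, Int.cast_zero] at h1
    exact mul_ne_zero (Finset.prod_ne_zero_iff.2 fun i _ => hc i) hM h1
  have h3 : (1 : ℝ) ≤ |((Matrix.of z).det : ℤ)| := by
    exact_mod_cast Int.one_le_abs h2
  rw [Int.cast_abs, ← h1, abs_mul, Finset.abs_prod] at h3
  refine h3.trans (mul_le_mul_of_nonneg_right ?_ (abs_nonneg _))
  refine (Finset.prod_le_prod (fun _ _ => abs_nonneg _) fun i _ => hcC i).trans_eq ?_
  rw [Finset.prod_const, Finset.card_univ, Fintype.card_fin]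

/-- From `det M · u = adj M · (M u)`: if `M u` is small, so is `det M`, because the entries of the
adjugate are at most `d!`. Summing over the coordinates of `u` uses that its `ℓ₁`-norm is at least
1. -/
theorem abs_det_le_of_abs_mulVec_le {d : ℕ} {M : Matrix (Fin d) (Fin d) ℝ}
    (hM : ∀ i l, |M i l| ≤ 1) {u : Fin d → ℝ} (hu : 1 ≤ ∑ i, |u i|) {w : ℝ}
    (hw : ∀ i, |M.mulVec u i| ≤ w) : |M.det| ≤ d ^ 2 * d.factorial * w := by
  have hadj : ∀ i l, |M.adjugate i l| ≤ d.factorial := by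
    intro i l
    rw [Matrix.adjugate_apply]
    have := Matrix.det_le (A := M.updateRow l (Pi.single i 1)) (abv := AbsoluteValue.abs)
      (x := (1 : ℝ)) (fun a c => by
        rw [AbsoluteValue.abs_apply, Matrix.updateRow_apply]
        split_ifs
        · rw [Pi.single_apply]
          split_ifs <;> simp
        · exact hM a c)
    simpa using this
  have h1 : ∀ k, M.det * u k = ∑ l, M.adjugate k l * M.mulVec u l := by
    intro k
    have : (M.adjugate.mulVec (M.mulVec u)) k = (M.det • u) k := by
      rw [Matrix.mulVec_mulVec, Matrix.adjugate_mul, Matrix.smul_mulVec, Matrix.one_mulVec]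
    rw [Pi.smul_apply, smul_eq_mul] at this
    rw [← this]
    rfl
  have h2 : ∀ k, |M.det| * |u k| ≤ d * (d.factorial * w) := by
    intro k
    rw [← abs_mul, h1]
    refine (Finset.abs_sum_le_sum_abs _ _).trans ?_
    refine (Finset.sum_le_card_nsmul _ _ (d.factorial * w) fun l _ => ?_).trans_eq (by simp)
    rw [abs_mul]
    exact mul_le_mul (hadj k l) (hw l) (abs_nonneg _) (Nat.cast_nonneg _)
  calc |M.det| = |M.det| * 1 := (mul_one _).symm
    _ ≤ |M.det| * ∑ k, |u k| := mul_le_mul_of_nonneg_left hu (abs_nonneg _)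
    _ = ∑ k, |M.det| * |u k| := Finset.mul_sum _ _ _
    _ ≤ ∑ k : Fin d, (d : ℝ) * (d.factorial * w) := Finset.sum_le_sum fun k _ => h2 k
    _ = _ := by
      rw [Finset.sum_const, Finset.card_univ, Fintype.card_fin, nsmul_eq_mul]
      ring

theorem one_le_sum_abs {d : ℕ} {u : E d} (hu : ‖u‖ = 1) : 1 ≤ ∑ i, |u i| := by
  have h1 : ∑ i, |u i| ^ 2 = 1 := by
    have := EuclideanSpace.norm_sq_eq u
    rw [hu, one_pow] at this
    simpa using this.symm
  rw [← h1]
  refine Finset.sum_le_sum fun i _ => ?_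
  have h2 : |u i| ≤ 1 := by
    have := PiLp.norm_apply_le u i
    rwa [hu, Real.norm_eq_abs] at this
  nlinarith [abs_nonneg (u i)]

/-- The left side is the reciprocal of the width that the determinant argument yields. Everything is
reduced to powers of 2 by `n + 1 ≤ 2^n`, where `d = n + 1`. -/
theorem vertexDenom_pow_le {d b : ℕ} (hd : 0 < d) (hb : 1 ≤ b) :
    (2 ^ b * vertexDenom d b ^ 2) ^ d * (d ^ 2 * d.factorial) ≤ 2 ^ (5 * d ^ 4 * b) := by
  obtain ⟨n, rfl⟩ : ∃ n, d = n + 1 := ⟨d - 1, by omega⟩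
  have h1 : n + 1 ≤ 2 ^ n := Nat.lt_two_pow_self
  have h2 : (n + 1) * 2 ^ b + 1 ≤ 2 ^ (b + n + 1) := by
    have : 1 ≤ 2 ^ b := Nat.one_le_two_pow
    calc (n + 1) * 2 ^ b + 1 ≤ (n + 1) * 2 ^ b + (n + 1) * 2 ^ b := by nlinarith
      _ = (n + 1) * (2 ^ b * 2) := by ring
      _ ≤ 2 ^ n * (2 ^ b * 2) := Nat.mul_le_mul_right _ h1
      _ = _ := by ring
  have h3 : vertexDenom (n + 1) b ≤ 2 ^ ((b + n + 1) * ((n + 1) * (n + 1)) + n * (n + 1)) := by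
    rw [vertexDenom, pow_add 2, pow_mul 2, pow_mul 2]
    exact Nat.mul_le_mul (Nat.pow_le_pow_left h2 _) (Nat.pow_le_pow_left h1 _)
  have h4 : (n + 1).factorial ≤ 2 ^ (n * (n + 1)) := by
    refine (Nat.factorial_le_pow (n + 1)).trans ?_
    rw [pow_mul]
    exact Nat.pow_le_pow_left h1 _
  have h5 : (n + 1) ^ 2 ≤ 2 ^ (n * 2) := by
    rw [pow_mul]
    exact Nat.pow_le_pow_left h1 _
  calc (2 ^ b * vertexDenom (n + 1) b ^ 2) ^ (n + 1) * ((n + 1) ^ 2 * (n + 1).factorial)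
      ≤ (2 ^ b * (2 ^ ((b + n + 1) * ((n + 1) * (n + 1)) + n * (n + 1))) ^ 2) ^ (n + 1) *
        (2 ^ (n * 2) * 2 ^ (n * (n + 1))) :=
        Nat.mul_le_mul (Nat.pow_le_pow_left (Nat.mul_le_mul_left _ (Nat.pow_le_pow_left h3 _)) _)
          (Nat.mul_le_mul h5 h4)
    _ = 2 ^ ((b + ((b + n + 1) * ((n + 1) * (n + 1)) + n * (n + 1)) * 2) * (n + 1) +
        (n * 2 + n * (n + 1))) := by
        rw [← pow_mul, ← pow_add, ← pow_mul, ← pow_add, ← pow_add]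
    _ ≤ 2 ^ (5 * (n + 1) ^ 4 * b) := by
        refine Nat.pow_le_pow_right (by norm_num) ?_
        obtain ⟨a, rfl⟩ : ∃ a, b = a + 1 := ⟨b - 1, by omega⟩
        ring_nf
        have hn2 : n ≤ n ^ 2 := Nat.le_self_pow (by norm_num) n
        have hn3 : n ^ 2 ≤ n ^ 3 := by
          rcases Nat.eq_zero_or_pos n with rfl | h
          · simp
          · exact Nat.pow_le_pow_right h (by norm_num)
        have ha2 : a * n ≤ a * n ^ 2 := Nat.mul_le_mul_left _ hn2
        nlinarith [Nat.zero_le (a * n), Nat.zero_le (a * n ^ 2), Nat.zero_le (a * n ^ 3),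
          Nat.zero_le (a * n ^ 4), Nat.zero_le (n ^ 4)]

/-- Since `e^4 > 40 > 2^5`, a width of `2^(-5 d⁴ b)` is larger than `e^(-υ)` with `υ = 4 d⁴ b`, even
after the loss of the factor `39/40` in the diameter queries. -/
theorem two_pow_five_mul_lt {n : ℕ} (hn : 0 < n) : (2 : ℝ) ^ (5 * n) < 39 / 40 * Real.exp (4 * n) := by
  have h1 : (2.7182818283 : ℝ) < Real.exp 1 := Real.exp_one_gt_d9
  have h2 : (40 : ℝ) ≤ Real.exp 1 ^ 4 := by
    calc (40 : ℝ) ≤ 2.7182818283 ^ 4 := by norm_num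
      _ ≤ _ := pow_le_pow_left₀ (by norm_num) h1.le 4
  have h3 : Real.exp (4 * n) = (Real.exp 1 ^ 4) ^ n := by
    rw [← pow_mul, ← Real.exp_nat_mul]
    push_cast
    ring_nf
  obtain ⟨m, rfl⟩ : ∃ m, n = m + 1 := ⟨n - 1, by omega⟩
  rw [h3, pow_mul]
  calc ((2 : ℝ) ^ 5) ^ (m + 1) = 32 * 32 ^ m := by norm_num [pow_succ]; ring
    _ < 39 / 40 * (40 * 40 ^ m) := by
      have : (32 : ℝ) ^ m ≤ 40 ^ m := pow_le_pow_left₀ (by norm_num) (by norm_num) m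
      have h4 : (0 : ℝ) < 40 ^ m := by positivity
      nlinarith
    _ = 39 / 40 * 40 ^ (m + 1) := by ring
    _ ≤ _ := by gcongr

/-- A Tukey region of positive volume is not too narrow in any direction. -/
theorem exists_le_abs_inner_sub {d b : ℕ} (hd : 0 < d) (hb : 1 ≤ b) {P : Finset (E d)}
    (hP : (P : Set (E d)) ⊆ gridPoints d b) {κ : ℝ} (hκ : 0 < κ)
    (hvol : 0 < volume (tukeyRegion P κ)) {u : E d} (hu : ‖u‖ = 1) :
    ∃ x ∈ tukeyRegion P κ, ∃ y ∈ tukeyRegion P κ,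
      Real.exp (-(refinedBits d b : ℝ)) ≤ 39 / 40 * |inner ℝ (x - y) u| := by
  obtain ⟨v₀, v, hv₀, hv, hind⟩ := exists_linearIndependent_extremePoints
    (isCompact_tukeyRegion hd P hκ) (convex_tukeyRegion hd P κ) hvol
  have hext : ∀ {x}, x ∈ (tukeyRegion P κ).extremePoints ℝ →
      x ∈ (tukeyRegion P (⌈κ⌉₊ : ℕ)).extremePoints ℝ := fun {x} hx => by
    rwa [← tukeyRegion_eq_ceil]
  set M : Matrix (Fin d) (Fin d) ℝ := Matrix.of fun i l => (v i - v₀) l with hM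
  have hdet : M.det ≠ 0 := by
    have h1 : LinearIndependent ℝ M.row :=
      hind.map' (WithLp.linearEquiv 2 ℝ (Fin d → ℝ)).toLinearMap (LinearEquiv.ker _)
    rw [Matrix.linearIndependent_rows_iff_isUnit, Matrix.isUnit_iff_isUnit_det] at h1
    exact h1.ne_zero
  obtain ⟨q₀, hq₀, hq₀le, z₀, hz₀⟩ := exists_vertex_denominator hd hP (hext hv₀)
  choose q hq hqle z hz using fun i => exists_vertex_denominator hd hP (hext (hv i))
  -- Row `i` is a difference of two vertices, so `2^b` times the product of their denominators
  -- clears it.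
  have hdetle := one_le_abs_det_mul hdet (fun i => 2 ^ b * ((q i : ℝ) * q₀))
    (fun i => by
      have := hq i
      positivity)
    (C := 2 ^ b * (vertexDenom d b : ℝ) ^ 2)
    (fun i => by
      rw [abs_mul, abs_of_pos (by positivity : (0 : ℝ) < 2 ^ b), abs_mul, sq]
      have h1 : |(q i : ℝ)| ≤ vertexDenom d b := by exact_mod_cast hqle i
      have h2 : |(q₀ : ℝ)| ≤ vertexDenom d b := by exact_mod_cast hq₀le
      gcongr)
    (fun i l => ⟨q₀ * z i l - q i * z₀ l, by
      have h1 := hz i l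
      have h2 := hz₀ l
      push_cast
      rw [← h1, ← h2, hM, Matrix.of_apply, PiLp.sub_apply]
      ring⟩)
  by_contra hcon
  push Not at hcon
  set w := Real.exp (-(refinedBits d b : ℝ)) * (40 / 39) with hw
  have hmul : ∀ i, M.mulVec (fun l => u l) i = inner ℝ (v i - v₀) u := by
    intro i
    rw [PiLp.inner_apply, Matrix.mulVec, dotProduct]
    refine Finset.sum_congr rfl fun l _ => ?_
    simp [hM, mul_comm]
  have hlt := fun i => hcon (v i) (hv i).1 v₀ hv₀.1
  have h1 := abs_det_le_of_abs_mulVec_le (M := M) (u := fun l => u l) (w := w)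
    (fun i l => abs_sub_le_one_of_mem_tukeyRegion hd hP hκ (hv i).1 hv₀.1 l)
    (one_le_sum_abs hu) (fun i => by
      rw [hmul, hw]
      linarith [hlt i])
  have h2 : ((2 : ℝ) ^ b * (vertexDenom d b : ℝ) ^ 2) ^ d * (d ^ 2 * d.factorial) ≤
      2 ^ (5 * (d ^ 4 * b)) := by
    have := vertexDenom_pow_le hd hb
    rw [mul_assoc 5] at this
    exact_mod_cast this
  have h3 := two_pow_five_mul_lt (n := d ^ 4 * b) (by positivity)
  have h4 : (refinedBits d b : ℝ) = 4 * ((d ^ 4 * b : ℕ) : ℝ) := by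
    rw [refinedBits]
    push_cast
    ring
  have h5 : ((2 : ℝ) ^ b * (vertexDenom d b : ℝ) ^ 2) ^ d * |M.det| ≤
      2 ^ (5 * (d ^ 4 * b)) * w := by
    calc _ ≤ ((2 : ℝ) ^ b * (vertexDenom d b : ℝ) ^ 2) ^ d * (d ^ 2 * d.factorial * w) :=
          mul_le_mul_of_nonneg_left h1 (by positivity)
      _ = ((2 : ℝ) ^ b * (vertexDenom d b : ℝ) ^ 2) ^ d * (d ^ 2 * d.factorial) * w := by ring
      _ ≤ _ := mul_le_mul_of_nonneg_right h2 (by positivity)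
  have h6 : 2 ^ (5 * (d ^ 4 * b)) * w < 1 := by
    calc _ < 39 / 40 * Real.exp (4 * ((d ^ 4 * b : ℕ) : ℝ)) * w :=
          mul_lt_mul_of_pos_right h3 (by positivity)
      _ = 1 := by
        rw [hw, h4, Real.exp_neg]
        field_simp
  linarith

/-! ### Volumes of boxes and of convex bodies -/

/-- The first coordinate and the remaining coordinates. -/
def splitFirst (n : ℕ) : E (n + 1) ≃ᵐ ℝ × E n :=
  (MeasurableEquiv.toLp 2 (Fin (n + 1) → ℝ)).symm.trans
    ((MeasurableEquiv.piFinSuccAbove (fun _ => ℝ) 0).trans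
      (MeasurableEquiv.prodCongr (MeasurableEquiv.refl ℝ) (MeasurableEquiv.toLp 2 (Fin n → ℝ))))

theorem splitFirst_apply {n : ℕ} (x : E (n + 1)) : splitFirst n x = (x 0, dropFirst n x) := rfl

theorem dropFirst_e₀ (n : ℕ) : dropFirst n (e₀ n) = 0 := by
  ext i
  change e₀ n i.succ = 0
  simp [e₀]

theorem measurePreserving_splitFirst (n : ℕ) :
    MeasurePreserving (splitFirst n) volume (volume.prod volume) :=
  (((MeasurePreserving.id volume).prod (PiLp.volume_preserving_toLp (Fin n))).comp
    (volume_preserving_piFinSuccAbove (fun _ : Fin (n + 1) => ℝ) 0)).comp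
    (PiLp.volume_preserving_ofLp (Fin (n + 1)))

theorem Directions.R_apply_zero (D : Directions) {n : ℕ} {u : E (n + 1)} (hu : ‖u‖ = 1)
    (x : E (n + 1)) : D.R n u x 0 = inner ℝ x u := by
  rw [← (D.R n u).inner_map_map x u, D.R_apply n u hu, e₀]
  simp [EuclideanSpace.inner_single_right]

theorem volume_box (D : Directions) {n : ℕ} {u : E (n + 1)} (hu : ‖u‖ = 1) (a c : ℝ)
    (B : Set (E n)) :
    volume {x : E (n + 1) | inner ℝ x u ∈ Set.Icc a c ∧ dropFirst n (D.R n u x) ∈ B} =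
      ENNReal.ofReal (c - a) * volume B := by
  have h1 : {x : E (n + 1) | inner ℝ x u ∈ Set.Icc a c ∧ dropFirst n (D.R n u x) ∈ B} =
      (D.R n u).toMeasurableEquiv ⁻¹' (splitFirst n ⁻¹' (Set.Icc a c ×ˢ B)) := by
    ext x
    rw [Set.mem_ofPred_eq, ← D.R_apply_zero hu]
    rfl
  rw [h1, MeasurePreserving.measure_preimage_equiv (D.R n u).measurePreserving,
    (measurePreserving_splitFirst n).measure_preimage_equiv, Measure.prod_prod, Real.volume_Icc]

theorem lintegral_one_sub_div_pow {L : ℝ} (hL : 0 < L) (n : ℕ) :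
    ∫⁻ t in Set.Ioc 0 L, ENNReal.ofReal ((1 - t / L) ^ n) = ENNReal.ofReal (L / (n + 1)) := by
  have hcont : Continuous fun t : ℝ => (1 - t / L) ^ n := by fun_prop
  have h1 : ∫ t in (0 : ℝ)..L, (1 - t / L) ^ n = L / (n + 1) := by
    have hd : ∀ t ∈ Set.uIcc 0 L, HasDerivAt (fun t : ℝ => -(L / (n + 1)) * (1 - t / L) ^ (n + 1))
        ((1 - t / L) ^ n) t := by
      intro t _
      have h2 : HasDerivAt (fun t : ℝ => 1 - t / L) (-(1 / L)) t :=
        ((hasDerivAt_id t).div_const L).const_sub 1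
      refine ((h2.pow (n + 1)).const_mul (-(L / (n + 1)))).congr_deriv ?_
      have : (n : ℝ) + 1 ≠ 0 := by positivity
      rw [Nat.add_sub_cancel]
      push_cast
      generalize (1 - t / L) ^ n = z
      field_simp
    rw [intervalIntegral.integral_eq_sub_of_hasDerivAt hd (hcont.intervalIntegrable _ _)]
    rw [div_self hL.ne']
    simp
  rw [← h1, intervalIntegral.integral_of_le hL.le,
    ofReal_integral_eq_lintegral_ofReal (hcont.integrableOn_Ioc)]
  refine (ae_restrict_iff' measurableSet_Ioc).2 (Filter.Eventually.of_forall fun t ht => ?_)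
  have : t / L ≤ 1 := (div_le_one hL).2 ht.2
  exact pow_nonneg (by linarith) n

/-- A convex body is at least as large as a cone over its projection along one of its
segments. -/
theorem volume_image_dropFirst_le {n : ℕ} {K : Set (E (n + 1))} (hK : IsCompact K)
    (hconv : Convex ℝ K) {s t : E (n + 1)} (hs : s ∈ K) (ht : t ∈ K)
    (hst : dropFirst n s = dropFirst n t) :
    ENNReal.ofReal (t 0 - s 0) * volume (dropFirst n '' K) ≤ (n + 1) * volume K := by
  rcases le_or_gt (t 0 - s 0) 0 with hL | hL
  · rw [ENNReal.ofReal_of_nonpos hL, zero_mul]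
    exact zero_le
  set L := t 0 - s 0 with hLdef
  set K' : Set (ℝ × E n) := (splitFirst n).symm ⁻¹' K with hK'
  have hK'm : MeasurableSet K' := (splitFirst n).symm.measurable hK.measurableSet
  have hmem : ∀ {x : E (n + 1)} {h : ℝ} {y : E n}, x ∈ K → x 0 = h → dropFirst n x = y →
      (h, y) ∈ K' := by
    rintro x h y hx rfl rfl
    rw [hK', Set.mem_preimage, ← splitFirst_apply, MeasurableEquiv.symm_apply_apply]
    exact hx
  have hvol : volume K = ∫⁻ y : E n, volume ((fun h : ℝ => (h, y)) ⁻¹' K') := by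
    rw [← Measure.prod_apply_symm hK'm, hK',
      ← (measurePreserving_splitFirst n).measure_preimage_equiv, ← Set.preimage_comp]
    simp
  obtain ⟨C, hC⟩ : ∃ C : ℝ, ∀ x ∈ K, |x 0| ≤ C := by
    obtain ⟨C, hC⟩ := hK.isBounded.exists_norm_le
    exact ⟨C, fun x hx => (PiLp.norm_apply_le x 0).trans (hC x hx)⟩
  have hfin : ∀ y : E n, volume ((fun h : ℝ => (h, y)) ⁻¹' K') ≠ ⊤ := by
    intro y
    refine ((measure_mono (t := Set.Icc (-C) C) ?_).trans_lt measure_Icc_lt_top).ne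
    intro h hh
    have h1 := hC _ hh
    have h2 : ((splitFirst n).symm (h, y)) 0 = h := by
      have := splitFirst_apply ((splitFirst n).symm (h, y))
      rw [MeasurableEquiv.apply_symm_apply] at this
      exact (congrArg Prod.fst this).symm
    rw [h2] at h1
    exact abs_le.1 h1
  set F : E n → ℝ := fun y => (volume ((fun h : ℝ => (h, y)) ⁻¹' K')).toReal with hF
  have hFm : Measurable F := (measurable_measure_prodMk_right hK'm).ennreal_toReal
  -- Layer-cake formula for the fibre length `F y`, the length of the part of `K` above `y`.
  have hvol' : volume K = ∫⁻ r in Set.Ioi 0, volume {y | r ≤ F y} := by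
    rw [hvol, ← lintegral_eq_lintegral_meas_le volume
      (Filter.Eventually.of_forall fun y => ENNReal.toReal_nonneg) hFm.aemeasurable]
    exact lintegral_congr fun y => (ENNReal.ofReal_toReal (hfin y)).symm
  set Z := dropFirst n '' K with hZ
  set y₀ := dropFirst n s with hy₀
  -- Over the projection shrunk by `1 - r/L` towards the foot `y₀` of the chord, the fibres have
  -- length at least `r`: combining `x` with weight `1 - r/L` and a point of the chord with weight
  -- `r/L`, and letting the latter run from `s` to `t`, sweeps a vertical segment of length `r`.
  -- Integrating the volumes of these copies gives `L/(n + 1)` times the volume of the projection.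
  have hsub : ∀ r ∈ Set.Ioc 0 L,
      AffineMap.homothety y₀ (1 - r / L) '' Z ⊆ {y | r ≤ F y} := by
    rintro r hr _ ⟨_, ⟨x, hx, rfl⟩, rfl⟩
    have hr0 : 0 ≤ r / L := div_nonneg hr.1.le hL.le
    have hr1 : 0 ≤ 1 - r / L := sub_nonneg.2 ((div_le_one hL).2 hr.2)
    rw [Set.mem_ofPred_eq, hF]
    rw [← ENNReal.ofReal_le_iff_le_toReal (hfin _)]
    have hIcc : Set.Icc ((1 - r / L) * x 0 + r / L * s 0) ((1 - r / L) * x 0 + r / L * t 0) ⊆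
        (fun h : ℝ => (h, AffineMap.homothety y₀ (1 - r / L) (dropFirst n x))) ⁻¹' K' := by
      intro h hh
      set a := (h - ((1 - r / L) * x 0 + r / L * s 0)) / r with ha
      have ha0 : 0 ≤ a := div_nonneg (by linarith [hh.1]) hr.1.le
      have hLr : r / L * t 0 - r / L * s 0 = r := by
        rw [← mul_sub, ← hLdef]; field_simp
      have ha1 : a ≤ 1 := by
        rw [ha, div_le_one hr.1]
        linarith [hh.2]
      have hz : (1 - a) • s + a • t ∈ K := hconv hs ht (by linarith) ha0 (by ring)
      refine hmem (x := (1 - r / L) • x + (r / L) • ((1 - a) • s + a • t))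
        (hconv hx hz hr1 hr0 (by ring)) ?_ ?_
      · simp only [PiLp.add_apply, PiLp.smul_apply, smul_eq_mul]
        have h3 : (1 - a) * s 0 + a * t 0 = s 0 + a * L := by rw [hLdef]; ring
        have h4 : r / L * (a * L) = a * r := by field_simp
        have h5 : a * r = h - ((1 - r / L) * x 0 + r / L * s 0) := div_mul_cancel₀ _ hr.1.ne'
        rw [h3, mul_add, h4, h5]
        ring
      · rw [map_add, map_smul, map_smul, map_add, map_smul, map_smul, ← hst, ← hy₀,
          AffineMap.homothety_apply]
        simp only [vsub_eq_sub, vadd_eq_add]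
        module
    refine le_trans (le_of_eq ?_) (measure_mono hIcc)
    rw [Real.volume_Icc]
    congr 1
    have : r = r / L * L := by field_simp
    rw [hLdef] at this ⊢
    linarith
  have hle : ∫⁻ r in Set.Ioc 0 L, ENNReal.ofReal ((1 - r / L) ^ n) * volume Z ≤ volume K := by
    rw [hvol']
    refine le_trans ?_ (lintegral_mono_set (s := Set.Ioc 0 L) Set.Ioc_subset_Ioi_self)
    refine setLIntegral_mono' measurableSet_Ioc fun r hr => ?_
    refine le_trans (le_of_eq ?_) (measure_mono (hsub r hr))
    rw [Measure.addHaar_image_homothety, finrank_euclideanSpace_fin, abs_of_nonneg]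
    exact pow_nonneg (sub_nonneg.2 ((div_le_one hL).2 hr.2)) n
  rw [lintegral_mul_const _ (by fun_prop), lintegral_one_sub_div_pow hL] at hle
  calc ENNReal.ofReal L * volume Z
      = (n + 1) * (ENNReal.ofReal (L / (n + 1)) * volume Z) := by
        rw [← mul_assoc]
        congr 1
        have : ((n : ENNReal) + 1) = ENNReal.ofReal (n + 1) := by
          rw [ENNReal.ofReal_add (Nat.cast_nonneg n) zero_le_one, ENNReal.ofReal_natCast,
            ENNReal.ofReal_one]
        rw [this, ← ENNReal.ofReal_mul (by positivity)]
        congr 1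
        field_simp
    _ ≤ _ := mul_le_mul_right hle _

theorem volume_image_rotate_dropFirst_le (D : Directions) {n : ℕ} {K : Set (E (n + 1))}
    (hK : IsCompact K) (hconv : Convex ℝ K) {s t u : E (n + 1)} (hs : s ∈ K) (ht : t ∈ K)
    (hu : ‖u‖ = 1) {L : ℝ} (hst : t - s = L • u) :
    ENNReal.ofReal L * volume ((fun x => dropFirst n (D.R n u x)) '' K) ≤ (n + 1) * volume K := by
  have hRs : D.R n u t - D.R n u s = L • e₀ n := by
    rw [← map_sub, hst, map_smul, D.R_apply n u hu]
  have h := volume_image_dropFirst_le (hK.image (D.R n u).continuous)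
    (hconv.linear_image (D.R n u).toLinearEquiv.toLinearMap) (Set.mem_image_of_mem _ hs)
    (Set.mem_image_of_mem _ ht) (by
      rw [eq_comm, ← sub_eq_zero, ← map_sub]
      change dropFirst n (D.R n u t - D.R n u s) = 0
      rw [hRs, map_smul, dropFirst_e₀, smul_zero])
  have h0 : D.R n u t 0 - D.R n u s 0 = L := by
    have := congrArg (fun x : E (n + 1) => x 0) hRs
    simpa [e₀] using this
  have hv : volume (D.R n u '' K) = volume K := by
    have : D.R n u '' K = (D.R n u).symm.toMeasurableEquiv ⁻¹' K := by
      ext x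
      exact ⟨by rintro ⟨y, hy, rfl⟩; simpa using hy, fun hx => ⟨_, hx, by simp⟩⟩
    rw [this, MeasurePreserving.measure_preimage_equiv (D.R n u).symm.measurePreserving]
  rw [← Set.image_comp] at h
  rw [← h0, ← hv]
  exact h

/-! ### Compositions of projections and rotations -/

/-- `A` is the adjoint of an isometric embedding. -/
def IsCoisometry {d j : ℕ} (A : E d →ₗ[ℝ] E j) : Prop :=
  ∃ B : E j →ₗᵢ[ℝ] E d, ∀ x w, inner ℝ (A x) w = inner ℝ x (B w)

theorem isCoisometry_id (d : ℕ) : IsCoisometry (LinearMap.id : E d →ₗ[ℝ] E d) :=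
  ⟨LinearIsometry.id, fun _ _ => rfl⟩

theorem IsCoisometry.rotate (D : Directions) {d n : ℕ} {A : E d →ₗ[ℝ] E (n + 1)}
    (hA : IsCoisometry A) (v : E (n + 1)) : IsCoisometry (D.rotate v A) := by
  obtain ⟨B, hB⟩ := hA
  refine ⟨B.comp (D.R n v).symm.toLinearIsometry, fun x w => ?_⟩
  change inner ℝ (D.R n v (A x)) w = inner ℝ x (B ((D.R n v).symm w))
  rw [← hB, ← (D.R n v).inner_map_map (A x), LinearIsometryEquiv.apply_symm_apply]

theorem inner_succ {n : ℕ} (x y : E (n + 1)) :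
    inner ℝ x y = x 0 * y 0 + inner ℝ (dropFirst n x) (dropFirst n y) := by
  rw [PiLp.inner_apply, PiLp.inner_apply, Fin.sum_univ_succ]
  simp only [RCLike.inner_apply, conj_trivial]
  rw [mul_comm]
  rfl

/-- The vector with first coordinate `c` and remaining coordinates `y`. -/
def consCoord {n : ℕ} (c : ℝ) (y : E n) : E (n + 1) := WithLp.toLp 2 (Fin.cons c fun i => y i)

theorem consCoord_zero {n : ℕ} (c : ℝ) (y : E n) : consCoord c y 0 = c := rfl

theorem dropFirst_consCoord {n : ℕ} (c : ℝ) (y : E n) : dropFirst n (consCoord c y) = y := rfl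

theorem ext_dropFirst {n : ℕ} {x y : E (n + 1)} (h0 : x 0 = y 0)
    (h : dropFirst n x = dropFirst n y) : x = y := by
  ext i
  refine Fin.cases h0 (fun i => ?_) i
  exact congrArg (fun z : E n => z i) h

/-- Adding a zero in front of the coordinates. -/
def addZero (n : ℕ) : E n →ₗᵢ[ℝ] E (n + 1) where
  toFun y := consCoord 0 y
  map_add' y y' := ext_dropFirst (by simp [consCoord_zero]) (by
    rw [map_add, dropFirst_consCoord, dropFirst_consCoord, dropFirst_consCoord])
  map_smul' c y := ext_dropFirst (by simp [consCoord_zero]) (by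
    rw [map_smul, dropFirst_consCoord, dropFirst_consCoord]; rfl)
  norm_map' y := by
    change ‖consCoord 0 y‖ = ‖y‖
    rw [← sq_eq_sq₀ (norm_nonneg _) (norm_nonneg _), ← real_inner_self_eq_norm_sq,
      ← real_inner_self_eq_norm_sq, inner_succ, dropFirst_consCoord, consCoord_zero]
    ring

theorem IsCoisometry.dropFirst {d n : ℕ} {A : E d →ₗ[ℝ] E (n + 1)} (hA : IsCoisometry A) :
    IsCoisometry (dropFirst n ∘ₗ A) := by
  obtain ⟨B, hB⟩ := hA
  refine ⟨B.comp (addZero n), fun x w => ?_⟩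
  change _ = inner ℝ x (B (consCoord 0 w))
  rw [← hB, inner_succ]
  rw [consCoord_zero, dropFirst_consCoord, mul_zero, zero_add]
  rfl

theorem IsCoisometry.norm_map_le {d j : ℕ} {A : E d →ₗ[ℝ] E j} (hA : IsCoisometry A) (x : E d) :
    ‖A x‖ ≤ ‖x‖ := by
  obtain ⟨B, hB⟩ := hA
  have h1 := hB x (A x)
  rw [real_inner_self_eq_norm_sq] at h1
  have h2 := real_inner_le_norm x (B (A x))
  rw [B.norm_map, ← h1] at h2
  rcases (norm_nonneg (A x)).eq_or_lt with h0 | h0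
  · rw [← h0]
    exact norm_nonneg x
  · nlinarith

/-! ### Utility of the choice of the coordinates -/

theorem isCompact_slice {d j : ℕ} (hd : 0 < d) (P : Finset (E d)) (A : E d →ₗ[ℝ] E j) (i : Fin j)
    (y : Fin j → ℝ) {k : ℕ} (hk : 0 < k) : IsCompact (slice P A i y k) := by
  have hA : Continuous A := A.continuous_of_finiteDimensional
  have hcoord : ∀ m : Fin j, Continuous fun p => A p m := fun m => by fun_prop
  have hset : slice P A i y k =
      (fun p => A p i) '' (tukeyRegion P k ∩ ⋂ m, ⋂ (_ : m < i), {p | A p m = y m}) := by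
    ext x
    simp only [slice, Set.mem_image, Set.mem_inter_iff, Set.mem_iInter, Set.mem_ofPred_eq, and_assoc]
  rw [hset]
  refine ((isCompact_tukeyRegion hd P (Nat.cast_pos.2 hk)).inter_right ?_).image (hcoord i)
  exact isClosed_iInter fun m => isClosed_iInter fun _ => isClosed_eq (hcoord m) continuous_const

/-- On a one-point grid with constant score a negative `α` makes the success event empty, although
its probability is positive. -/
theorem QCAccurate.nonneg {M : QCAlgorithm} {υ : ℕ} {β α : ℝ} (hβ : β < 1)
    (hM : QCAccurate M υ β α) : 0 ≤ α := by
  by_contra hα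
  have h := hM {0} (fun _ => 0) (Finset.singleton_nonempty 0) (by simpa using Nat.one_le_two_pow)
    (fun r => by
      by_cases hr : r ≤ 0
      · simpa [hr] using convex_univ
      · simpa [hr] using convex_empty)
  have hset : {x : ℝ | x ∈ ({0} : Finset ℝ) ∧ ∀ y ∈ ({0} : Finset ℝ), (0 : ℝ) - α ≤ 0} = ∅ := by
    ext x
    simp only [Finset.mem_singleton, forall_eq, Set.mem_ofPred_eq, Set.mem_empty_iff_false, iff_false,
      not_and]
    intro _
    linarith
  rw [hset, prob, measure_empty] at h
  have := ENNReal.ofReal_eq_zero.1 (le_antisymm h zero_le)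
  linarith

/-- The right end point of the interval `tdc ≥ k` is a refined grid point by construction, so
restricting the maximization to the grid loses nothing. -/
theorem exists_mem_refinedGrid {d j b : ℕ} (hd : 0 < d) {P : Finset (E d)}
    (hP : (P : Set (E d)) ⊆ gridPoints d b) {A : E d →ₗ[ℝ] E j} {i : Fin j} {y : Fin j → ℝ} {k : ℕ}
    (hk : 0 < k) (hne : (slice P A i y k).Nonempty) :
    ∃ x ∈ refinedGrid b A i y, k ≤ tdc P A i y x := by
  obtain ⟨x, hx⟩ := (isCompact_slice hd P A i y hk).exists_isGreatest hne
  refine ⟨x, ?_, le_tdc_of_mem_slice hx.1⟩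
  rw [refinedGrid, Set.Finite.mem_toFinset]
  exact Or.inr ⟨P, hP, k, hk, Or.inr hx⟩

theorem refinedGrid_nonempty {d j : ℕ} (b : ℕ) (A : E d →ₗ[ℝ] E j) (i : Fin j) (y : Fin j → ℝ) :
    (refinedGrid b A i y).Nonempty := by
  refine ⟨0, ?_⟩
  rw [refinedGrid, Set.Finite.mem_toFinset]
  exact Or.inl ⟨0, Nat.zero_le _, by simp⟩

/-- Invariant: some point of depth `θ` agrees with `y` on all coordinates that are already fixed. By
`hup` these precede the listed ones, so they form exactly the prefix that `tdc` sees. Each call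
lowers `θ` by `α`, and positivity of the depth turns the value of `tdc` back into a point. -/
theorem fillCoords_accurate {d j b : ℕ} (hd : 0 < d) (hb : 1 ≤ b) {M : QCAlgorithm} {β α : ℝ}
    (hβ : 0 ≤ β) (hα : 0 ≤ α) (hM : QCAccurate M (refinedBits d b) β α) {P : Finset (E d)}
    (hP : (P : Set (E d)) ⊆ gridPoints d b) (A : E d →ₗ[ℝ] E j) (is : List (Fin j))
    (hsort : is.Pairwise (· < ·)) (hup : ∀ m, m ∉ is → ∀ i ∈ is, m < i) (y : Fin j → ℝ) {θ : ℝ}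
    (hθ : 0 < θ - is.length * α) (hy : ∃ p ∈ tukeyRegion P θ, ∀ m, m ∉ is → A p m = y m) :
    Fails (is.length * β) (fillCoords M b P A is y)
      {y' | (∃ p ∈ tukeyRegion P (θ - is.length * α), A p = WithLp.toLp 2 y') ∧
        ∀ m, m ∉ is → y' m = y m} := by
  induction is generalizing y θ with
  | nil =>
    obtain ⟨p, hp, hpy⟩ := hy
    refine fails_pure ⟨⟨p, by simpa using hp, ?_⟩, fun _ _ => rfl⟩
    ext m
    exact hpy m (by simp)
  | cons i is ih =>
    rw [List.pairwise_cons] at hsort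
    rw [List.length_cons] at hθ ⊢
    push_cast at hθ ⊢
    have hlen : 0 ≤ (is.length : ℝ) * α := by positivity
    have hθ0 : 0 < θ := by nlinarith
    have hk : 0 < ⌈θ⌉₊ := Nat.ceil_pos.2 hθ0
    obtain ⟨p, hp, hpy⟩ := hy
    have hlt : ∀ m, m < i → m ∉ i :: is := by
      intro m hm hmem
      rcases List.mem_cons.1 hmem with rfl | h
      · exact lt_irrefl _ hm
      · exact lt_asymm hm (hsort.1 m h)
    have hne : (slice P A i y ⌈θ⌉₊).Nonempty :=
      ⟨A p i, p, by rwa [← tukeyRegion_eq_ceil], fun m hm => hpy m (hlt m hm), rfl⟩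
    obtain ⟨g, hg, hgk⟩ := exists_mem_refinedGrid hd hP hk hne
    have h1 := (fails_iff hβ _ _).2 (hM _ _ (refinedGrid_nonempty b A i y)
      (card_refinedGrid_le hd hb A i y) (quasiconcaveOn_tdc hd P A i y))
    rw [add_mul, one_mul, add_comm, fillCoords]
    refine Fails.bind hβ (by positivity) h1 fun x hx => ?_
    have hx1 : θ - α ≤ tdc P A i y x := by
      have h2 := hx.2 g hg
      have h3 : θ ≤ tdc P A i y g := (Nat.le_ceil θ).trans (Nat.cast_le.2 hgk)
      linarith
    have hpos : 0 < θ - α := by nlinarith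
    obtain ⟨p', hp', hpy', hpx'⟩ : x ∈ slice P A i y (tdc P A i y x) :=
      mem_slice_of_le_tdc (by exact_mod_cast hpos.trans_le hx1) le_rfl
    have h4 := ih hsort.2 (fun m hm a ha => by
        rcases eq_or_ne m i with rfl | hmi
        · exact hsort.1 a ha
        · exact hup m (by simp [hmi, hm]) a (List.mem_cons_of_mem _ ha))
      (Function.update y i x) (θ := θ - α) (by linarith)
      ⟨p', tukeyRegion_antitone P hx1 hp', fun m hm => by
        rcases eq_or_ne m i with rfl | hmi
        · rw [hpx', Function.update_self]
        · rw [Function.update_of_ne hmi]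
          exact hpy' m (hup m (by simp [hmi, hm]) i List.mem_cons_self)⟩
    refine h4.mono ?_
    rintro y' ⟨⟨p'', hp'', hpy''⟩, hy'⟩
    refine ⟨⟨p'', ?_, hpy''⟩, fun m hm => ?_⟩
    · have : θ - α - is.length * α = θ - (is.length + 1) * α := by ring
      rwa [← this]
    · rw [List.mem_cons, not_or] at hm
      rw [hy' m hm.2, Function.update_of_ne hm.1]

/-! ### Directional depth -/

theorem Directions.rotate_apply_zero (D : Directions) {d n : ℕ} {v : E (n + 1)} (hv : ‖v‖ = 1)
    (A : E d →ₗ[ℝ] E (n + 1)) (p : E d) : D.rotate v A p 0 = inner ℝ (A p) v :=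
  D.R_apply_zero hv (A p)

theorem le_tdcDir {D : Directions} {d n : ℕ} {P : Finset (E d)} {A : E d →ₗ[ℝ] E (n + 1)}
    {v a : E (n + 1)} (hv : ‖v‖ = 1) {θ : ℝ} (ha : a ∈ A '' tukeyRegion P θ) :
    ⌈θ⌉₊ ≤ tdcDir D P A v (inner ℝ a v) := by
  obtain ⟨p, hp, rfl⟩ := ha
  refine le_tdc_of_mem_slice ⟨p, by rwa [← tukeyRegion_eq_ceil], fun m hm => ?_,
    D.rotate_apply_zero hv A p⟩
  exact absurd hm (Fin.not_lt_zero m)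

theorem exists_of_le_tdcDir {D : Directions} {d n : ℕ} {P : Finset (E d)}
    {A : E d →ₗ[ℝ] E (n + 1)} {v : E (n + 1)} (hv : ‖v‖ = 1) {θ x : ℝ} (hθ : 0 < θ)
    (h : θ ≤ tdcDir D P A v x) : ∃ p ∈ tukeyRegion P θ, D.rotate v A p 0 = x ∧
      inner ℝ (A p) v = x := by
  obtain ⟨p, hp, -, hpx⟩ := mem_slice_of_le_tdc (Nat.ceil_pos.2 hθ) (Nat.ceil_le.2 h)
  exact ⟨p, by rwa [tukeyRegion_eq_ceil], hpx, by rwa [← D.rotate_apply_zero hv]⟩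

theorem convex_image_tukeyRegion {d j : ℕ} (hd : 0 < d) (P : Finset (E d)) (κ : ℝ)
    (A : E d →ₗ[ℝ] E j) : Convex ℝ (A '' tukeyRegion P κ) :=
  (convex_tukeyRegion hd P κ).linear_image A

/-- A convex set that contains `b` and a point whose coordinate along `v` exceeds that of `b` by at
least `ℓ` contains a point whose coordinate exceeds that of `b` by exactly `ℓ`. -/
theorem exists_inner_eq_add {j : ℕ} {K : Set (E j)} (hK : Convex ℝ K) {a b v : E j}
    (ha : a ∈ K) (hb : b ∈ K) {ℓ : ℝ} (hℓ : 0 ≤ ℓ) (h : ℓ ≤ inner ℝ (a - b) v) :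
    ∃ c ∈ K, inner ℝ c v = inner ℝ b v + ℓ := by
  rcases hℓ.eq_or_lt with rfl | hpos
  · exact ⟨b, hb, by simp⟩
  · have hI := hpos.trans_le h
    set r := ℓ / inner ℝ (a - b) v with hr
    have hr0 : 0 ≤ r := by positivity
    have hr1 : r ≤ 1 := (div_le_one hI).2 h
    refine ⟨b + r • (a - b), hK.add_smul_sub_mem hb ha ⟨hr0, hr1⟩, ?_⟩
    rw [inner_add_left, real_inner_smul_left, hr, div_mul_cancel₀ _ hI.ne']

theorem IsAngleCover.exists_inner_ge {j : ℕ} {ζ : ℝ} {V : Set (E j)} (hV : IsAngleCover ζ V)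
    (hζ : ζ ≤ Real.pi) {a : E j} (ha : a ≠ 0) :
    ∃ v ∈ V, Real.cos ζ * ‖a‖ ≤ inner ℝ a v := by
  have hn : ‖a‖ ≠ 0 := norm_ne_zero_iff.2 ha
  obtain ⟨v, hv, hangle⟩ := hV.2 (‖a‖⁻¹ • a) (by
    rw [norm_smul, norm_inv, norm_norm, inv_mul_cancel₀ hn])
  refine ⟨v, hv, ?_⟩
  rw [InnerProductGeometry.angle_smul_left_of_pos _ _ (by positivity)] at hangle
  have h1 := Real.cos_le_cos_of_nonneg_of_le_pi (InnerProductGeometry.angle_nonneg a v) hζ hangle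
  rw [InnerProductGeometry.cos_angle, hV.1 v hv, mul_one, le_div_iff₀ (by positivity)] at h1
  exact h1

/-! ### Utility of the approximation of the diameter -/

/-- Some `v` of the cover has an angle at most `√(1/20)` with `a - b`, and `cos x ≥ 1 - x²/2` gives
the factor `1 - 1/40 = 39/40`. Convexity then replaces `a` by a point at distance exactly `ℓ` along
`v`. -/
theorem le_diamQuery {D : Directions} {d n : ℕ} (hd : 0 < d) {P : Finset (E d)}
    {A : E d →ₗ[ℝ] E (n + 1)} {κ ℓ : ℝ} (hℓ : 0 < ℓ) {a b : E (n + 1)}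
    (ha : a ∈ A '' tukeyRegion P κ) (hb : b ∈ A '' tukeyRegion P κ)
    (h : ℓ ≤ 39 / 40 * ‖a - b‖) : κ ≤ diamQuery D P A ℓ := by
  have hne : a - b ≠ 0 := by
    intro h0
    rw [h0, norm_zero] at h
    linarith
  have hsq : Real.sqrt ((1 / 10) / 2) ^ 2 = 1 / 20 := by rw [Real.sq_sqrt (by norm_num)]; norm_num
  have hpi : Real.sqrt ((1 / 10) / 2) ≤ Real.pi := by
    have h1 : Real.sqrt ((1 / 10) / 2) ≤ 1 := by
      rw [Real.sqrt_le_one]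
      norm_num
    linarith [Real.pi_gt_three]
  obtain ⟨v, hv, hva⟩ := (D.W_cover (n + 1)).exists_inner_ge hpi hne
  have hv1 := (D.W_cover (n + 1)).1 v hv
  have hcos := Real.one_sub_sq_div_two_le_cos (x := Real.sqrt ((1 / 10) / 2))
  rw [hsq] at hcos
  have hle : ℓ ≤ inner ℝ (a - b) v := by
    refine h.trans (le_trans ?_ hva)
    exact mul_le_mul_of_nonneg_right (by linarith) (norm_nonneg _)
  obtain ⟨c, hc, hcv⟩ := exists_inner_eq_add (convex_image_tukeyRegion hd P κ A) ha hb hℓ.le hle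
  have h1 := le_tdcDir (D := D) hv1 hb
  have h2 := le_tdcDir (D := D) hv1 hc
  rw [hcv] at h2
  refine (Nat.le_ceil κ).trans (Nat.cast_le.2 ?_)
  refine (le_min h1 h2).trans ((le_ciSup (bddAbove_range_min_tdcDir D P A v ℓ) (inner ℝ b v)).trans ?_)
  exact Finset.le_sup (f := fun v => ⨆ x : ℝ, min (tdcDir D P A v x) (tdcDir D P A v (x + ℓ))) hv

theorem exists_of_le_diamQuery {D : Directions} {d n : ℕ} {P : Finset (E d)}
    {A : E d →ₗ[ℝ] E (n + 1)} {θ ℓ : ℝ} (hθ : 0 < θ) (h : θ ≤ diamQuery D P A ℓ) :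
    ∃ a ∈ A '' tukeyRegion P θ, ∃ b ∈ A '' tukeyRegion P θ, ℓ ≤ ‖a - b‖ := by
  rw [← Nat.ceil_le, diamQuery, Finset.le_sup_iff (Nat.ceil_pos.2 hθ)] at h
  obtain ⟨v, hv, hvs⟩ := h
  have hv1 : ‖v‖ = 1 := (D.W_cover (n + 1)).1 v hv
  obtain ⟨x, hx⟩ := Nat.sSup_mem (Set.range_nonempty _) (bddAbove_range_min_tdcDir D P A v ℓ)
  have hx' : ⌈θ⌉₊ ≤ min (tdcDir D P A v x) (tdcDir D P A v (x + ℓ)) := by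
    rw [iSup, ← hx] at hvs
    exact hvs
  obtain ⟨p, hp, -, hpx⟩ := exists_of_le_tdcDir hv1 hθ (Nat.ceil_le.1 (hx'.trans (min_le_left _ _)))
  obtain ⟨p', hp', -, hpx'⟩ :=
    exists_of_le_tdcDir hv1 hθ (Nat.ceil_le.1 (hx'.trans (min_le_right _ _)))
  refine ⟨A p', ⟨p', hp', rfl⟩, A p, ⟨p, hp, rfl⟩, ?_⟩
  have h1 := real_inner_le_norm (A p' - A p) v
  rw [inner_sub_left, hpx, hpx', hv1, mul_one] at h1
  linarith

theorem diamLength_pos {d : ℕ} (hd : 0 < d) (i : ℕ) : 0 < diamLength d i := by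
  unfold diamLength
  have : (0 : ℝ) < d := by exact_mod_cast hd
  positivity

/-- Since `19/20 ≤ e^(-1/20)` and `T/20 ≥ υ + (ln d)/2`, the factor `√d` is absorbed. -/
theorem diamLength_diamRounds_le {d : ℕ} (hd : 0 < d) (υ : ℕ) :
    diamLength d (diamRounds d υ) ≤ Real.exp (-(υ : ℝ)) := by
  have hd' : (0 : ℝ) < d := by exact_mod_cast hd
  have h1 : (2 * (υ : ℝ) + Real.log d) / (1 / 10) ≤ diamRounds d υ := Nat.le_ceil _
  have h2 : (1 : ℝ) - (1 / 10) / 2 ≤ Real.exp (-(1 / 20)) := by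
    have := Real.add_one_le_exp (-(1 / 20) : ℝ)
    linarith
  have h3 : Real.sqrt d = Real.exp (Real.log d / 2) := by
    rw [Real.sqrt_eq_rpow, Real.rpow_def_of_pos hd']
    congr 1
    ring
  calc diamLength d (diamRounds d υ)
      ≤ Real.exp (Real.log d / 2) * Real.exp (-(1 / 20)) ^ diamRounds d υ := by
        rw [diamLength, h3]
        exact mul_le_mul_of_nonneg_left (pow_le_pow_left₀ (by norm_num) h2 _) (Real.exp_pos _).le
    _ = Real.exp (Real.log d / 2 + diamRounds d υ * (-(1 / 20))) := by
        rw [← Real.exp_nat_mul, ← Real.exp_add]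
    _ ≤ _ := by
        rw [Real.exp_le_exp]
        linarith

theorem norm_sub_le_sqrt {d b : ℕ} (hd : 0 < d) {P : Finset (E d)}
    (hP : (P : Set (E d)) ⊆ gridPoints d b) {κ : ℝ} (hκ : 0 < κ) {x y : E d}
    (hx : x ∈ tukeyRegion P κ) (hy : y ∈ tukeyRegion P κ) : ‖x - y‖ ≤ Real.sqrt d := by
  rw [EuclideanSpace.norm_eq]
  refine Real.sqrt_le_sqrt ?_
  refine (Finset.sum_le_card_nsmul _ _ 1 fun l _ => ?_).trans_eq (by simp)
  have h1 := abs_sub_le_one_of_mem_tukeyRegion hd hP hκ hx hy l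
  rw [PiLp.sub_apply, Real.norm_eq_abs]
  nlinarith [abs_nonneg (x l - y l)]

/-- The threshold lies below `κ` by one noise margin: skipped queries are truly below `κ`, and the
accepted one is at least `κ` minus two margins, which is `κ - deltaDiam`. -/
theorem dpTukeyDiam_accurate (D : Directions) {d n b : ℕ} (hd : 0 < d) (hb : 1 ≤ b) {ε β κ : ℝ}
    (hε : 0 < ε) (hβ : 0 < β) (hκ : 0 < κ) {P : Finset (E d)}
    (hP : (P : Set (E d)) ⊆ gridPoints d b) (hvol : 0 < volume (tukeyRegion P κ))
    {A : E d →ₗ[ℝ] E (n + 1)} (hA : IsCoisometry A) :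
    Fails β (dpTukeyDiam D (refinedBits d b) ε β κ P A) {ℓ | 0 ≤ ℓ ∧
      (∀ a ∈ A '' tukeyRegion P κ, ∀ c ∈ A '' tukeyRegion P κ, ‖a - c‖ ≤ 10 / 9 * ℓ) ∧
      (0 < κ - deltaDiam d (refinedBits d b) ε β →
        ∃ a ∈ A '' tukeyRegion P (κ - deltaDiam d (refinedBits d b) ε β),
        ∃ c ∈ A '' tukeyRegion P (κ - deltaDiam d (refinedBits d b) ε β), ℓ ≤ ‖a - c‖)} := by
  set υ := refinedBits d b with hυ
  set T := diamRounds d υ with hT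
  refine Fails.map ((sparseVector_accurate hε hβ (T + 1) _ _).mono ?_)
  rintro i ⟨hi, hbefore, hat⟩
  have hcast : (((T + 1 : ℕ) : ℝ) + 1) = (T : ℝ) + 2 := by push_cast; ring
  rw [hcast] at hbefore hat
  have hlt : ∀ j < i, ∀ a ∈ A '' tukeyRegion P κ, ∀ c ∈ A '' tukeyRegion P κ,
      39 / 40 * ‖a - c‖ < diamLength d j := by
    intro j hj a ha c hc
    by_contra hcon
    have h1 := le_diamQuery (D := D) hd (diamLength_pos hd j) ha hc (not_lt.1 hcon)
    have h2 := hbefore j hj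
    linarith
  -- If every length were skipped, the image would have diameter below `40/39 · e^(-υ)`. The
  -- isometry `B` pulls a unit vector back to one of the original space, where the region is wider
  -- than that.
  have hiT : i ≤ T := by
    by_contra hcon
    obtain ⟨B, hB⟩ := hA
    obtain ⟨w, hw⟩ := exists_norm_eq_one (Nat.succ_pos n)
    obtain ⟨x, hx, y, hy, hxy⟩ := exists_le_abs_inner_sub hd hb hP hκ hvol (u := B w)
      (by rw [B.norm_map, hw])
    have h1 := hlt T (not_le.1 hcon) (A x) ⟨x, hx, rfl⟩ (A y) ⟨y, hy, rfl⟩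
    rw [← hB, map_sub] at hxy
    have h2 := abs_real_inner_le_norm (A x - A y) w
    rw [hw, mul_one] at h2
    have h3 := diamLength_diamRounds_le hd υ
    linarith
  rw [Set.mem_preimage, if_pos hiT]
  refine ⟨(diamLength_pos hd i).le, fun a ha c hc => ?_, fun hpos => ?_⟩
  · cases i with
    | zero =>
      obtain ⟨x, hx, rfl⟩ := ha
      obtain ⟨y, hy, rfl⟩ := hc
      rw [← map_sub]
      have h1 := (hA.norm_map_le (x - y)).trans (norm_sub_le_sqrt hd hP hκ hx hy)
      have h2 : diamLength d 0 = Real.sqrt d := by simp [diamLength]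
      rw [h2]
      linarith [Real.sqrt_nonneg d]
    -- The previous length was skipped, so the diameter is at most `40/39 · 20/19 · ℓ`, and this
    -- constant is below `10/9`.
    | succ i =>
      have h1 := hlt i (Nat.lt_succ_self i) a ha c hc
      have h2 : diamLength d (i + 1) = 19 / 20 * diamLength d i := by
        simp only [diamLength, pow_succ]
        ring
      rw [h2]
      linarith [norm_nonneg (a - c)]
  · refine exists_of_le_diamQuery hpos (le_trans (le_of_eq ?_) (hat (Nat.lt_succ_of_le hiT)))
    rw [deltaDiam]
    ring

/-! ### Utility of the choice of a direction -/

theorem dpLargeTDCDirection_accurate (D : Directions) {d n : ℕ} {ε β : ℝ}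
    (hε : 0 < ε) (hβ : 0 < β) (κ : ℝ) (P : Finset (E d)) (A : E d →ₗ[ℝ] E (n + 1))
    (V : List (E (n + 1))) (s : E (n + 1)) (lam : ℝ)
    (hex : ∃ v ∈ V, κ ≤ tdcDir D P A v (inner ℝ s v + lam)) :
    Fails β (dpLargeTDCDirection D ε β κ P A V s lam)
      {o | ∃ v ∈ V, o = some v ∧ κ - deltaDir V.length ε β ≤ tdcDir D P A v (inner ℝ s v + lam)} := by
  refine Fails.map ((sparseVector_accurate hε hβ V.length _ _).mono ?_)
  rintro i ⟨hi, hbefore, hat⟩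
  have hilt : i < V.length := by
    by_contra hcon
    obtain ⟨v, hv, hκ⟩ := hex
    obtain ⟨j, hj, rfl⟩ := List.mem_iff_getElem.1 hv
    have h1 := hbefore j (by omega)
    rw [List.getElem?_eq_getElem hj] at h1
    have h2 : 6 * Real.log ((V.length + 1) / β) / ε = 6 / ε * Real.log ((V.length + 1) / β) := by
      ring
    simp only at h1
    linarith
  have h1 := hat hilt
  rw [List.getElem?_eq_getElem hilt] at h1
  refine ⟨V[i], List.getElem_mem hilt, List.getElem?_eq_getElem hilt, le_trans (le_of_eq ?_) h1⟩
  rw [deltaDir]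
  ring

theorem findT_accurate (D : Directions) {d n b : ℕ} (hd : 0 < d) (hb : 1 ≤ b) {M : QCAlgorithm}
    {β α : ℝ} (hβ : 0 ≤ β) (hα : 0 ≤ α) (hM : QCAccurate M (refinedBits d b) β α)
    {P : Finset (E d)} (hP : (P : Set (E d)) ⊆ gridPoints d b) (A : E d →ₗ[ℝ] E (n + 1))
    (s : E (n + 1)) (lam : ℝ) {v : E (n + 1)} (hv : ‖v‖ = 1) {θ : ℝ} (hθ : 0 < θ - n * α)
    (h : θ ≤ tdcDir D P A v (inner ℝ s v + lam)) :
    Fails (n * β) (findT D M b P A s lam (some v))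
      {o | ∃ t ∈ A '' tukeyRegion P (θ - n * α), o = some t ∧ inner ℝ t v = inner ℝ s v + lam} := by
  have hlen : (List.finRange (n + 1)).tail.length = n := by
    rw [List.length_tail, List.length_finRange, Nat.add_sub_cancel]
  have hmem : ∀ m : Fin (n + 1), m ∉ (List.finRange (n + 1)).tail ↔ m = 0 := by
    intro m
    rw [List.finRange_succ, List.tail_cons]
    refine Fin.cases (by simp [Fin.succ_ne_zero]) (fun m => by simp) m
  have hθ0 : 0 < θ := by
    have : 0 ≤ (n : ℝ) * α := by positivity
    linarith
  obtain ⟨p, hp, hp0, -⟩ := exists_of_le_tdcDir hv hθ0 h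
  have h1 := fillCoords_accurate hd hb hβ hα hM hP (D.rotate v A) (List.finRange (n + 1)).tail
    (List.pairwise_lt_finRange (n + 1)).tail (fun m hm i hi => by
      rw [hmem] at hm
      subst hm
      rw [Fin.pos_iff_ne_zero]
      exact fun h0 => (hmem i).2 h0 hi)
    (Function.update 0 0 (inner ℝ s v + lam)) (θ := θ) (by rwa [hlen])
    ⟨p, hp, fun m hm => by
      rw [(hmem m).1 hm, hp0, Function.update_self]⟩
  rw [hlen] at h1
  refine Fails.map (h1.mono ?_)
  rintro y ⟨⟨p', hp', hpy⟩, hy⟩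
  have hAp : A p' = (D.R n v).symm (WithLp.toLp 2 y) := by
    rw [LinearIsometryEquiv.eq_symm_apply, ← hpy]
    rfl
  refine ⟨A p', ⟨p', hp', rfl⟩, by rw [hAp], ?_⟩
  rw [← D.rotate_apply_zero hv A p', hpy]
  change y 0 = _
  rw [hy 0 ((hmem 0).2 rfl), Function.update_self]

/-! ### Boxes -/

/-- Applying an isometry to all coordinates but the first. -/
def consIsometry {n : ℕ} (F : E n ≃ₗᵢ[ℝ] E n) : E (n + 1) ≃ₗᵢ[ℝ] E (n + 1) where
  toFun x := consCoord (x 0) (F (dropFirst n x))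
  invFun x := consCoord (x 0) (F.symm (dropFirst n x))
  left_inv x := ext_dropFirst rfl (by simp [dropFirst_consCoord])
  right_inv x := ext_dropFirst rfl (by simp [dropFirst_consCoord])
  map_add' x y := ext_dropFirst (by simp [consCoord_zero]) (by
    simp [dropFirst_consCoord])
  map_smul' c x := ext_dropFirst (by simp [consCoord_zero]) (by
    simp [dropFirst_consCoord])
  norm_map' x := by
    change ‖consCoord (x 0) (F (dropFirst n x))‖ = ‖x‖
    rw [← sq_eq_sq₀ (norm_nonneg _) (norm_nonneg _), ← real_inner_self_eq_norm_sq,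
      ← real_inner_self_eq_norm_sq, inner_succ, inner_succ x, dropFirst_consCoord, consCoord_zero,
      F.inner_map_map]

theorem IsBox.univ_zero : IsBox (Set.univ : Set (E 0)) :=
  ⟨LinearIsometryEquiv.refl ℝ _, 0, 0, fun i => i.elim0, by ext x; simp⟩

theorem IsBox.extend (D : Directions) {n : ℕ} {u : E (n + 1)} (hu : ‖u‖ = 1) {a c : ℝ}
    (hac : a ≤ c) {B : Set (E n)} (hB : IsBox B) :
    IsBox {x : E (n + 1) | inner ℝ x u ∈ Set.Icc a c ∧ dropFirst n (D.R n u x) ∈ B} := by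
  obtain ⟨F, lo, hi, hle, rfl⟩ := hB
  refine ⟨(D.R n u).trans (consIsometry F), Fin.cons a lo, Fin.cons c hi,
    fun i => Fin.cases hac hle i, ?_⟩
  ext x
  simp only [Set.mem_ofPred_eq]
  rw [Fin.forall_fin_succ, ← D.R_apply_zero hu]
  rfl

/-- The box with side `[⟨s, u⟩ - 10/9 ℓ, ⟨s, u⟩ + 10/9 ℓ]` in direction `u` over the base `B`. -/
def extendBox (D : Directions) {n : ℕ} (s u : E (n + 1)) (ℓ : ℝ) (B : Set (E n)) :
    Set (E (n + 1)) :=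
  {x | inner ℝ x u ∈ Set.Icc (inner ℝ s u - 10 / 9 * ℓ) (inner ℝ s u + 10 / 9 * ℓ) ∧
    dropFirst n (D.R n u x) ∈ B}

theorem subset_extendBox (D : Directions) {n : ℕ} {K : Set (E (n + 1))} {s u : E (n + 1)}
    (hu : ‖u‖ = 1) {ℓ : ℝ} (hℓ : ∀ a ∈ K, ‖a - s‖ ≤ 10 / 9 * ℓ) {B : Set (E n)}
    (hB : (fun x => dropFirst n (D.R n u x)) '' K ⊆ B) : K ⊆ extendBox D s u ℓ B := by
  intro a ha
  refine ⟨?_, hB ⟨a, ha, rfl⟩⟩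
  have h1 := abs_real_inner_le_norm (a - s) u
  rw [hu, mul_one, inner_sub_left, abs_le] at h1
  have h2 := hℓ a ha
  constructor <;> linarith

/-- One step of the volume recursion: the base is compared with the projection of `K` along `u`, and
the cone bound for the chord `st` returns to `K` with the factor `n + 1`. -/
theorem volume_extendBox_le (D : Directions) {n : ℕ} {K : Set (E (n + 1))} (hK : IsCompact K)
    (hconv : Convex ℝ K) {s t u : E (n + 1)} (hs : s ∈ K) (ht : t ∈ K) (hu : ‖u‖ = 1)
    {L ℓ : ℝ} (hst : t - s = L • u) (hL : 0.45 * ℓ ≤ L) (hℓ : 0 ≤ ℓ) (s' : E (n + 1))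
    {B : Set (E n)} (hB : volume B ≤ 5 ^ n * (n.factorial : ENNReal) *
      volume ((fun x => dropFirst n (D.R n u x)) '' K)) :
    volume (extendBox D s' u ℓ B) ≤ 5 ^ (n + 1) * ((n + 1).factorial : ENNReal) * volume K := by
  rw [extendBox, volume_box D hu]
  -- The side is `20/9 ℓ`, and `20/9 ≤ 5 · 0.45`.
  have h1 : ENNReal.ofReal (inner ℝ s' u + 10 / 9 * ℓ - (inner ℝ s' u - 10 / 9 * ℓ)) ≤
      5 * ENNReal.ofReal L := by
    have h5 : (5 : ENNReal) = ENNReal.ofReal 5 := by norm_num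
    rw [h5, ← ENNReal.ofReal_mul (by norm_num)]
    refine ENNReal.ofReal_le_ofReal ?_
    linarith
  refine (mul_le_mul' h1 hB).trans ?_
  have h2 := volume_image_rotate_dropFirst_le D hK hconv hs ht hu hst
  calc 5 * ENNReal.ofReal L * (5 ^ n * (n.factorial : ENNReal) *
        volume ((fun x => dropFirst n (D.R n u x)) '' K))
      = 5 ^ (n + 1) * (n.factorial : ENNReal) *
        (ENNReal.ofReal L * volume ((fun x => dropFirst n (D.R n u x)) '' K)) := by ring
    _ ≤ 5 ^ (n + 1) * (n.factorial : ENNReal) * ((n + 1) * volume K) := mul_le_mul_right h2 _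
    _ = _ := by
      rw [Nat.factorial_succ]
      push_cast
      ring

/-! ### Utility of the bounding-box algorithm -/

/-- The volume guarantee is conditional on `0 < κ - Δ`. This form carries the condition through the
union bound, at no cost when it fails. -/
theorem fails_of_imp {Ω : Type} {β : ℝ} {p : PMF Ω} {q : Prop} {S : Set Ω}
    (h : q → Fails β p S) : Fails β p {o | q → o ∈ S} := by
  by_cases hq : q
  · exact (h hq).mono fun o ho _ => ho
  · have : {o | q → o ∈ S} = Set.univ := Set.eq_univ_of_forall fun o h => absurd h hq
    rw [this, Fails, Set.compl_univ, prob, measure_empty]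
    exact zero_le

theorem deltaDiam_nonneg {ε β : ℝ} (d υ : ℕ) (hε : 0 < ε) (hβ : 0 < β) (hβ1 : β ≤ 1) :
    0 ≤ deltaDiam d υ ε β := by
  have h1 : (1 : ℝ) ≤ (diamRounds d υ + 2) / β := by
    rw [one_le_div hβ]
    have : (0 : ℝ) ≤ diamRounds d υ := Nat.cast_nonneg _
    linarith
  have := Real.log_nonneg h1
  unfold deltaDiam
  positivity

theorem deltaDir_nonneg {ε β : ℝ} (m : ℕ) (hε : 0 < ε) (hβ : 0 < β) (hβ1 : β ≤ 1) :
    0 ≤ deltaDir m ε β := by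
  have h1 : (1 : ℝ) ≤ (m + 1) / β := by
    rw [one_le_div hβ]
    have : (0 : ℝ) ≤ m := Nat.cast_nonneg _
    linarith
  have := Real.log_nonneg h1
  unfold deltaDir
  positivity

theorem deltaDir_mono {ε β : ℝ} {m m' : ℕ} (hε : 0 < ε) (hβ : 0 < β) (h : m ≤ m') :
    deltaDir m ε β ≤ deltaDir m' ε β := by
  unfold deltaDir
  have : (m : ℝ) ≤ m' := Nat.cast_le.2 h
  gcongr

theorem norm_segmentDir {n : ℕ} (s : E (n + 1)) (o : Option (E (n + 1))) :
    ‖segmentDir s o‖ = 1 := by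
  have h0 : ‖e₀ n‖ = 1 := by simp [e₀]
  cases o with
  | none => exact h0
  | some t =>
    by_cases h : t = s
    · rwa [segmentDir, if_pos h]
    · rw [segmentDir, if_neg h, norm_smul, norm_inv, norm_norm, inv_mul_cancel₀ (norm_ne_zero_iff.2 (sub_ne_zero.2 h))]

theorem sub_eq_norm_smul_segmentDir {n : ℕ} (s t : E (n + 1)) :
    t - s = ‖t - s‖ • segmentDir s (some t) := by
  by_cases h : t = s
  · simp [h]
  · rw [segmentDir, if_neg h, smul_smul, mul_inv_cancel₀ (norm_ne_zero_iff.2 (sub_ne_zero.2 h)), one_smul]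

/-- One of `a`, `c` is at distance at least `ℓ/2` from `s`, and the cover keeps the fraction `cos
(arccos (9/10)) = 9/10` of it; hence `0.45 ℓ`. -/
theorem exists_direction (D : Directions) {d n : ℕ} (hd : 0 < d) {P : Finset (E d)}
    {A : E d →ₗ[ℝ] E (n + 1)} {θ ℓ : ℝ} (hℓ : 0 ≤ ℓ) {s a c : E (n + 1)}
    (hs : s ∈ A '' tukeyRegion P θ) (ha : a ∈ A '' tukeyRegion P θ)
    (hc : c ∈ A '' tukeyRegion P θ) (h : ℓ ≤ ‖a - c‖) :
    ∃ v ∈ D.V (n + 1), θ ≤ tdcDir D P A v (inner ℝ s v + 0.45 * ℓ) := by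
  obtain ⟨x, hx, hxs⟩ : ∃ x ∈ A '' tukeyRegion P θ, ℓ / 2 ≤ ‖x - s‖ := by
    have htri : ‖a - c‖ ≤ ‖a - s‖ + ‖c - s‖ := by
      have := norm_sub_le (a - s) (c - s)
      rwa [sub_sub_sub_cancel_right] at this
    rcases le_or_gt (ℓ / 2) ‖a - s‖ with h1 | h1
    · exact ⟨a, ha, h1⟩
    · exact ⟨c, hc, by linarith⟩
  suffices h : ∃ v ∈ D.V (n + 1), 0.45 * ℓ ≤ inner ℝ (x - s) v by
    obtain ⟨v, hv, hle⟩ := h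
    obtain ⟨z, hz, hzv⟩ := exists_inner_eq_add (convex_image_tukeyRegion hd P θ A) hx hs
      (by positivity) hle
    refine ⟨v, hv, (Nat.le_ceil θ).trans (Nat.cast_le.2 ?_)⟩
    rw [← hzv]
    exact le_tdcDir ((D.V_cover (n + 1)).1 v hv) hz
  -- Here `ℓ ≤ 0`, and any vector of the cover will do; one exists because the cover is nonempty.
  rcases eq_or_ne (x - s) 0 with h0 | h0
  · obtain ⟨w, hw⟩ := exists_norm_eq_one (Nat.succ_pos n)
    obtain ⟨v, hv, -⟩ := (D.V_cover (n + 1)).2 w hw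
    refine ⟨v, hv, ?_⟩
    rw [h0, norm_zero] at hxs
    rw [h0, inner_zero_left]
    linarith
  · obtain ⟨v, hv, hva⟩ := (D.V_cover (n + 1)).exists_inner_ge (Real.arccos_le_pi _) h0
    refine ⟨v, hv, le_trans ?_ hva⟩
    rw [Real.cos_arccos (by norm_num) (by norm_num)]
    linarith

theorem image_dropFirst_rotate (D : Directions) {d n : ℕ} (u : E (n + 1))
    (A : E d →ₗ[ℝ] E (n + 1)) (S : Set (E d)) :
    (dropFirst n ∘ₗ D.rotate u A) '' S = (fun x => dropFirst n (D.R n u x)) '' (A '' S) := by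
  rw [← Set.image_comp]
  rfl

theorem isCompact_image_tukeyRegion {d j : ℕ} (hd : 0 < d) (P : Finset (E d)) {κ : ℝ} (hκ : 0 < κ)
    (A : E d →ₗ[ℝ] E j) : IsCompact (A '' tukeyRegion P κ) :=
  (isCompact_tukeyRegion hd P hκ).image A.continuous_of_finiteDimensional

/-- `B` is a box that contains the image of the Tukey region, and its volume is bounded in terms of
the image of a Tukey region of smaller depth. -/
def GoodImageBox {d j : ℕ} (P : Finset (E d)) (A : E d →ₗ[ℝ] E j) (κ Δ : ℝ) (B : Set (E j)) :
    Prop :=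
  IsBox B ∧ A '' tukeyRegion P κ ⊆ B ∧
    (0 < κ - Δ → volume B ≤ 5 ^ j * (j.factorial : ENNReal) * volume (A '' tukeyRegion P (κ - Δ)))

theorem fillCoords_all_accurate {d j b : ℕ} (hd : 0 < d) (hb : 1 ≤ b) (hj : j ≤ d)
    {M : QCAlgorithm} {β α κ : ℝ} (hβ : 0 ≤ β) (hα : 0 ≤ α)
    (hM : QCAccurate M (refinedBits d b) β α) {P : Finset (E d)}
    (hP : (P : Set (E d)) ⊆ gridPoints d b) (hκ : 0 < κ)
    (hne : (tukeyRegion P (κ + d * α)).Nonempty) (A : E d →ₗ[ℝ] E j) :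
    Fails (j * β) (fillCoords M b P A (List.finRange j) 0)
      {y | WithLp.toLp 2 y ∈ A '' tukeyRegion P κ} := by
  have hjd : (j : ℝ) * α ≤ d * α := mul_le_mul_of_nonneg_right (Nat.cast_le.2 hj) hα
  obtain ⟨p, hp⟩ := hne
  have h1 := fillCoords_accurate hd hb hβ hα hM hP A (List.finRange j)
    (List.pairwise_lt_finRange j) (fun m hm => absurd (List.mem_finRange m) hm) 0
    (θ := κ + d * α) (by rw [List.length_finRange]; linarith)
    ⟨p, hp, fun m hm => absurd (List.mem_finRange m) hm⟩
  rw [List.length_finRange] at h1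
  refine h1.mono ?_
  rintro y ⟨⟨p', hp', hy⟩, -⟩
  exact ⟨p', tukeyRegion_antitone P (by linarith) hp', hy⟩

/-- Containment needs only that `s` lies in the image of the region of depth `κ` and that `10/9 ℓ`
bounds its diameter, so it holds for any direction `u`. The volume bound needs a chord at depth `κ -
Δ`: the depth drops by `deltaDiam` for the length, by `deltaDir` for the direction and by `α` for
each remaining coordinate of `t`. The induction hypothesis applies to the projected map with the
same `κ` and `Δ`. -/
theorem bbRec_accurate (D : Directions) {d b m : ℕ} (hd : 0 < d) (hb : 1 ≤ b)
    (hm : ∀ j ≤ d, (D.V j).length ≤ m) {M : QCAlgorithm} {ε β α κ : ℝ} (hε : 0 < ε) (hβ : 0 < β)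
    (hβ1 : β ≤ 1) (hα : 0 ≤ α) (hM : QCAccurate M (refinedBits d b) β α) {P : Finset (E d)}
    (hP : (P : Set (E d)) ⊆ gridPoints d b) (hκ : 0 < κ)
    (hvol : 0 < volume (tukeyRegion P κ)) (hne : (tukeyRegion P (κ + d * α)).Nonempty)
    {Δ : ℝ} (hΔ : deltaDiam d (refinedBits d b) ε β + deltaDir m ε β + d * α ≤ Δ)
    (j : ℕ) (hj0 : 0 < j) (hj : j ≤ d) (A : E d →ₗ[ℝ] E j) (hA : IsCoisometry A) :
    Fails (recCalls j * β) (bbRec D M b ε β κ P j A) {B | GoodImageBox P A κ Δ B} := by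
  have hΔ1 := deltaDiam_nonneg d (refinedBits d b) hε hβ hβ1
  have hΔ2 := deltaDir_nonneg m hε hβ hβ1
  have hdα : 0 ≤ (d : ℝ) * α := by positivity
  induction j using recCalls.induct with
  | case1 => exact absurd hj0 (lt_irrefl 0)
  | case2 =>
    have h1 := fillCoords_all_accurate hd hb hj hβ.le hα hM hP hκ hne A
    rw [bbRec, show ((recCalls 1 : ℕ) : ℝ) * β = (1 : ℕ) * β + (β + 0) by
      simp only [recCalls]; push_cast; ring]
    refine Fails.bind (by positivity) (by positivity) h1 fun s hs => ?_
    refine Fails.bind hβ.le le_rfl (dpTukeyDiam_accurate D hd hb hε hβ hκ hP hvol hA)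
      fun ℓ hℓ => fails_pure ?_
    obtain ⟨hℓ0, hdiam, hlarge⟩ := hℓ
    have hu : ‖e₀ 0‖ = 1 := by simp [e₀]
    have hin : ∀ x : E 1, inner ℝ x (e₀ 0) = x 0 := fun x => by
      simp [e₀, EuclideanSpace.inner_single_right]
    have hB : {x : E 1 | x 0 ∈ Set.Icc (s 0 - 10 / 9 * ℓ) (s 0 + 10 / 9 * ℓ)} =
        extendBox D (WithLp.toLp 2 s) (e₀ 0) ℓ Set.univ := by
      ext x
      rw [extendBox, Set.mem_ofPred_eq, Set.mem_ofPred_eq, hin, hin]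
      simp only [Set.mem_univ, and_true]
    rw [hB]
    refine ⟨IsBox.extend D hu (by linarith) IsBox.univ_zero,
      subset_extendBox D hu (fun a ha => hdiam a ha _ hs) (Set.subset_univ _), fun hpos => ?_⟩
    obtain ⟨a, ha, c, hc, hac⟩ := hlarge (by linarith)
    have hsub : A '' tukeyRegion P (κ - deltaDiam d (refinedBits d b) ε β) ⊆
        A '' tukeyRegion P (κ - Δ) := Set.image_mono (tukeyRegion_antitone P (by linarith))
    have hsmul : ∀ x y : E 1, x - y = (x 0 - y 0) • e₀ 0 := by
      intro x y
      ext i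
      rw [Subsingleton.elim i 0]
      simp [e₀]
    have hnorm : ‖a - c‖ = |a 0 - c 0| := by
      rw [hsmul, norm_smul, hu, mul_one, Real.norm_eq_abs]
    have hK := isCompact_image_tukeyRegion hd P hpos A
    have hconv := convex_image_tukeyRegion hd P (κ - Δ) A
    -- In dimension 0 the base is a single point, of volume 1.
    have hbase : ∀ K : Set (E 1), K.Nonempty → volume (Set.univ : Set (E 0)) ≤
        5 ^ 0 * (Nat.factorial 0 : ENNReal) *
        volume ((fun x => dropFirst 0 (D.R 0 (e₀ 0) x)) '' K) := by
      intro K hKne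
      rw [(hKne.image _).eq_univ]
      simp
    rw [hnorm] at hac
    rcases le_total 0 (a 0 - c 0) with h0 | h0
    · rw [abs_of_nonneg h0] at hac
      exact volume_extendBox_le D hK hconv (hsub hc) (hsub ha) hu (hsmul a c) (by linarith) hℓ0 _
        (hbase _ ⟨a, hsub ha⟩)
    · rw [abs_of_nonpos h0, neg_sub] at hac
      exact volume_extendBox_le D hK hconv (hsub ha) (hsub hc) hu (hsmul c a) (by linarith) hℓ0 _
        (hbase _ ⟨a, hsub ha⟩)
  | case3 n ih =>
    have h1 := fillCoords_all_accurate hd hb hj hβ.le hα hM hP hκ hne A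
    have hr : 0 ≤ (recCalls (n + 1) : ℝ) * β := by positivity
    have hn : 0 ≤ ((n + 1 : ℕ) : ℝ) * β := by positivity
    have hnα : ((n + 1 : ℕ) : ℝ) * α ≤ d * α :=
      mul_le_mul_of_nonneg_right (Nat.cast_le.2 (by omega)) hα
    rw [bbRec, show ((recCalls (n + 2) : ℕ) : ℝ) * β = (n + 2 : ℕ) * β + (β + (β +
      ((n + 1 : ℕ) * β + (recCalls (n + 1) * β + 0)))) by simp only [recCalls]; push_cast; ring]
    refine Fails.bind (by positivity) (by linarith) h1 fun s' hs => ?_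
    set s : E (n + 2) := WithLp.toLp 2 s' with hsdef
    refine Fails.bind hβ.le (by linarith) (dpTukeyDiam_accurate D hd hb hε hβ hκ hP hvol hA)
      fun ℓ hℓ => ?_
    obtain ⟨hℓ0, hdiam, hlarge⟩ := hℓ
    have hlen := deltaDir_mono hε hβ (hm (n + 2) hj)
    have hdir := deltaDir_nonneg (D.V (n + 2)).length hε hβ hβ1
    refine Fails.bind hβ.le (by linarith) (fails_of_imp (q := 0 < κ - Δ) fun hpos => by
      obtain ⟨a, ha, c, hc, hac⟩ := hlarge (by linarith)
      exact dpLargeTDCDirection_accurate D hε hβ (κ - deltaDiam d (refinedBits d b) ε β) P A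
        (D.V (n + 2)) s (0.45 * ℓ) (exists_direction D hd hℓ0
          (Set.image_mono (tukeyRegion_antitone P (by linarith)) hs) ha hc hac)) fun o ho => ?_
    refine Fails.bind hn (by linarith) (S := {t | 0 < κ - Δ → t ∈ {t | ∃ v : E (n + 2), ‖v‖ = 1 ∧
        ∃ t' ∈ A '' tukeyRegion P (κ - Δ), t = some t' ∧
          inner ℝ t' v = inner ℝ s v + 0.45 * ℓ}})
      (fails_of_imp fun hpos => by
        obtain ⟨v, hv, rfl, hvθ⟩ := ho hpos
        have hv1 := (D.V_cover (n + 2)).1 v hv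
        refine (findT_accurate D hd hb hβ.le hα hM hP A s (0.45 * ℓ) hv1 (by linarith) hvθ).mono ?_
        rintro _ ⟨t, ht, rfl, htv⟩
        exact ⟨v, hv1, t, Set.image_mono (tukeyRegion_antitone P (by linarith)) ht, rfl, htv⟩)
      fun t ht => ?_
    set u := segmentDir s t with hu
    have hu1 : ‖u‖ = 1 := norm_segmentDir s t
    refine Fails.bind hr le_rfl (ih (Nat.succ_pos n) (by omega) _ (hA.rotate D u).dropFirst)
      fun B' hB' => fails_pure ?_
    obtain ⟨hbox, hsubB, hvolB⟩ := hB'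
    rw [image_dropFirst_rotate] at hsubB hvolB
    refine ⟨IsBox.extend D hu1 (by linarith) hbox,
      subset_extendBox D hu1 (fun a ha => hdiam a ha _ hs) hsubB, fun hpos => ?_⟩
    obtain ⟨v, hv1, t', ht', rfl, htv⟩ := ht hpos
    refine volume_extendBox_le D (isCompact_image_tukeyRegion hd P hpos A)
      (convex_image_tukeyRegion hd P (κ - Δ) A)
      (Set.image_mono (tukeyRegion_antitone P (by linarith)) hs) ht' hu1
      (sub_eq_norm_smul_segmentDir s t') ?_ hℓ0 s (hvolB hpos)
    have h2 := real_inner_le_norm (t' - s) v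
    rw [inner_sub_left, htv, hv1, mul_one] at h2
    linarith

theorem boundingBox_accurate (D : Directions) (M : ℝ → ℝ → ℝ → QCAlgorithm) {d b m : ℕ}
    (hd : 0 < d) (hb : 1 ≤ b) (hm : ∀ j ≤ d, (D.V j).length ≤ m) {ε δ β κ α : ℝ} (hε : 0 < ε)
    (hβ : 0 < β) (hβ1 : β < 1)
    (hM : QCAccurate (M (ε / numCalls d) (δ / numCalls d) (β / numCalls d)) (refinedBits d b)
      (β / numCalls d) α)
    {P : Finset (E d)} (hP : (P : Set (E d)) ⊆ gridPoints d b) (hκ : 0 < κ)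
    (hvol : 0 < volume (tukeyRegion P κ)) (hne : (tukeyRegion P (κ + d * α)).Nonempty)
    {Δ : ℝ} (hΔ : deltaBB d (refinedBits d b) m ε β α ≤ Δ) :
    ENNReal.ofReal (1 - β) ≤ prob (boundingBox D M b ε δ β κ P) {B | GoodBox P κ Δ B} := by
  have hk := numCalls_pos hd
  have hk1 : 1 ≤ numCalls d := by
    have : (1 : ℝ) ≤ d := by exact_mod_cast hd
    unfold numCalls
    nlinarith
  have hβ0 : β / numCalls d < 1 := (div_lt_one hk).2 (hβ1.trans_le hk1)
  rw [← fails_iff hβ.le]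
  have h1 := bbRec_accurate D hd hb hm (div_pos hε hk) (div_pos hβ hk) hβ0.le
    (hM.nonneg hβ0) hM hP hκ hvol hne hΔ d hd le_rfl LinearMap.id (isCoisometry_id d)
  rw [recCalls_eq hd, mul_div_cancel₀ _ hk.ne'] at h1
  refine h1.mono ?_
  rintro B ⟨hbox, hsub, hvolB⟩
  have hid : ∀ S : Set (E d), (LinearMap.id : E d →ₗ[ℝ] E d) '' S = S := fun S => Set.image_id S
  rw [hid] at hsub hvolB
  refine ⟨hbox, hsub, measure_mono hsub, ?_⟩
  -- For `κ - Δ ≤ 0` the region is the whole space, which has infinite volume.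
  rcases lt_or_ge 0 (κ - Δ) with hpos | hneg
  · exact hvolB hpos
  · have : Nontrivial (E d) := by
      obtain ⟨w, hw⟩ := exists_norm_eq_one hd
      exact ⟨w, 0, fun h => by rw [h, norm_zero] at hw; exact zero_ne_one hw⟩
    have h5 : (5 : ENNReal) ^ d * (d.factorial : ENNReal) ≠ 0 :=
      mul_ne_zero (by simp) (by exact_mod_cast d.factorial_ne_zero)
    rw [tukeyRegion_of_nonpos P hneg, measure_univ_of_isAddLeftInvariant, ENNReal.mul_top h5]
    exact le_top

/-! ### The binary search is the exponential mechanism -/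

theorem coin_apply_true {p : ℝ} (h1 : p ≤ 1) :
    coin p.toNNReal true = ENNReal.ofReal p := by
  have h : p.toNNReal ≤ 1 := by simpa using h1
  change ((min p.toNNReal 1 : NNReal) : ENNReal) = _
  rw [min_eq_left h]
  rfl

theorem coin_apply_false {p : ℝ} (h0 : 0 ≤ p) (h1 : p ≤ 1) :
    coin p.toNNReal false = ENNReal.ofReal (1 - p) := by
  have h : p.toNNReal ≤ 1 := by simpa using h1
  change ((1 - min p.toNNReal 1 : NNReal) : ENNReal) = _
  rw [min_eq_left h, ENNReal.ofReal_sub _ h0, ENNReal.coe_sub]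
  simp [ENNReal.ofReal]

theorem sum_map_pos {w : ℝ → ℝ} (hw : ∀ x, 0 < w x) {L : List ℝ} (hL : L ≠ []) :
    0 < (L.map w).sum := by
  refine List.sum_pos _ (fun a ha => ?_) (by simpa using hL)
  obtain ⟨x, -, rfl⟩ := List.mem_map.1 ha
  exact hw x

theorem pure_headD_apply {w : ℝ → ℝ} (hw : ∀ x, 0 < w x) {L : List ℝ} (hL : L ≠ [])
    (h1 : L.length ≤ 1) (x : ℝ) :
    PMF.pure (L.headD 0) x = if x ∈ L then ENNReal.ofReal (w x / (L.map w).sum) else 0 := by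
  obtain ⟨a, rfl⟩ : ∃ a, L = [a] :=
    List.length_eq_one_iff.1 (le_antisymm h1 (List.length_pos_iff.2 hL))
  by_cases h : x = a
  · subst h
    simp [PMF.pure_apply, div_self (hw x).ne']
  · simp [PMF.pure_apply, h]

/-- The probability of the half that contains `x` is its share of the total weight, and the
recursive call contributes the share of `x` within that half; the weight of the half cancels. -/
theorem bisect_apply {w : ℝ → ℝ} (hw : ∀ x, 0 < w x) (r : ℕ) :
    ∀ L : List ℝ, L ≠ [] → L.Nodup → L.length ≤ 2 ^ r → ∀ x, bisect w r L x =
      if x ∈ L then ENNReal.ofReal (w x / (L.map w).sum) else 0 := by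
  induction r with
  | zero => exact fun L hL _ h1 x => pure_headD_apply hw hL (by simpa using h1) x
  | succ r ih =>
    intro L hL hnd hlen x
    rw [bisect]
    split_ifs with h1 hx hx
    · rw [pure_headD_apply hw hL h1, if_pos hx]
    · rw [pure_headD_apply hw hL h1, if_neg hx]
    all_goals
      rw [pow_succ] at hlen
      set n := L.length / 2 with hn
      have hsplit : L.take n ++ L.drop n = L := List.take_append_drop n L
      have hl₁ : (L.take n).length = n := by simp; omega
      have hl₂ : (L.drop n).length = L.length - n := by simp
      have hne₁ : L.take n ≠ [] := List.length_pos_iff.1 (by omega)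
      have hne₂ : L.drop n ≠ [] := List.length_pos_iff.1 (by omega)
      have hmem : x ∈ L ↔ x ∈ L.take n ∨ x ∈ L.drop n := by
        rw [← List.mem_append, hsplit]
      rw [← hsplit] at hnd
      have hdisj := List.disjoint_of_nodup_append hnd
      have hsum : (L.map w).sum = ((L.take n).map w).sum + ((L.drop n).map w).sum := by
        rw [← List.sum_append, ← List.map_append, hsplit]
      have ih₁ := ih _ hne₁ (List.nodup_append.1 hnd).1 (by omega) x
      have ih₂ := ih _ hne₂ (List.nodup_append.1 hnd).2.1 (by omega) x
      have hs₁ := sum_map_pos hw hne₁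
      have hs₂ := sum_map_pos hw hne₂
      have hp1 : ((L.take n).map w).sum / (((L.take n).map w).sum + ((L.drop n).map w).sum) ≤ 1 :=
        (div_le_one (by linarith)).2 (by linarith)
      rw [PMF.bind_apply, tsum_bool, coin_apply_true hp1, coin_apply_false (by positivity) hp1]
      simp only [if_true, Bool.false_eq_true, if_false]
      rw [ih₁, ih₂]
    · rw [hsum]
      rcases hmem.1 hx with h | h
      · rw [if_pos h, if_neg (hdisj h), mul_zero, zero_add, ← ENNReal.ofReal_mul (by positivity)]
        congr 1
        field_simp
      · rw [if_pos h, if_neg (fun h' => hdisj h' h), mul_zero, add_zero,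
          ← ENNReal.ofReal_mul (by linarith)]
        congr 1
        field_simp
        ring
    · rw [hmem, not_or] at hx
      rw [if_neg hx.1, if_neg hx.2, mul_zero, mul_zero, add_zero]

theorem binarySearch_apply (ε : ℝ) {G : Finset ℝ} (hG : G.Nonempty) (q : ℝ → ℝ) (x : ℝ) :
    binarySearch ε G q x = if x ∈ G then
      ENNReal.ofReal (Real.exp (ε * q x / 2) / ∑ y ∈ G, Real.exp (ε * q y / 2)) else 0 := by
  have hne : G.sort (· ≤ ·) ≠ [] := by
    intro h
    have := congrArg List.length h
    rw [Finset.length_sort] at this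
    exact hG.card_pos.ne' this
  rw [binarySearch, bisect_apply (fun _ => Real.exp_pos _) _ _ hne (Finset.sort_nodup _ _)
    (by rw [Finset.length_sort]; exact Nat.le_pow_clog one_lt_two _),
    ← List.sum_toFinset _ (Finset.sort_nodup _ _), Finset.sort_toFinset]
  simp only [Finset.mem_sort]

/-- A change of the score by 1 costs `e^(ε/2)` in the weight of `x` and `e^(ε/2)` in the total
weight. -/
theorem binarySearch_private {ε : ℝ} (hε : 0 < ε) : QCPrivate (binarySearch ε) ε 0 := by
  intro G q q' _ _ hqq
  rcases G.eq_empty_or_nonempty with rfl | hG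
  · have h : binarySearch ε ∅ q = binarySearch ε ∅ q' := by simp [binarySearch, bisect]
    rw [h]
    exact CloseTo.refl _ hε.le
  refine CloseTo.of_apply_le fun x => ?_
  rw [binarySearch_apply ε hG, binarySearch_apply ε hG]
  split_ifs with hx
  · rw [← ENNReal.ofReal_mul (Real.exp_pos _).le]
    refine ENNReal.ofReal_le_ofReal ?_
    have key : ∀ y (f g : ℝ → ℝ), (∀ x, |f x - g x| ≤ 1) →
        Real.exp (ε * f y / 2) ≤ Real.exp (ε / 2) * Real.exp (ε * g y / 2) := by
      intro y f g h
      rw [← Real.exp_add, Real.exp_le_exp]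
      have := mul_le_mul_of_nonneg_left (le_of_abs_le (h y)) hε.le
      linarith
    have h1 := key x q q' hqq
    have h2 : ∑ y ∈ G, Real.exp (ε * q' y / 2) ≤
        Real.exp (ε / 2) * ∑ y ∈ G, Real.exp (ε * q y / 2) := by
      rw [Finset.mul_sum]
      exact Finset.sum_le_sum fun y _ => key y q' q fun x => by rw [abs_sub_comm]; exact hqq x
    have hp : ∀ f : ℝ → ℝ, 0 < ∑ y ∈ G, Real.exp (ε * f y / 2) := fun f =>
      Finset.sum_pos (fun _ _ => Real.exp_pos _) hG
    have he : Real.exp ε = Real.exp (ε / 2) * Real.exp (ε / 2) := by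
      rw [← Real.exp_add, add_halves]
    rw [← mul_div_assoc, div_le_div_iff₀ (hp q) (hp q'), he]
    calc Real.exp (ε * q x / 2) * ∑ y ∈ G, Real.exp (ε * q' y / 2)
        ≤ (Real.exp (ε / 2) * Real.exp (ε * q' x / 2)) *
          (Real.exp (ε / 2) * ∑ y ∈ G, Real.exp (ε * q y / 2)) :=
          mul_le_mul h1 h2 (hp q').le (by positivity)
      _ = _ := by ring
  · exact zero_le

/-- A candidate that misses the maximum by `α` has probability at most `e^(-εα/2) = 2^(-υ) β`, and
there are at most `2^υ` candidates. -/
theorem binarySearch_accurate {ε β : ℝ} (υ : ℕ) (hε : 0 < ε) (hβ : 0 < β) :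
    QCAccurate (binarySearch ε) υ β (alphaBinary υ ε β) := by
  intro G q hG hcard _
  rw [← fails_iff hβ.le]
  set α := alphaBinary υ ε β with hα
  obtain ⟨z, hz, hmax⟩ := G.exists_max_image q hG
  rw [Fails, prob, PMF.toOuterMeasure_apply]
  have hW : Real.exp (ε * q z / 2) ≤ ∑ y ∈ G, Real.exp (ε * q y / 2) :=
    Finset.single_le_sum (f := fun y => Real.exp (ε * q y / 2)) (fun _ _ => (Real.exp_pos _).le) hz
  rw [tsum_eq_sum (s := G)]
  · refine (Finset.sum_le_sum (g := fun _ => ENNReal.ofReal (Real.exp (-(ε * α / 2))))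
      fun x hx => ?_).trans ?_
    · by_cases hbad : x ∈ {x | x ∈ G ∧ ∀ y ∈ G, q y - α ≤ q x}
      · rw [Set.indicator_of_notMem (Set.notMem_compl_iff.2 hbad)]
        exact zero_le
      · rw [Set.indicator_of_mem hbad, binarySearch_apply ε hG, if_pos hx]
        refine ENNReal.ofReal_le_ofReal ?_
        rw [div_le_iff₀ ((Real.exp_pos _).trans_le hW)]
        refine le_trans ?_ (mul_le_mul_of_nonneg_left hW (Real.exp_pos _).le)
        rw [← Real.exp_add, Real.exp_le_exp]
        have h : q x ≤ q z - α := by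
          by_contra h
          exact hbad ⟨hx, fun y hy => by linarith [hmax y hy]⟩
        have := mul_le_mul_of_nonneg_left h hε.le
        linarith
    · rw [Finset.sum_const, nsmul_eq_mul, ← ENNReal.ofReal_natCast,
        ← ENNReal.ofReal_mul (Nat.cast_nonneg _)]
      refine ENNReal.ofReal_le_ofReal ?_
      have h1 : -(ε * α / 2) = -(υ * Real.log 2) + Real.log β := by
        rw [hα, alphaBinary, one_div, Real.log_inv]
        field_simp
        ring
      rw [h1, Real.exp_add, Real.exp_log hβ, Real.exp_neg, Real.exp_nat_mul,
        Real.exp_log two_pos, ← mul_assoc]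
      refine mul_le_of_le_one_left hβ.le ?_
      rw [← div_eq_mul_inv, div_le_one (by positivity)]
      exact_mod_cast hcard
  · intro x hx
    rw [Set.indicator_apply, binarySearch_apply ε hG, if_neg hx, ite_self]

/-! ### Bounds on the loss of depth -/

theorem four_mul_le_refinedBits {d b : ℕ} (hb : 1 ≤ b) : 4 * (d : ℝ) ^ 4 ≤ refinedBits d b := by
  rw [refinedBits]
  push_cast
  have h : (1 : ℝ) ≤ b := by exact_mod_cast hb
  exact le_mul_of_one_le_right (by positivity) h

theorem one_le_numCalls {d : ℕ} (hd : 1 ≤ d) : 1 ≤ numCalls d := by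
  have h : (1 : ℝ) ≤ d := by exact_mod_cast hd
  rw [numCalls]
  nlinarith

theorem numCalls_le (d : ℕ) : numCalls d ≤ 3 * (d : ℝ) ^ 2 := by
  rw [numCalls]
  nlinarith [sq_nonneg ((d : ℝ) - 1), sq_nonneg (d : ℝ)]

theorem numCalls_le_refinedBits {d b : ℕ} (hd : 1 ≤ d) (hb : 1 ≤ b) :
    numCalls d ≤ refinedBits d b := by
  have h : (1 : ℝ) ≤ d := by exact_mod_cast hd
  have h2 : (d : ℝ) ^ 2 ≤ (d : ℝ) ^ 4 := pow_le_pow_right₀ h (by norm_num)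
  linarith [numCalls_le d, four_mul_le_refinedBits (d := d) hb, sq_nonneg (d : ℝ)]

theorem four_le_refinedBits {d b : ℕ} (hd : 1 ≤ d) (hb : 1 ≤ b) :
    (4 : ℝ) ≤ refinedBits d b := by
  have h : (1 : ℝ) ≤ d := by exact_mod_cast hd
  linarith [four_mul_le_refinedBits (d := d) hb, one_le_pow₀ h (n := 4)]

theorem one_le_log_of_four_le {x : ℝ} (hx : 4 ≤ x) : 1 ≤ Real.log x := by
  rw [Real.le_log_iff_exp_le (by linarith)]
  linarith [Real.exp_one_lt_three]

theorem log_diamRounds_le {d b : ℕ} (hd : 1 ≤ d) (hb : 1 ≤ b) :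
    Real.log (diamRounds d (refinedBits d b) + 2) ≤ 4 * Real.log (refinedBits d b) := by
  have h : (1 : ℝ) ≤ d := by exact_mod_cast hd
  have h4 := four_le_refinedBits hd hb
  have hd4 : (d : ℝ) ≤ (d : ℝ) ^ 4 := le_self_pow₀ h (by norm_num)
  have hdυ := four_mul_le_refinedBits (d := d) hb
  have hlog := Real.log_le_self (x := (d : ℝ)) (by linarith)
  set υ := refinedBits d b
  have hceil := Nat.ceil_lt_add_one (a := (2 * (υ : ℝ) + Real.log d) / (1 / 10))
    (by have := Real.log_nonneg h; positivity)
  -- By `log d ≤ d ≤ d⁴ ≤ υ/4`, the left side is at most `22.5 υ + 3 ≤ 24 υ`, and `υ³ ≥ 64`.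
  have h1 : (diamRounds d υ : ℝ) + 2 ≤ (υ : ℝ) ^ 4 := by
    rw [diamRounds]
    have h3 : (24 : ℝ) * υ ≤ (υ : ℝ) ^ 4 := by
      have : (64 : ℝ) ≤ (υ : ℝ) ^ 3 :=
        le_trans (by norm_num) (pow_le_pow_left₀ (by norm_num) h4 3)
      nlinarith
    linarith
  have h2 := Real.log_le_log (by positivity) h1
  rwa [Real.log_pow] at h2

theorem log_pow_add_one_le (K : ℕ) {d : ℕ} (hd : 1 ≤ d) :
    Real.log (((K ^ d : ℕ) : ℝ) + 1) ≤ d * Real.log (K + 1) := by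
  rw [← Real.log_pow]
  refine Real.log_le_log (by positivity) ?_
  push_cast
  have h := pow_add_pow_le (x := (K : ℝ)) (y := 1) (Nat.cast_nonneg _) zero_le_one
    (Nat.one_le_iff_ne_zero.1 hd)
  rwa [one_pow] at h

/-- The loss in each logarithm is `4 log υ + log k` and `d log (K + 1) + log k`, with `k ≤ υ`; the
six copies of `log υ` give the constant 6, and `12 · 3 = 36` comes from `k ≤ 3 d²`. -/
theorem deltaDiam_add_deltaDir_le (K : ℕ) {d b : ℕ} (hd : 1 ≤ d) (hb : 1 ≤ b) {ε β : ℝ}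
    (hε : 0 < ε) (hβ : 0 < β) (hβ1 : β < 1) :
    deltaDiam d (refinedBits d b) (ε / numCalls d) (β / numCalls d) +
      deltaDir (K ^ d) (ε / numCalls d) (β / numCalls d) ≤
    36 * (6 + Real.log (K + 1)) *
      ((d : ℝ) ^ 3 * (Real.log (refinedBits d b) - Real.log β) / ε) := by
  have h : (1 : ℝ) ≤ d := by exact_mod_cast hd
  have h4 := four_le_refinedBits hd hb
  have hk := one_le_numCalls hd
  have hk3 := numCalls_le d
  have hkυ := numCalls_le_refinedBits hd hb
  have hlogυ := one_le_log_of_four_le h4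
  have hT := log_diamRounds_le hd hb
  have hKd := log_pow_add_one_le K hd
  have hlogβ := Real.log_neg hβ hβ1
  have hK : 0 ≤ Real.log ((K : ℝ) + 1) := Real.log_nonneg (by simp)
  set k := numCalls d
  set υ := refinedBits d b
  have hk0 : 0 < k := by linarith
  have hlogk : Real.log k ≤ Real.log υ := Real.log_le_log hk0 hkυ
  set ℓ := Real.log υ - Real.log β with hℓ
  have e : ∀ x : ℝ, 0 < x → Real.log (x / (β / k)) = Real.log x + Real.log k - Real.log β := by
    intro x hx
    rw [Real.log_div hx.ne' (by positivity), Real.log_div hβ.ne' hk0.ne']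
    ring
  rw [deltaDiam, deltaDir, e _ (by positivity), e _ (by positivity), ← add_div, div_div_eq_mul_div,
    ← mul_div_assoc]
  refine div_le_div_of_nonneg_right ?_ hε.le
  have hℓ1 : 1 ≤ ℓ := by linarith
  set X := 12 * (Real.log (diamRounds d υ + 2) + Real.log k - Real.log β) +
    12 * (Real.log (((K ^ d : ℕ) : ℝ) + 1) + Real.log k - Real.log β) with hX
  have hdK : d * Real.log ((K : ℝ) + 1) ≤ d * Real.log ((K : ℝ) + 1) * ℓ :=
    le_mul_of_one_le_right (by positivity) hℓ1
  have hdl : ℓ ≤ d * ℓ := le_mul_of_one_le_left (by linarith) h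
  have hXle : X ≤ 12 * (d * ((6 + Real.log (K + 1)) * ℓ)) := by
    have : X ≤ 12 * (d * Real.log ((K : ℝ) + 1)) + 72 * ℓ + 12 * (4 * Real.log β) := by
      rw [hX, hℓ]; linarith
    nlinarith
  calc X * k ≤ 12 * (d * ((6 + Real.log (K + 1)) * ℓ)) * (3 * (d : ℝ) ^ 2) :=
        mul_le_mul hXle hk3 hk0.le (by positivity)
    _ = _ := by ring

theorem deltaBB_binarySearch_le (K : ℕ) {d b : ℕ} (hd : 1 ≤ d) (hb : 1 ≤ b) {ε β : ℝ}
    (hε : 0 < ε) (hβ : 0 < β) (hβ1 : β < 1) :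
    deltaBB d (refinedBits d b) (K ^ d) ε β
      (alphaBinary (refinedBits d b) (ε / numCalls d) (β / numCalls d)) ≤
    (36 * (6 + Real.log (K + 1)) + 12) *
      ((d : ℝ) ^ 3 * ((refinedBits d b : ℝ) + Real.log (d / β)) / ε) := by
  have h : (1 : ℝ) ≤ d := by exact_mod_cast hd
  have hmain := deltaDiam_add_deltaDir_le K hd hb hε hβ hβ1
  have h4 := four_le_refinedBits hd hb
  have hk := one_le_numCalls hd
  have hk3 := numCalls_le d
  have hkυ := numCalls_le_refinedBits hd hb
  have hlogυ := Real.log_le_self (x := (refinedBits d b : ℝ)) (by linarith)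
  have hlogβ := Real.log_neg hβ hβ1
  have hlogd := Real.log_nonneg h
  have hK : 0 ≤ Real.log ((K : ℝ) + 1) := Real.log_nonneg (by simp)
  rw [deltaBB, add_mul]
  set k := numCalls d
  set υ := refinedBits d b
  have hk0 : 0 < k := by linarith
  have hlogk : Real.log k ≤ Real.log υ := Real.log_le_log hk0 hkυ
  rw [Real.log_div (by positivity) hβ.ne']
  refine add_le_add (hmain.trans ?_) ?_
  · gcongr
    linarith
  · have hα : alphaBinary υ (ε / k) (β / k) ≤
        4 * ((υ : ℝ) + (Real.log d - Real.log β)) * k / ε := by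
      rw [alphaBinary, one_div_div, Real.log_div hk0.ne' hβ.ne', div_div_eq_mul_div]
      have h2 : (υ : ℝ) * Real.log 2 ≤ υ :=
        mul_le_of_le_one_right (by linarith) (by linarith [Real.log_two_lt_d9])
      refine div_le_div_of_nonneg_right (mul_le_mul_of_nonneg_right ?_ hk0.le) hε.le
      linarith
    calc (d : ℝ) * alphaBinary υ (ε / k) (β / k)
        ≤ d * (4 * ((υ : ℝ) + (Real.log d - Real.log β)) * (3 * (d : ℝ) ^ 2) / ε) := by
          refine mul_le_mul_of_nonneg_left (hα.trans ?_) (by linarith)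
          gcongr
          linarith
      _ = _ := by ring

/-- Dividing three parameters by `k ≤ υ` adds at most `3 log υ`, so `L₀ ≤ 4 L` and `log (2 + L₀) ≤
log 4 + log (2 + L) ≤ 3 log (2 + L)`. -/
theorem deltaBB_betweenThresholds_le (K c : ℕ) (a : ℝ) {d b : ℕ} (hd : 1 ≤ d) (hb : 1 ≤ b)
    {ε δ β α L L₀ : ℝ} (hε : 0 < ε) (hε1 : ε ≤ 1) (hδ : 0 < δ) (hδ1 : δ ≤ 1) (hβ : 0 < β)
    (hβ1 : β < 1)
    (hL₀ : L₀ = Real.log (refinedBits d b /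
      (β / numCalls d * (ε / numCalls d) * (δ / numCalls d))))
    (hL : L = Real.log (d * refinedBits d b / (ε * δ * β)))
    (hα : α ≤ a * (L₀ * Real.log (2 + L₀) ^ c / (ε / numCalls d))) :
    deltaBB d (refinedBits d b) (K ^ d) ε β α ≤
      (36 * (6 + Real.log (K + 1)) + 12 * 3 ^ c * |a|) *
        ((d : ℝ) ^ 3 * (L * Real.log (2 + L) ^ c) / ε) := by
  have h : (1 : ℝ) ≤ d := by exact_mod_cast hd
  have hmain := deltaDiam_add_deltaDir_le K hd hb hε hβ hβ1
  have h4 := four_le_refinedBits hd hb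
  have hk := one_le_numCalls hd
  have hk3 := numCalls_le d
  have hkυ := numCalls_le_refinedBits hd hb
  have hlogυ := one_le_log_of_four_le h4
  have hlogβ := Real.log_neg hβ hβ1
  have hlogε := Real.log_nonpos hε.le hε1
  have hlogδ := Real.log_nonpos hδ.le hδ1
  have hlogd := Real.log_nonneg h
  have hlogk0 := Real.log_nonneg hk
  have hK : 0 ≤ Real.log ((K : ℝ) + 1) := Real.log_nonneg (by simp)
  rw [deltaBB, add_mul]
  set k := numCalls d
  set υ := refinedBits d b
  have hk0 : 0 < k := by linarith
  have hυ0 : (0 : ℝ) < υ := by linarith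
  have hlogk : Real.log k ≤ Real.log υ := Real.log_le_log hk0 hkυ
  have hd0 : (0 : ℝ) < d := by linarith
  rw [Real.log_div (by positivity) (by positivity), Real.log_mul (by positivity) (by positivity),
    Real.log_mul (by positivity) (by positivity), Real.log_mul (by positivity) (by positivity)] at hL
  rw [Real.log_div (by positivity) (by positivity), Real.log_mul (by positivity) (by positivity),
    Real.log_mul (by positivity) (by positivity), Real.log_div hβ.ne' hk0.ne',
    Real.log_div hε.ne' hk0.ne', Real.log_div hδ.ne' hk0.ne'] at hL₀
  have hlog4 : Real.log 4 ≤ Real.log υ := Real.log_le_log (by norm_num) h4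
  have hlog4' : Real.log 4 = 2 * Real.log 2 := by
    rw [← Real.log_rpow two_pos]; norm_num
  have hl2 := Real.log_two_gt_d9
  have hl2' := Real.log_two_lt_d9
  have hL1 : Real.log 4 ≤ L := by linarith
  have hlogL : 1 ≤ Real.log (2 + L) := by
    rw [Real.le_log_iff_exp_le (by linarith)]
    linarith [Real.exp_one_lt_d9]
  have hL₀0 : 0 ≤ L₀ := by linarith
  have hL₀L : L₀ ≤ 4 * L := by linarith
  have hlogL₀0 : 0 ≤ Real.log (2 + L₀) := Real.log_nonneg (by linarith)
  have hlogL₀ : Real.log (2 + L₀) ≤ 3 * Real.log (2 + L) := by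
    have h1 : Real.log (2 + L₀) ≤ Real.log (4 * (2 + L)) :=
      Real.log_le_log (by linarith) (by linarith)
    rw [Real.log_mul (by norm_num) (by linarith)] at h1
    linarith
  have hL0 : 0 ≤ L := by linarith
  refine add_le_add (hmain.trans ?_) ?_
  · gcongr
    calc Real.log υ - Real.log β ≤ L * 1 := by linarith
      _ ≤ _ := mul_le_mul_of_nonneg_left (one_le_pow₀ hlogL) hL0
  · have hα' : α ≤ |a| * (4 * L * (3 * Real.log (2 + L)) ^ c / (ε / k)) := by
      refine hα.trans ?_
      refine mul_le_mul (le_abs_self a) ?_ (by positivity) (abs_nonneg a)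
      gcongr
    rw [div_div_eq_mul_div] at hα'
    calc (d : ℝ) * α
        ≤ d * (|a| * (4 * L * (3 * Real.log (2 + L)) ^ c * (3 * (d : ℝ) ^ 2) / ε)) := by
          refine mul_le_mul_of_nonneg_left (hα'.trans ?_) hd0.le
          gcongr
      _ = _ := by rw [mul_pow]; ring

/-- With `s = 1` the term `log (d s / (δ β))` could be arbitrarily close to 0 and would not absorb
the constant from `log k`. For `s ≥ 2` it is at least `log 2`. -/
theorem logStar_ne_one {x : ℝ} (hx : 2 < x) : logStar x ≠ 1 := by
  intro h
  have hmem : logStar x ∈ {n : ℕ | (Real.logb 2)^[n] x ≤ 1} :=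
    Nat.sInf_mem (Nat.nonempty_of_pos_sInf (by rw [← logStar, h]; exact one_pos))
  rw [h] at hmem
  have h1 : Real.logb 2 x ≤ 1 := hmem
  rw [Real.logb_le_iff_le_rpow one_lt_two (by linarith), Real.rpow_one] at h1
  linarith

theorem deltaBB_recConcave_le (K : ℕ) (a : ℝ) {d b s : ℕ} (hd : 1 ≤ d) (hb : 1 ≤ b)
    {ε δ β α : ℝ} (hε : 0 < ε) (hδ : 0 < δ) (hδ1 : δ ≤ 1) (hβ : 0 < β) (hβ1 : β < 1)
    (hs : s ≠ 1)
    (hα : α ≤ a * (8 ^ s * (s : ℝ) / (ε / numCalls d) *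
      Real.log (s / (β / numCalls d * (δ / numCalls d))))) :
    deltaBB d (refinedBits d b) (K ^ d) ε β α ≤
      (36 * (6 + Real.log (K + 1)) + 27 * |a|) *
        ((d : ℝ) ^ 3 * Real.log (d * refinedBits d b / β) / ε +
          (d : ℝ) ^ 3 * (8 ^ s * (s : ℝ)) * Real.log (d * s / (δ * β)) / ε) := by
  have h : (1 : ℝ) ≤ d := by exact_mod_cast hd
  have hmain := deltaDiam_add_deltaDir_le K hd hb hε hβ hβ1
  have h4 := four_le_refinedBits hd hb
  have hk := one_le_numCalls hd
  have hk3 := numCalls_le d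
  have hlogυ := one_le_log_of_four_le h4
  have hlogβ := Real.log_neg hβ hβ1
  have hlogδ := Real.log_nonpos hδ.le hδ1
  have hlogd := Real.log_nonneg h
  have hlogk0 := Real.log_nonneg hk
  have hK : 0 ≤ Real.log ((K : ℝ) + 1) := Real.log_nonneg (by simp)
  rw [deltaBB]
  set k := numCalls d
  set υ := refinedBits d b
  have hk0 : 0 < k := by linarith
  have hυ0 : (0 : ℝ) < υ := by linarith
  have hd0 : (0 : ℝ) < d := by linarith
  have hX : Real.log υ - Real.log β ≤ Real.log (d * υ / β) := by
    rw [Real.log_div (by positivity) hβ.ne', Real.log_mul hd0.ne' hυ0.ne']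
    linarith
  have hX0 : 0 ≤ Real.log (d * υ / β) := by linarith
  have hfirst : deltaDiam d υ (ε / k) (β / k) + deltaDir (K ^ d) (ε / k) (β / k) ≤
      36 * (6 + Real.log (K + 1)) * ((d : ℝ) ^ 3 * Real.log (d * υ / β) / ε) := by
    refine hmain.trans ?_
    gcongr
  -- For `s = 0` the assumed accuracy is at most 0, so there is nothing to absorb.
  rcases Nat.eq_zero_or_pos s with rfl | hs0
  · have hα0 : α ≤ 0 := by simpa using hα
    have h0 : (d : ℝ) * α ≤ 0 := mul_nonpos_of_nonneg_of_nonpos hd0.le hα0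
    have h1 : 0 ≤ 27 * |a| * ((d : ℝ) ^ 3 * Real.log (d * υ / β) / ε) := by positivity
    simp only [Nat.cast_zero, mul_zero, zero_mul, zero_div, add_zero]
    rw [add_mul]
    linarith
  · have hs2 : (2 : ℝ) ≤ s := by exact_mod_cast (by omega : 2 ≤ s)
    have hlogs : Real.log 2 ≤ Real.log s := Real.log_le_log two_pos hs2
    have hl2 := Real.log_two_gt_d9
    -- From `k ≤ 3 d² ≤ 4 d²`; since `2 log 2 = log 4` and `log 2 ≤ log s`, the logarithm in `hα` is
    -- at most `9 m`.
    have hlogk : Real.log k ≤ Real.log 4 + 2 * Real.log d := by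
      rw [← Nat.cast_two (R := ℝ), ← Real.log_pow, ← Real.log_mul (by norm_num) (by positivity)]
      exact Real.log_le_log hk0 (by nlinarith)
    have hlog4 : Real.log 4 = 2 * Real.log 2 := by
      rw [← Real.log_rpow two_pos]; norm_num
    have hM : Real.log (d * s / (δ * β)) =
        Real.log d + Real.log s - Real.log δ - Real.log β := by
      rw [Real.log_div (by positivity) (by positivity), Real.log_mul (by positivity) (by positivity),
        Real.log_mul (by positivity) (by positivity)]
      ring
    set m := Real.log (d * s / (δ * β))
    have hm0 : 0 ≤ m := by linarith
    have hlog : Real.log (s / (β / k * (δ / k))) =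
        Real.log s + 2 * Real.log k - Real.log β - Real.log δ := by
      rw [Real.log_div (by positivity) (by positivity), Real.log_mul (by positivity) (by positivity),
        Real.log_div (by positivity) (by positivity), Real.log_div (by positivity) (by positivity)]
      ring
    rw [hlog] at hα
    have hα' : α ≤ |a| * (8 ^ s * (s : ℝ) / (ε / k) * (9 * m)) := by
      refine hα.trans ?_
      refine mul_le_mul (le_abs_self a) ?_
        (mul_nonneg (by positivity) (by linarith)) (abs_nonneg a)
      gcongr
      linarith
    rw [div_div_eq_mul_div] at hα'
    have hsecond : (d : ℝ) * α ≤ 27 * |a| * ((d : ℝ) ^ 3 * (8 ^ s * (s : ℝ)) * m / ε) := by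
      calc (d : ℝ) * α
          ≤ d * (|a| * (8 ^ s * (s : ℝ) * (3 * (d : ℝ) ^ 2) / ε * (9 * m))) := by
            refine mul_le_mul_of_nonneg_left (hα'.trans ?_) hd0.le
            gcongr
        _ = _ := by ring
    have h1 : 0 ≤ 27 * |a| * ((d : ℝ) ^ 3 * Real.log (d * υ / β) / ε) := by positivity
    have h2 : 0 ≤ 36 * (6 + Real.log (K + 1)) *
        ((d : ℝ) ^ 3 * (8 ^ s * (s : ℝ)) * m / ε) := by positivity
    rw [add_mul, mul_add, mul_add]
    linarith

/-- A number `K` such that the angle covers have at most `K ^ j` vectors is positive. -/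
theorem Directions.one_le_of_length_le (D : Directions) {K : ℕ}
    (h : (D.V 1).length ≤ K ^ 1) : 1 ≤ K := by
  rw [pow_one] at h
  obtain ⟨v, hv, -⟩ := (D.V_cover 1).2 (e₀ 0) (by simp [e₀])
  have h1 : 0 < (D.V 1).length := List.length_pos_of_mem hv
  omega

end

/-! ### Assembly of the five statements -/

theorem mainTheorem3 :
    -- privacy and utility, for any private maximizer `M` of quasi-concave functions
    (∀ (D : Directions) (M : ℝ → ℝ → ℝ → QCAlgorithm) (d b m : ℕ) (ε δ β κ : ℝ),
      1 ≤ d → 1 ≤ b → (∀ j ≤ d, (D.V j).length ≤ m) → 0 < ε → 0 ≤ δ → 0 < β → β < 1 →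
      QCPrivate (M (ε / numCalls d) (δ / numCalls d) (β / numCalls d))
        (ε / numCalls d) (δ / numCalls d) →
      IsDP (fun P : Finset (E d) => boundingBox D M b ε δ β κ P) ε δ ∧
      ∀ α : ℝ,
        QCAccurate (M (ε / numCalls d) (δ / numCalls d) (β / numCalls d)) (refinedBits d b)
          (β / numCalls d) α →
        ∀ P : Finset (E d), (P : Set (E d)) ⊆ gridPoints d b → 0 < κ →
          0 < MeasureTheory.volume (tukeyRegion P κ) →
          (tukeyRegion P (κ + d * α)).Nonempty →
          ENNReal.ofReal (1 - β) ≤ prob (boundingBox D M b ε δ β κ P)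
            {B | GoodBox P κ (deltaBB d (refinedBits d b) m ε β α) B}) ∧
    -- the binary search is such a maximizer
    (∀ (ε β : ℝ) (υ : ℕ), 0 < ε → 0 < β → β < 1 →
      QCPrivate (binarySearch ε) ε 0 ∧
      QCAccurate (binarySearch ε) υ β (alphaBinary υ ε β)) ∧
    -- the resulting guarantee with the binary search
    (∀ K : ℕ, ∃ C : ℝ, 0 < C ∧
      ∀ (D : Directions) (d b : ℕ) (ε β κ : ℝ),
      1 ≤ d → 1 ≤ b → (∀ j ≤ d, (D.V j).length ≤ K ^ j) → 0 < ε → 0 < β → β < 1 →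
      IsDP (fun P : Finset (E d) =>
        boundingBox D (fun ε' _ _ => binarySearch ε') b ε 0 β κ P) ε 0 ∧
      deltaBB d (refinedBits d b) (K ^ d) ε β
          (alphaBinary (refinedBits d b) (ε / numCalls d) (β / numCalls d))
        ≤ C * ((d : ℝ) ^ 3 * ((refinedBits d b : ℝ) + Real.log (d / β)) / ε) ∧
        ∀ P : Finset (E d), (P : Set (E d)) ⊆ gridPoints d b → 0 < κ →
          0 < MeasureTheory.volume (tukeyRegion P κ) →
          (tukeyRegion P (κ + d * alphaBinary (refinedBits d b) (ε / numCalls d)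
            (β / numCalls d))).Nonempty →
          ENNReal.ofReal (1 - β) ≤
            prob (boundingBox D (fun ε' _ _ => binarySearch ε') b ε 0 β κ P)
              {B | GoodBox P κ
                (C * ((d : ℝ) ^ 3 * ((refinedBits d b : ℝ) + Real.log (d / β)) / ε)) B}) ∧
    -- the loss for a maximizer with the accuracy of the "Between Thresholds" algorithm
    (∀ (K c : ℕ) (a : ℝ), ∃ C : ℝ, 0 < C ∧
      ∀ (d b : ℕ) (ε δ β α : ℝ), 1 ≤ d → 1 ≤ b → 0 < ε → ε ≤ 1 → 0 < δ → δ ≤ 1 →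
      0 < β → β < 1 →
      (let L₀ := Real.log (refinedBits d b /
        (β / numCalls d * (ε / numCalls d) * (δ / numCalls d)))
       α ≤ a * (L₀ * Real.log (2 + L₀) ^ c / (ε / numCalls d))) →
      let L := Real.log (d * refinedBits d b / (ε * δ * β))
      deltaBB d (refinedBits d b) (K ^ d) ε β α
        ≤ C * ((d : ℝ) ^ 3 * (L * Real.log (2 + L) ^ c) / ε)) ∧
    -- the loss for a maximizer with the accuracy of the "RecConcave" algorithm
    (∀ (K : ℕ) (a : ℝ), ∃ C : ℝ, 0 < C ∧
      ∀ (d b : ℕ) (ε δ β α : ℝ), 1 ≤ d → 1 ≤ b → 0 < ε → 0 < δ → δ ≤ 1 →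
      0 < β → β < 1 →
      (let S : ℝ := logStar (refinedBits d b)
       α ≤ a * (8 ^ logStar (refinedBits d b) * S / (ε / numCalls d) *
        Real.log (S / (β / numCalls d * (δ / numCalls d))))) →
      let S : ℝ := logStar (refinedBits d b)
      deltaBB d (refinedBits d b) (K ^ d) ε β α
        ≤ C * ((d : ℝ) ^ 3 * Real.log (d * refinedBits d b / β) / ε +
          (d : ℝ) ^ 3 * (8 ^ logStar (refinedBits d b) * S) * Real.log (d * S / (δ * β)) / ε)) := by
  refine ⟨?_, ?_, ?_, ?_, ?_⟩
  · intro D M d b m ε δ β κ hd hb hm hε hδ hβ hβ1 hM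
    exact ⟨boundingBox_isDP D M d b β κ hd hε hδ hM, fun α hacc P hP hκ hvol hne =>
      boundingBox_accurate D M hd hb hm hε hβ hβ1 hacc hP hκ hvol hne le_rfl⟩
  · exact fun ε β υ hε hβ _ => ⟨binarySearch_private hε, binarySearch_accurate υ hε hβ⟩
  · intro K
    have hK : 0 ≤ Real.log ((K : ℝ) + 1) := Real.log_nonneg (by simp)
    refine ⟨36 * (6 + Real.log (K + 1)) + 12, by positivity, ?_⟩
    intro D d b ε β κ hd hb hV hε hβ hβ1
    have hk := numCalls_pos hd
    have hΔ := deltaBB_binarySearch_le K hd hb hε hβ hβ1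
    -- Needed for `K^j ≤ K^d`, so that `m = K^d` bounds all covers.
    have hK1 : 1 ≤ K := D.one_le_of_length_le (hV 1 hd)
    have hpriv := binarySearch_private (div_pos hε hk)
    rw [← zero_div (numCalls d)] at hpriv
    have hacc := binarySearch_accurate (refinedBits d b) (div_pos hε hk) (div_pos hβ hk)
    exact ⟨boundingBox_isDP D (fun ε' _ _ => binarySearch ε') d b β κ hd hε le_rfl hpriv, hΔ,
      fun P hP hκ hvol hne => boundingBox_accurate D (fun ε' _ _ => binarySearch ε') hd hb
        (fun j hj => (hV j hj).trans (Nat.pow_le_pow_right hK1 hj)) hε hβ hβ1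
        hacc hP hκ hvol hne hΔ⟩
  · intro K c a
    have hK : 0 ≤ Real.log ((K : ℝ) + 1) := Real.log_nonneg (by simp)
    exact ⟨36 * (6 + Real.log (K + 1)) + 12 * 3 ^ c * |a|, by positivity,
      fun d b ε δ β α hd hb hε hε1 hδ hδ1 hβ hβ1 hα =>
        deltaBB_betweenThresholds_le K c a hd hb hε hε1 hδ hδ1 hβ hβ1 rfl rfl hα⟩
  · intro K a
    have hK : 0 ≤ Real.log ((K : ℝ) + 1) := Real.log_nonneg (by simp)
    exact ⟨36 * (6 + Real.log (K + 1)) + 27 * |a|, by positivity,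
      fun d b ε δ β α hd hb hε hδ hδ1 hβ hβ1 hα =>
        deltaBB_recConcave_le K a hd hb hε hδ hδ1 hβ hβ1
          (logStar_ne_one (by linarith [four_le_refinedBits hd hb])) hα⟩
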